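/- **Definition.** Submanifolds are smooth and embedded. Let $N$ be a (not necessarily connected) smooth manifold without boundary. A *compact smooth polyhedron* $P\subset N$ of dimension $d$, and its *faces*, are defined by induction on $d$. For $d=0$, $P$ is a finite subset of $N$; its only faces are its points, which have codimension $0$, each being its own interior and having empty boundary. For $d>0$, $P$ is a finite disjoint union of its codimension $0$ faces $F_i$, where: * each $F_i$ is connected and compact and is contained in a connected $d$-dimensional submanifold $S_i\subset N$; its *interior* $\mathring F_i$, taken relative to $S_i$, is nonempty, and $F_i=\mathrm{Cl}\,\mathring F_i$; * the boundary $\partial F_i:=F_i\setminus\mathring F_i$ is a (possibly empty) finite union $\bigcup_j s_{ij}$ of connected (in particular nonempty) compact smooth polyhedra $s_{ij}\subset N$ of dimension $d-1$, the codimension $1$ faces of $P$; for $k\ge 0$, the codimension $k+1$ faces of $P$ are the codimension $k$ faces of the $s_{ij}$; * for $j_1\ne j_2$, $s_{ij_1}\cap s_{ij_2}=\partial s_{ij_1}\cap\partial s_{ij_2}$, and this set is a (possibly empty) union of common faces of $s_{ij_1}$ and $s_{ij_2}$. **Lemma 3.2.** Let $M$ be a complete $n$-dimensional Riemannian manifold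 without boundary (not necessarily connected; points of different components are at infinite distance), let $P\subset M$ be a compact smooth polyhedron of dimension $d$, and let $x\in P$. For $\delta>0$, let $S(x,\delta)$ be the metric sphere of radius $\delta$ centred at $x$. Then there exists $\delta(x)>0$ such that the following holds for every $0<\delta\le\delta(x)$. 1. $S(x,\delta)$ is a submanifold of $M$ of dimension $n-1$ (empty if $n=0$), and it intersects only those faces $f$ of $P$ that properly contain $x$, i.e. $\{x\}\subsetneq f$. 2. $S(x,\delta)\cap P$, with suitable faces, is a compact smooth polyhedron of dimension $d-1$ in the manifold $S(x,\delta)$, hence also in $M$ (if $d=0$, then $S(x,\delta)\cap P=\varnothing$). 3. For every $k\ge0$, the codimension $k$ faces of this polyhedron are exactly the connected components of the sets $S(x,\delta)\cap f$, where $f$ runs over the codimension $k$ faces of $P$ containing $x$. 4. If a codimension $k$ face $c$ of $S(x,\delta)\cap P$ is a connected component of $S(x,\delta)\cap f$, where $f$ is a codimension $k$ face of $P$ containing $x$, then $\mathring c=c\cap\mathring f$. -/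

import Mathlib

open Set Bundle
open scoped Manifold ContDiff

namespace SmoothPolyhedra

/-- `S` is an (embedded) smooth submanifold of dimension `d` of the smooth manifold `M` (without
boundary, modelled on `E`): around each of its points there is a smooth chart of `M` in which `S`
becomes a `d`-dimensional linear subspace of `E`. -/
def IsSubmanifold (E : Type*) [NormedAddCommGroup E] [NormedSpace ℝ E]
    {M : Type*} [TopologicalSpace M] [ChartedSpace E M] (d : ℕ) (S : Set M) : Prop :=
  ∀ p ∈ S, ∃ φ ∈ IsManifold.maximalAtlas 𝓘(ℝ, E) ∞ M, p ∈ φ.source ∧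
    ∃ V : Submodule ℝ E, Module.finrank ℝ V = d ∧ ∀ q ∈ φ.source, (q ∈ S ↔ φ q ∈ V)

/-- The topological interior of `F` relative to the subspace `S`, as a subset of `M`. -/
def relInterior {M : Type*} [TopologicalSpace M] (S F : Set M) : Set M :=
  ((↑) : S → M) '' interior (((↑) : S → M) ⁻¹' F)

/-- A face: a subset together with its interior (for the faces of a compact smooth polyhedron the
interior is forced to be the interior relative to a submanifold of the face). -/
@[ext]
structure Face (M : Type*) where
  carrier : Set M
  interior : Set M

/-- The boundary of a face. -/
def Face.boundary {M : Type*} (f : Face M) : Set M := f.carrier \ f.interior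

/-- A subset of `M` together with, for each `k`, the set of its codimension `k` faces. -/
@[ext]
structure FacedSet (M : Type*) where
  carrier : Set M
  faces : ℕ → Set (Face M)

/-- The boundary of a set with faces: the points of it that are not in the interior of a
codimension `0` face. -/
def FacedSet.boundary {M : Type*} (P : FacedSet M) : Set M :=
  P.carrier \ ⋃ f ∈ P.faces 0, f.interior

/-- `IsCompactSmoothPolyhedron E A d P`: the set `P` with its faces is a compact smooth polyhedron
of dimension `d` in the smooth manifold `A`, where `A` is `M` (that is, `Set.univ`) or a smooth
submanifold of `M`. In the latter case the submanifolds of the faces have to lie in `A`. -/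
inductive IsCompactSmoothPolyhedron (E : Type*) [NormedAddCommGroup E] [NormedSpace ℝ E]
    {M : Type*} [TopologicalSpace M] [ChartedSpace E M] (A : Set M) : ℕ → FacedSet M → Prop
  /-- Dimension `0`: a finite set, whose only faces are its points, of codimension `0`. -/
  | zero (P : FacedSet M)
      (finite : P.carrier.Finite)
      (subset : P.carrier ⊆ A)
      (faces_zero : P.faces 0 = {f | ∃ p ∈ P.carrier, f = ⟨{p}, {p}⟩})
      (faces_succ : ∀ k, P.faces (k + 1) = ∅) :
      IsCompactSmoothPolyhedron E A 0 P
  /-- Dimension `d + 1`: `F i` are the codimension `0` faces, `S i` is a submanifold of the face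
  `F i`, and `s i j` are the codimension `1` faces into which the boundary of `F i` decomposes;
  each `s i j` comes with its own faces. -/
  | succ (d : ℕ) (P : FacedSet M) (m : ℕ) (F : Fin m → Face M) (S : Fin m → Set M)
      (r : Fin m → ℕ) (s : (i : Fin m) → Fin (r i) → FacedSet M)
      (carrier_eq : P.carrier = ⋃ i, (F i).carrier)
      (disjoint : ∀ i i', i ≠ i' → Disjoint (F i).carrier (F i').carrier)
      (connected : ∀ i, IsConnected (F i).carrier)
      (compact : ∀ i, IsCompact (F i).carrier)
      (submanifold : ∀ i, IsSubmanifold E (d + 1) (S i))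
      (submanifold_connected : ∀ i, IsConnected (S i))
      (submanifold_subset : ∀ i, S i ⊆ A)
      (subset_submanifold : ∀ i, (F i).carrier ⊆ S i)
      (interior_eq : ∀ i, (F i).interior = relInterior (S i) (F i).carrier)
      (interior_nonempty : ∀ i, (F i).interior.Nonempty)
      (closure_interior : ∀ i, (F i).carrier = closure (F i).interior)
      (boundary_eq : ∀ i, (F i).boundary = ⋃ j, (s i j).carrier)
      (side_connected : ∀ i j, IsConnected (s i j).carrier)
      (side_polyhedron : ∀ i j, IsCompactSmoothPolyhedron E A d (s i j))
      (sides_inter : ∀ i j j', j ≠ j' →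
        (s i j).carrier ∩ (s i j').carrier = (s i j).boundary ∩ (s i j').boundary)
      (sides_inter_faces : ∀ i j j', j ≠ j' → ∃ U : Set (Face M),
        (∀ f ∈ U, ∃ k, f ∈ (s i j).faces k ∧ f ∈ (s i j').faces k) ∧
        (s i j).carrier ∩ (s i j').carrier = ⋃ f ∈ U, f.carrier)
      (faces_zero : P.faces 0 = range F)
      (faces_succ : ∀ k, P.faces (k + 1) = ⋃ i, ⋃ j, (s i j).faces k) :
      IsCompactSmoothPolyhedron E A (d + 1) P

/-- The metric sphere of radius `δ` centred at `x`. (In a nonconnected riemannian manifold, the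
distance between points of different components is infinite.) -/
def sphere {M : Type*} [EMetricSpace M] (x : M) (δ : ℝ) : Set M :=
  {y | edist y x = ENNReal.ofReal δ}

end SmoothPolyhedra

/-! The distance enters through one fact: near `x` the squared distance `r` to `x` is smooth and
bounded below by a multiple of the squared norm in a chart (`exists_smooth_sq_dist`). In a chart at
`x`, the geodesic equation is solved as a fixed point equation for the acceleration in `C([0,1],
E)`, so the inverse function theorem gives a smooth exponential map. The energy of the geodesic from
`x` to `y` is a smooth function `ρ` of `y`. Geodesics show that the distance is at most `√ρ`. The
Gauss lemma bounds the gradient of `√ρ` by `1`, and integrating this along arbitrary paths gives the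
reverse inequality.

Such an `r` increases in radial directions near `x` in every smooth chart (`isRadial_of_le`). If a
submanifold `S` through `x` is linear in a chart centred at `x`, the rays from `x` through points of
`S` stay in `S`. Hence `r` has nonzero derivative along `S` at the points of `S` near `x` other than
`x` (`IsRadial.eventually_isTransverse`), and a small sphere `L` cuts `S` in a submanifold of one
dimension less. Faces missing `x` are compact and finitely many, so small spheres avoid them.

The slices are assembled by induction on the dimension (`exists_link_of_face`). Let `F` be a face
through `x` in a submanifold `S`. Near an interior point of a side, `F` is a half space of `S`
bounded by that side, and `L` crosses the side transversally; so `L` meets both the interior of `F`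
and `S \ F` arbitrarily close to that point (`IsLevel.mem_closure_of_boundary`). By induction such
points are dense in the sliced sides. Therefore `L ∩ F` is the closure of its part in the interior
of `F`, which is also its interior relative to `L ∩ S`. A component of `L ∩ F` missing the boundary
is open and closed in `L ∩ S`, and only finitely many others exist by induction; by compactness
there are finitely many components. These are the new faces of codimension `0`.

Interiors are compared through `intrinsicInterior`, which depends only on the set and the dimension.
A face is thus determined by its carrier and dimension, so that slices of a common face of two sides
are common faces of the sliced sides. -/

namespace SmoothPolyhedra

open Filter Topology

set_option linter.unusedSectionVars false

/-! ### Superposition operators on spaces of continuous maps -/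

section Superposition

universe u

variable {X : Type*} [TopologicalSpace X] [CompactSpace X]
  {E F : Type u} [NormedAddCommGroup E] [NormedSpace ℝ E] [NormedAddCommGroup F] [NormedSpace ℝ F]

/-- Pointwise application of a continuous bilinear map to continuous functions. -/
noncomputable def pointwiseBilin {G E F : Type*} [NormedAddCommGroup G] [NormedSpace ℝ G]
    [NormedAddCommGroup E] [NormedSpace ℝ E] [NormedAddCommGroup F] [NormedSpace ℝ F]
    (B : G →L[ℝ] E →L[ℝ] F) : C(X, G) →L[ℝ] C(X, E) →L[ℝ] C(X, F) :=
  LinearMap.mkContinuous₂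
    (LinearMap.mk₂ ℝ (fun (A : C(X, G)) (u : C(X, E)) =>
      (⟨fun t => B (A t) (u t), by fun_prop⟩ : C(X, F)))
      (fun _ _ _ => by ext; simp) (fun _ _ _ => by ext; simp)
      (fun _ _ _ => by ext; simp) (fun _ _ _ => by ext; simp)) ‖B‖
    (fun A u => by
      rw [ContinuousMap.norm_le _ (by positivity)]
      intro t
      refine (B.le_opNorm₂ (A t) (u t)).trans ?_
      gcongr
      · exact A.norm_coe_le_norm t
      · exact u.norm_coe_le_norm t)

@[simp] theorem pointwiseBilin_apply {G E F : Type*} [NormedAddCommGroup G] [NormedSpace ℝ G]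
    [NormedAddCommGroup E] [NormedSpace ℝ E] [NormedAddCommGroup F] [NormedSpace ℝ F]
    (B : G →L[ℝ] E →L[ℝ] F) (A : C(X, G)) (u : C(X, E)) (t : X) :
    pointwiseBilin B A u t = B (A t) (u t) := rfl

noncomputable instance instNormedAddCommGroupContinuousMapCLM :
    NormedAddCommGroup C(X, E →L[ℝ] F) := ContinuousMap.instNormedAddCommGroup

noncomputable instance instSeminormedAddCommGroupContinuousMapCLM :
    SeminormedAddCommGroup C(X, E →L[ℝ] F) :=
  instNormedAddCommGroupContinuousMapCLM.toSeminormedAddCommGroup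

noncomputable instance instNormedSpaceContinuousMapCLM :
    NormedSpace ℝ C(X, E →L[ℝ] F) := ContinuousMap.normedSpace

/-- The mean value inequality on the segment from `u t` to `u t + h t` bounds the remainder by `ε *
‖h t‖`, uniformly in `t`, because `v ↦ f' ∘ v` is continuous for the sup norm. -/
theorem hasFDerivAt_superposition {f : E → F} {f' : E → E →L[ℝ] F}
    (hf : ∀ y, HasFDerivAt f (f' y) y) (hc : Continuous f) (hc' : Continuous f') (u : C(X, E)) :
    HasFDerivAt (fun v : C(X, E) => (⟨f, hc⟩ : C(E, F)).comp v)
      (pointwiseBilin (ContinuousLinearMap.id ℝ (E →L[ℝ] F)) ((⟨f', hc'⟩ : C(E, E →L[ℝ] F)).comp u)) u := by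
  rw [hasFDerivAt_iff_isLittleO_nhds_zero, Asymptotics.isLittleO_iff]
  intro ε hε
  have hcont : ContinuousAt (fun v : C(X, E) => (⟨f', hc'⟩ : C(E, E →L[ℝ] F)).comp v) u :=
    (ContinuousMap.continuous_postcomp _).continuousAt
  obtain ⟨δ, hδ, H⟩ := Metric.continuousAt_iff.1 hcont ε hε
  filter_upwards [Metric.ball_mem_nhds (0 : C(X, E)) hδ] with h hh
  rw [ContinuousMap.norm_le _ (by positivity)]
  intro t
  have key : ∀ z ∈ segment ℝ (u t) (u t + h t), ‖f' z - f' (u t)‖ ≤ ε := by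
    intro z hz
    rw [segment_eq_image'] at hz
    obtain ⟨s, hs, rfl⟩ := hz
    have h1 : dist (u + s • h) u < δ := by
      rw [dist_eq_norm, add_sub_cancel_left, norm_smul]
      rw [mem_ball_zero_iff] at hh
      have : ‖s‖ ≤ 1 := by rw [Real.norm_eq_abs, abs_le]; constructor <;> linarith [hs.1, hs.2]
      nlinarith [norm_nonneg h]
    have h2 := (H h1).le
    rw [dist_eq_norm, ContinuousMap.norm_le _ hε.le] at h2
    simpa using h2 t
  have := (convex_segment (u t) (u t + h t)).norm_image_sub_le_of_norm_hasFDerivWithin_le'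
    (fun z _ => (hf z).hasFDerivWithinAt) key (left_mem_segment ℝ _ _) (right_mem_segment ℝ _ _)
  simp only [add_sub_cancel_left] at this
  calc _ = ‖f (u t + h t) - f (u t) - (f' (u t)) (h t)‖ := rfl
    _ ≤ ε * ‖h t‖ := this
    _ ≤ ε * ‖h‖ := by gcongr; exact h.norm_coe_le_norm t

/-- The derivative is the superposition operator of `fderiv ℝ f` followed by a continuous linear
map. The induction therefore changes the target to `E →L[ℝ] F`, which is why `F` is generalized and
shares its universe with `E`. -/
theorem contDiff_nat_superposition {F : Type u} [NormedAddCommGroup F] [NormedSpace ℝ F]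
    (n : ℕ) {f : E → F} (hf : ContDiff ℝ n f) :
    ContDiff ℝ n (fun v : C(X, E) => (⟨f, hf.continuous⟩ : C(E, F)).comp v) := by
  induction n generalizing F with
  | zero => exact contDiff_zero.2 (ContinuousMap.continuous_postcomp _)
  | succ n ih =>
    have hf' : ContDiff ℝ n (fderiv ℝ f) := hf.fderiv_right (by norm_cast)
    have hd := hasFDerivAt_superposition (X := X) (f := f) (f' := fderiv ℝ f)
      (fun y => (hf.differentiable (by simp) y).hasFDerivAt) hf.continuous hf'.continuous
    push_cast
    rw [contDiff_succ_iff_hasFDerivAt]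
    exact ⟨_, ContDiff.comp (g := pointwiseBilin (X := X) (ContinuousLinearMap.id ℝ (E →L[ℝ] F)))
      (ContinuousLinearMap.contDiff _) (ih hf'), hd⟩

theorem contDiff_superposition {f : E → F} (hf : ContDiff ℝ ∞ f) :
    ContDiff ℝ ∞ (fun v : C(X, E) => (⟨f, hf.continuous⟩ : C(E, F)).comp v) :=
  contDiff_infty.2 fun n => contDiff_nat_superposition n (hf.of_le (by exact_mod_cast le_top))

end Superposition

/-! ### The smooth inverse function theorem -/

/-- A smooth map with invertible derivative at a point restricts to a diffeomorphism between open
sets, smooth in both directions. -/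
theorem exists_localDiffeomorph {V V' : Type*} [NormedAddCommGroup V] [NormedSpace ℝ V]
    [CompleteSpace V] [NormedAddCommGroup V'] [NormedSpace ℝ V'] {Φ : V → V'} {a : V}
    (hΦ : ∀ᶠ p in 𝓝 a, ContDiffAt ℝ ∞ Φ p) {Φ' : V ≃L[ℝ] V'}
    (hΦ' : HasFDerivAt Φ (Φ' : V →L[ℝ] V') a) :
    ∃ e : OpenPartialHomeomorph V V', a ∈ e.source ∧ (∀ p, e p = Φ p) ∧
      ContDiffOn ℝ ∞ e e.source ∧ ContDiffOn ℝ ∞ e.symm e.target := by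
  have ha : ContDiffAt ℝ ∞ Φ a := hΦ.self_of_nhds
  -- Invertible operators form an open set. Restricting to points where the derivative is invertible
  -- makes the inverse map smooth on its whole domain, not only at the image of `a`.
  have hinv : ∀ᶠ p in 𝓝 a,
      fderiv ℝ Φ p ∈ range ((↑) : (V ≃L[ℝ] V') → V →L[ℝ] V') := by
    have h1 : ContinuousAt (fderiv ℝ Φ) a :=
      (ha.fderiv_right (m := 0) (by simp)).continuousAt
    apply h1.preimage_mem_nhds
    rw [hΦ'.fderiv]
    exact ContinuousLinearEquiv.nhds Φ'
  obtain ⟨s, hs, hso, has⟩ := eventually_nhds_iff.1 (hΦ.and hinv)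
  let e₀ := ha.toOpenPartialHomeomorph Φ hΦ' (by simp)
  let e := e₀.restrOpen s hso
  have he : ∀ p, e p = Φ p := fun p => rfl
  have hes : ∀ p ∈ e.source, p ∈ s := fun p hp => hp.2
  refine ⟨e, ⟨ha.mem_toOpenPartialHomeomorph_source hΦ' (by simp), has⟩, he,
    fun p hp => (hs p (hes p hp)).1.contDiffWithinAt, fun y hy => ?_⟩
  have hy' := e.map_target hy
  obtain ⟨hd, ⟨B, hB⟩⟩ := hs _ (hes _ hy')
  refine (e.contDiffAt_symm hy (f₀' := B) ?_ hd).contDiffWithinAt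
  rw [hB]
  exact (hd.differentiableAt (by simp)).hasFDerivAt

/-! ### Second order differential equations with a parameter -/

section SecondOrder

variable {E : Type*} [NormedAddCommGroup E] [NormedSpace ℝ E] [CompleteSpace E]

/-- The velocity at time `t` of the curve with initial velocity `w` and acceleration `a`. -/
noncomputable def velocity (w : E) (a : C(unitInterval, E)) (t : ℝ) : E :=
  w + ∫ s in (0 : ℝ)..t, a (projIcc 0 1 zero_le_one s)

/-- The position at time `t` of the curve starting at `0` with initial velocity `w` and
acceleration `a`. -/
noncomputable def position (w : E) (a : C(unitInterval, E)) (t : ℝ) : E :=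
  ∫ s in (0 : ℝ)..t, velocity w a s

/-- Clamping time by `projIcc` extends the acceleration continuously to the real line, so the
fundamental theorem of calculus holds at all times, the endpoints included. -/
theorem hasDerivAt_velocity (w : E) (a : C(unitInterval, E)) (t : ℝ) :
    HasDerivAt (velocity w a) (a (projIcc 0 1 zero_le_one t)) t := by
  have hc : Continuous fun s => a (projIcc (0 : ℝ) 1 zero_le_one s) := by fun_prop
  exact (intervalIntegral.integral_hasDerivAt_right (hc.intervalIntegrable _ _)
    (hc.stronglyMeasurableAtFilter _ _) hc.continuousAt).const_add w

theorem continuous_velocity (w : E) (a : C(unitInterval, E)) : Continuous (velocity w a) :=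
  continuous_iff_continuousAt.2 fun t => (hasDerivAt_velocity w a t).continuousAt

theorem hasDerivAt_position (w : E) (a : C(unitInterval, E)) (t : ℝ) :
    HasDerivAt (position w a) (velocity w a t) t := by
  have hc := continuous_velocity w a
  exact intervalIntegral.integral_hasDerivAt_right (hc.intervalIntegrable _ _)
    (hc.stronglyMeasurableAtFilter _ _) hc.continuousAt

theorem continuous_position (w : E) (a : C(unitInterval, E)) : Continuous (position w a) :=
  continuous_iff_continuousAt.2 fun t => (hasDerivAt_position w a t).continuousAt

@[simp] theorem position_zero_time (w : E) (a : C(unitInterval, E)) : position w a 0 = 0 := by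
  simp [position]

@[simp] theorem velocity_zero_time (w : E) (a : C(unitInterval, E)) : velocity w a 0 = w := by
  simp [velocity]

theorem velocity_add (w w' : E) (a a' : C(unitInterval, E)) (t : ℝ) :
    velocity (w + w') (a + a') t = velocity w a t + velocity w' a' t := by
  have hc (a : C(unitInterval, E)) : Continuous fun s => a (projIcc (0 : ℝ) 1 zero_le_one s) := by
    fun_prop
  simp only [velocity, ContinuousMap.add_apply]
  rw [intervalIntegral.integral_add ((hc a).intervalIntegrable _ _)
    ((hc a').intervalIntegrable _ _)]
  abel

theorem velocity_smul (c : ℝ) (w : E) (a : C(unitInterval, E)) (t : ℝ) :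
    velocity (c • w) (c • a) t = c • velocity w a t := by
  simp only [velocity, ContinuousMap.smul_apply, intervalIntegral.integral_smul, smul_add]

theorem position_add (w w' : E) (a a' : C(unitInterval, E)) (t : ℝ) :
    position (w + w') (a + a') t = position w a t + position w' a' t := by
  simp only [position, velocity_add]
  exact intervalIntegral.integral_add ((continuous_velocity w a).intervalIntegrable _ _)
    ((continuous_velocity w' a').intervalIntegrable _ _)

theorem position_smul (c : ℝ) (w : E) (a : C(unitInterval, E)) (t : ℝ) :
    position (c • w) (c • a) t = c • position w a t := by
  simp only [position, velocity_smul, intervalIntegral.integral_smul]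

theorem norm_velocity_le (w : E) (a : C(unitInterval, E)) {t : ℝ} (ht : t ∈ Icc (0 : ℝ) 1) :
    ‖velocity w a t‖ ≤ ‖w‖ + ‖a‖ := by
  refine (norm_add_le _ _).trans ?_
  gcongr
  refine (intervalIntegral.norm_integral_le_of_norm_le_const (C := ‖a‖)
    fun s _ => a.norm_coe_le_norm _).trans ?_
  rw [sub_zero, abs_of_nonneg ht.1]
  exact mul_le_of_le_one_right (norm_nonneg _) ht.2

theorem norm_position_le (w : E) (a : C(unitInterval, E)) {t : ℝ} (ht : t ∈ Icc (0 : ℝ) 1) :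
    ‖position w a t‖ ≤ ‖w‖ + ‖a‖ := by
  refine (intervalIntegral.norm_integral_le_of_norm_le_const (C := ‖w‖ + ‖a‖)
    fun s hs => norm_velocity_le w a ?_).trans ?_
  · rw [uIoc_of_le ht.1] at hs
    exact ⟨hs.1.le, hs.2.trans ht.2⟩
  · rw [sub_zero, abs_of_nonneg ht.1]
    exact mul_le_of_le_one_right (by positivity) ht.2

/-- The curve in phase space starting at the origin of `E`, as a function of the initial velocity
and of the acceleration. -/
noncomputable def phaseCurve : E × C(unitInterval, E) →L[ℝ] C(unitInterval, E × E) :=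
  LinearMap.mkContinuous
    { toFun := fun p => ⟨fun t => (position p.1 p.2 t, velocity p.1 p.2 t),
        ((continuous_position _ _).comp continuous_subtype_val).prodMk
          ((continuous_velocity _ _).comp continuous_subtype_val)⟩
      map_add' := fun p q => by ext t <;> simp [position_add, velocity_add]
      map_smul' := fun c p => by ext t <;> simp [position_smul, velocity_smul] } 2
    (fun p => by
      rw [ContinuousMap.norm_le _ (by positivity)]
      intro t
      have h1 := norm_fst_le p
      have h2 := norm_snd_le p
      exact max_le ((norm_position_le p.1 p.2 t.2).trans (by linarith))
        ((norm_velocity_le p.1 p.2 t.2).trans (by linarith)))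

@[simp] theorem phaseCurve_apply (p : E × C(unitInterval, E)) (t : unitInterval) :
    phaseCurve p t = (position p.1 p.2 t, velocity p.1 p.2 t) := rfl

/-- A fixed point equation `a = R (w, a)` with a smooth right hand side that vanishes to second
order at the origin has a smooth solution near the origin. -/
theorem exists_smooth_fixedPoint {K : Type*} [NormedAddCommGroup K] [NormedSpace ℝ K]
    [CompleteSpace K] {R : E × K → K} (hR : ContDiff ℝ ∞ R) (hR0 : R 0 = 0)
    (hR1 : HasFDerivAt R (0 : E × K →L[ℝ] K) 0) :
    ∃ A : E → K, (∀ᶠ w in 𝓝 (0 : E), ContDiffAt ℝ ∞ A w) ∧ A 0 = 0 ∧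
      HasFDerivAt A (0 : E →L[ℝ] K) 0 ∧ ∀ᶠ w in 𝓝 (0 : E), A w = R (w, A w) := by
  -- The derivative of `Φ` at the origin is the identity because that of `R` vanishes. The solution
  -- is the second component of the local inverse of `Φ` at `(w, 0)`.
  let Φ : E × K → E × K := fun p => (p.1, p.2 - R p)
  have hΦ : ContDiff ℝ ∞ Φ := contDiff_fst.prodMk (contDiff_snd.sub hR)
  have hΦ0 : Φ 0 = 0 := by simp [Φ, hR0]
  have hΦ1 : HasFDerivAt Φ
      ((ContinuousLinearEquiv.refl ℝ (E × K)) : E × K →L[ℝ] E × K) 0 := by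
    have h2 := (hasFDerivAt_fst (𝕜 := ℝ) (p := (0 : E × K))).prodMk
      ((hasFDerivAt_snd (𝕜 := ℝ) (p := (0 : E × K))).sub hR1)
    exact h2.congr_fderiv (ContinuousLinearMap.ext fun p => Prod.ext rfl (sub_zero p.2))
  obtain ⟨e, h0s, he, -, hsymm⟩ :=
    exists_localDiffeomorph (Eventually.of_forall fun p => hΦ.contDiffAt) hΦ1
  have h0t : (0 : E × K) ∈ e.target := by
    rw [← hΦ0, ← he]; exact e.map_source h0s
  have hsymm0 : e.symm 0 = 0 := by
    have := e.left_inv h0s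
    rwa [he, hΦ0] at this
  have hsymm1 : HasFDerivAt e.symm
      ((ContinuousLinearEquiv.refl ℝ (E × K)).symm : E × K →L[ℝ] E × K) 0 :=
    e.hasFDerivAt_symm h0t (by rw [hsymm0, show ⇑e = Φ from funext he]; exact hΦ1)
  have hin : ContDiff ℝ ∞ (fun w : E => (w, (0 : K))) := contDiff_id.prodMk contDiff_const
  have hmem : ∀ᶠ w : E in 𝓝 0, (w, (0 : K)) ∈ e.target :=
    hin.continuous.continuousAt.preimage_mem_nhds (e.open_target.mem_nhds h0t)
  refine ⟨fun w => (e.symm (w, 0)).2, hmem.mono fun w hw => ?_, ?_, ?_, hmem.mono fun w hw => ?_⟩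
  · exact ContDiffAt.snd (ContDiffAt.comp w (g := e.symm)
      (hsymm.contDiffAt (e.open_target.mem_nhds hw)) hin.contDiffAt)
  · change (e.symm 0).2 = 0
    rw [hsymm0]; rfl
  · have h1 : HasFDerivAt (fun w : E => (w, (0 : K))) (ContinuousLinearMap.inl ℝ E K) 0 :=
      (ContinuousLinearMap.inl ℝ E K).hasFDerivAt
    have h2 := (HasFDerivAt.comp (0 : E) (g := e.symm) hsymm1 h1).snd
    exact h2.congr_fderiv (ContinuousLinearMap.ext fun w => rfl)
  · have h1 : Φ (e.symm (w, 0)) = (w, 0) := (he _).symm.trans (e.right_inv hw)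
    have h2 : (e.symm (w, 0)).1 = w := congrArg Prod.fst h1
    have h3 : (e.symm (w, 0)).2 - R (e.symm (w, 0)) = 0 := congrArg Prod.snd h1
    rw [sub_eq_zero] at h3
    conv_rhs => rw [show (w, (e.symm (w, 0)).2) = e.symm (w, 0) from Prod.ext h2.symm rfl]
    exact h3

set_option synthInstance.maxHeartbeats 200000 in
/-- Solutions of a second order differential equation with initial position `0` and small initial
velocity, near an equilibrium at which the right hand side vanishes to second order, depend
smoothly on the initial velocity. -/
theorem exists_smooth_acceleration {f : E × E → E} (hf : ContDiff ℝ ∞ f) (hf0 : f 0 = 0)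
    (hf1 : fderiv ℝ f 0 = 0) :
    ∃ A : E → C(unitInterval, E), (∀ᶠ w in 𝓝 (0 : E), ContDiffAt ℝ ∞ A w) ∧ A 0 = 0 ∧
      HasFDerivAt A (0 : E →L[ℝ] C(unitInterval, E)) 0 ∧
      ∀ᶠ w in 𝓝 (0 : E), ∀ t : unitInterval,
        A w t = f (position w (A w) t, velocity w (A w) t) := by
  -- With the acceleration as unknown, the differential equation reads `a = N (phaseCurve (w, a))`
  -- in a Banach space, where `N` is a superposition operator.
  let N : C(unitInterval, E × E) → C(unitInterval, E) :=
    fun v => (⟨f, hf.continuous⟩ : C(E × E, E)).comp v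
  have hN : ContDiff ℝ ∞ N := contDiff_superposition hf
  have hN0 : N 0 = 0 := by ext t; exact hf0
  have hN1 : HasFDerivAt N (0 : C(unitInterval, E × E) →L[ℝ] C(unitInterval, E)) 0 := by
    have hf' : ContDiff ℝ ∞ (fderiv ℝ f) := hf.fderiv_right (by simp)
    have := hasFDerivAt_superposition (f := f) (f' := fderiv ℝ f)
      (fun y => (hf.differentiable (by simp) y).hasFDerivAt) hf.continuous hf'.continuous
      (0 : C(unitInterval, E × E))
    refine this.congr_fderiv ?_
    ext u t
    simp [hf1]
  let L : E × C(unitInterval, E) →L[ℝ] C(unitInterval, E × E) := phaseCurve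
  obtain ⟨A, h1, h2, h3, h4⟩ := exists_smooth_fixedPoint (R := fun p => N (L p))
    (hN.comp L.contDiff) (by simp [hN0])
    (by
      have h5 : HasFDerivAt N (0 : C(unitInterval, E × E) →L[ℝ] C(unitInterval, E)) (L 0) := by
        rwa [map_zero]
      refine (h5.comp (0 : E × C(unitInterval, E)) L.hasFDerivAt).congr_fderiv ?_
      rw [ContinuousLinearMap.zero_comp])
  refine ⟨A, h1, h2, h3, h4.mono fun w hw t => ?_⟩
  exact congrArg (fun u : C(unitInterval, E) => u t) hw

end SecondOrder

/-! ### Geodesics of a Riemannian metric on a vector space -/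

section VectorSpace

set_option synthInstance.maxHeartbeats 200000
set_option maxHeartbeats 1000000

variable {E : Type*} [NormedAddCommGroup E] [NormedSpace ℝ E] [FiniteDimensional ℝ E]
  {G : E → E →L[ℝ] E →L[ℝ] ℝ}

theorem sq_le_of_posDef {B : E →L[ℝ] E →L[ℝ] ℝ} (hs : ∀ u v, B u v = B v u)
    (hp : ∀ v, v ≠ 0 → 0 < B v v) (u v : E) : (B u v) ^ 2 ≤ B u u * B v v := by
  rcases eq_or_ne v 0 with rfl | hv
  · simp
  have hvv := hp v hv
  have h0 : 0 ≤ B (u - (B u v / B v v) • v) (u - (B u v / B v v) • v) := by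
    rcases eq_or_ne (u - (B u v / B v v) • v) 0 with h | h
    · simp [h]
    · exact (hp _ h).le
  have h1 : B (u - (B u v / B v v) • v) (u - (B u v / B v v) • v) =
      B u u - (B u v) ^ 2 / B v v := by
    simp only [map_sub, map_smul, sub_apply, smul_apply,
      smul_eq_mul, hs v u]
    field_simp
    ring
  rw [h1, sub_nonneg, div_le_iff₀ hvv] at h0
  exact h0

theorem exists_equiv_of_posDef {B : E →L[ℝ] E →L[ℝ] ℝ} (hp : ∀ v, v ≠ 0 → 0 < B v v) :
    ∃ e : E ≃L[ℝ] (E →L[ℝ] ℝ), (e : E →L[ℝ] E →L[ℝ] ℝ) = B := by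
  have hinj : Function.Injective (B : E →ₗ[ℝ] E →L[ℝ] ℝ) := by
    rw [← LinearMap.ker_eq_bot, LinearMap.ker_eq_bot']
    intro v hv
    by_contra h
    have := hp v h
    have h2 : B v = 0 := hv
    simp [h2] at this
  have hfr : Module.finrank ℝ E = Module.finrank ℝ (E →L[ℝ] ℝ) := by
    rw [← (LinearMap.toContinuousLinearMap (𝕜 := ℝ) (E := E) (F' := ℝ)).finrank_eq]
    exact Subspace.dual_finrank_eq.symm
  refine ⟨(LinearEquiv.ofInjectiveOfFinrankEq _ hinj hfr).toContinuousLinearEquiv, ?_⟩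
  ext; rfl

/-- The geodesic equation can be solved for the acceleration. -/
theorem exists_geodesic_acceleration (hG : ContDiff ℝ ∞ G)
    (hp : ∀ x v, v ≠ 0 → 0 < G x v v) :
    ∃ f : E × E → E, ContDiff ℝ ∞ f ∧ f 0 = 0 ∧ fderiv ℝ f 0 = 0 ∧
      ∀ x v k, G x (f (x, v)) k = 2⁻¹ * fderiv ℝ G x k v v - fderiv ℝ G x v v k := by
  have hG' : ContDiff ℝ ∞ fun p : E × E => fderiv ℝ G p.1 p.2 :=
    hG.contDiff_fderiv_apply (by simp)
  -- This covector is the right side of the Euler–Lagrange equation of the energy, solved for `G x`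
  -- applied to the acceleration. It plays the role of the Christoffel symbols.
  let q : E × E → E →L[ℝ] ℝ := fun p =>
    (2⁻¹ : ℝ) • (((fderiv ℝ G p.1).flip p.2).flip p.2) - fderiv ℝ G p.1 p.2 p.2
  have hq : ContDiff ℝ ∞ q := by
    rw [contDiff_clm_apply_iff]
    intro k
    have h1 : ContDiff ℝ ∞ fun p : E × E => fderiv ℝ G p.1 k :=
      hG'.comp (contDiff_fst.prodMk contDiff_const)
    have h2 : ContDiff ℝ ∞ fun p : E × E => 2⁻¹ * fderiv ℝ G p.1 k p.2 p.2 :=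
      contDiff_const.mul ((h1.clm_apply contDiff_snd).clm_apply contDiff_snd)
    exact h2.sub ((hG'.clm_apply contDiff_snd).clm_apply contDiff_const)
  let f : E × E → E := fun p => (G p.1).inverse (q p)
  have hinv : ContDiff ℝ ∞ fun x => (G x).inverse := by
    rw [contDiff_iff_contDiffAt]
    intro x
    obtain ⟨e, he⟩ := exists_equiv_of_posDef (hp x)
    have h1 : ContDiffAt ℝ ∞ ContinuousLinearMap.inverse (G x) := by
      rw [← he]; exact contDiffAt_map_inverse e
    exact h1.comp x hG.contDiffAt
  have hf : ContDiff ℝ ∞ f := (hinv.comp contDiff_fst).clm_apply hq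
  -- As `f` is quadratic in the velocity, along a ray `s • p` it is `s ^ 2` times a differentiable
  -- function of `s`. This kills both the value and the derivative at the origin.
  have hhom : ∀ (s : ℝ) x v, f (x, s • v) = s ^ 2 • f (x, v) := by
    intro s x v
    have : q (x, s • v) = s ^ 2 • q (x, v) := by
      ext k
      simp [q]
      ring
    simp only [f, this, map_smul]
  have hGf : ∀ x v k, G x (f (x, v)) k = 2⁻¹ * fderiv ℝ G x k v v - fderiv ℝ G x v v k := by
    intro x v k
    obtain ⟨e, he⟩ := exists_equiv_of_posDef (hp x)
    have : G x (f (x, v)) = q (x, v) := by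
      simp only [f, ← he, ContinuousLinearMap.inverse_equiv]
      exact e.apply_symm_apply _
    rw [this]
    simp [q]
  refine ⟨f, hf, ?_, ?_, hGf⟩
  · have := hhom 0 0 0
    rw [smul_zero, zero_pow two_ne_zero, zero_smul] at this
    exact this
  · refine ContinuousLinearMap.ext fun p => ?_
    have hd : HasFDerivAt f (fderiv ℝ f 0) 0 := (hf.differentiable (by simp) 0).hasFDerivAt
    have h1 : HasDerivAt (fun s : ℝ => f (s • p)) (fderiv ℝ f 0 p) 0 := by
      have hl : HasDerivAt (fun s : ℝ => s • p) p 0 := by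
        simpa using (hasDerivAt_id (0 : ℝ)).smul_const p
      exact HasFDerivAt.comp_hasDerivAt (x := (0 : ℝ)) (l := f) (by simpa using hd) hl
    have h2 : HasDerivAt (fun s : ℝ => s ^ 2 • f (s • p.1, p.2)) 0 0 := by
      have h3 : DifferentiableAt ℝ (fun s : ℝ => f (s • p.1, p.2)) 0 :=
        ((hf.differentiable (by simp)).comp (by fun_prop)) 0
      have := ((hasDerivAt_id (0 : ℝ)).pow 2).smul h3.hasDerivAt
      exact this.congr_deriv (by simp)
    have h4 : (fun s : ℝ => f (s • p)) = fun s : ℝ => s ^ 2 • f (s • p.1, p.2) := by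
      ext s; rw [← hhom]; rfl
    rw [h4] at h1
    simpa using h1.unique h2

end VectorSpace

/-! ### The squared distance to a point for a Riemannian metric on a vector space -/

section NormalEnergy

set_option synthInstance.maxHeartbeats 200000

variable {E : Type*} [NormedAddCommGroup E] [NormedSpace ℝ E] [FiniteDimensional ℝ E]
  {G : E → E →L[ℝ] E →L[ℝ] ℝ}

/-- Invertibility bounds `‖v‖` by a multiple of `‖B v‖`, and Cauchy–Schwarz bounds `‖B v‖ ^ 2` by
`‖B‖ * B v v`. -/
theorem exists_pos_mul_sq_le_of_posDef {B : E →L[ℝ] E →L[ℝ] ℝ} (hs : ∀ u v, B u v = B v u)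
    (hp : ∀ v, v ≠ 0 → 0 < B v v) : ∃ c > 0, ∀ v, c * ‖v‖ ^ 2 ≤ B v v := by
  obtain ⟨e, he⟩ := exists_equiv_of_posDef hp
  let C := ‖(e.symm : (E →L[ℝ] ℝ) →L[ℝ] E)‖
  refine ⟨(C ^ 2 * ‖B‖ + 1)⁻¹, by positivity, fun v => ?_⟩
  have hnn : 0 ≤ B v v := by
    rcases eq_or_ne v 0 with rfl | h
    · simp
    · exact (hp v h).le
  have h1 : ‖B v‖ ≤ √(B v v * ‖B‖) := by
    refine (B v).opNorm_le_bound (Real.sqrt_nonneg _) fun k => ?_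
    rw [Real.norm_eq_abs]
    have h0 : (B v k) ^ 2 ≤ B v v * ‖B‖ * ‖k‖ ^ 2 := by
      refine (sq_le_of_posDef hs hp v k).trans ?_
      have : B k k ≤ ‖B‖ * ‖k‖ * ‖k‖ := (le_abs_self _).trans (B.le_opNorm₂ k k)
      calc B v v * B k k ≤ B v v * (‖B‖ * ‖k‖ * ‖k‖) := by gcongr
        _ = _ := by ring
    refine (Real.abs_le_sqrt h0).trans_eq ?_
    rw [Real.sqrt_mul (by positivity), Real.sqrt_sq (norm_nonneg _)]
  have h2 : ‖v‖ ≤ C * ‖B v‖ := by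
    have := (e.symm : (E →L[ℝ] ℝ) →L[ℝ] E).le_opNorm (B v)
    rw [← he] at this ⊢
    simpa using this
  have h3 : ‖v‖ ^ 2 ≤ C ^ 2 * ‖B‖ * B v v := by
    calc ‖v‖ ^ 2 ≤ (C * √(B v v * ‖B‖)) ^ 2 := by
          gcongr
          exact h2.trans (by gcongr)
      _ = C ^ 2 * ‖B‖ * B v v := by
          rw [mul_pow, Real.sq_sqrt (by positivity)]; ring
  rw [inv_mul_le_iff₀ (by positivity)]
  linarith

theorem hasDerivAt_metric (hG : ContDiff ℝ ∞ G) {c u v : ℝ → E} {c' u' v' : E} {t : ℝ}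
    (hc : HasDerivAt c c' t) (hu : HasDerivAt u u' t) (hv : HasDerivAt v v' t) :
    HasDerivAt (fun s => G (c s) (u s) (v s))
      (fderiv ℝ G (c t) c' (u t) (v t) + G (c t) u' (v t) + G (c t) (u t) v') t := by
  have h1 : HasDerivAt (fun s => G (c s)) (fderiv ℝ G (c t) c') t :=
    (hG.differentiable (by simp) (c t)).hasFDerivAt.comp_hasDerivAt t hc
  simpa using (h1.clm_apply hu).clm_apply hv

/-- Geodesics have constant speed. -/
theorem metric_velocity_eq (hG : ContDiff ℝ ∞ G) (hs : ∀ x u v, G x u v = G x v u) {w : E}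
    {a : C(unitInterval, E)}
    (ha : ∀ (t : unitInterval) k, G (position w a t) (a t) k =
      2⁻¹ * fderiv ℝ G (position w a t) k (velocity w a t) (velocity w a t) -
        fderiv ℝ G (position w a t) (velocity w a t) (velocity w a t) k)
    {t : ℝ} (ht : t ∈ Icc (0 : ℝ) 1) :
    G (position w a t) (velocity w a t) (velocity w a t) = G 0 w w := by
  have hd : ∀ s, HasDerivAt
      (fun s => G (position w a s) (velocity w a s) (velocity w a s)) _ s := fun s =>
    hasDerivAt_metric hG (hasDerivAt_position w a s) (hasDerivAt_velocity w a s)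
      (hasDerivAt_velocity w a s)
  have key := constant_of_has_deriv_right_zero (a := 0) (b := 1)
    (f := fun s => G (position w a s) (velocity w a s) (velocity w a s))
    (fun s _ => (hd s).continuousAt.continuousWithinAt) (fun s hs' => by
      refine ((hd s).congr_deriv ?_).hasDerivWithinAt
      have hsI : s ∈ Icc (0 : ℝ) 1 := ⟨hs'.1, hs'.2.le⟩
      -- Pairing the geodesic equation with the velocity cancels the derivative of the squared
      -- speed.
      have h1 := ha ⟨s, hsI⟩ (velocity w a s)
      simp only [projIcc_of_mem zero_le_one hsI]
      rw [hs _ (velocity w a s) (a _), h1]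
      ring) t ht
  simpa using key

/-- The phase curve is linear in the initial velocity and the acceleration, so a variation of curves
is again of the form `position h a'`, with velocity `velocity h a'`. -/
theorem hasDerivAt_phaseCurve_param {A : E → C(unitInterval, E)} {w h : E}
    {a' : C(unitInterval, E)} (hA : HasDerivAt (fun s : ℝ => A (w + s • h)) a' 0)
    (t : unitInterval) :
    HasDerivAt (fun s : ℝ => position (w + s • h) (A (w + s • h)) t) (position h a' t) 0 ∧
    HasDerivAt (fun s : ℝ => velocity (w + s • h) (A (w + s • h)) t) (velocity h a' t) 0 := by
  have h0 : HasDerivAt (fun s : ℝ => w + s • h) h 0 := by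
    simpa using ((hasDerivAt_id (0 : ℝ)).smul_const h).const_add w
  have h1 : HasDerivAt (fun s : ℝ => phaseCurve (w + s • h, A (w + s • h)) t)
      (phaseCurve (h, a') t) 0 := by
    let L : E × C(unitInterval, E) →L[ℝ] E × E := (ContinuousMap.evalCLM ℝ t).comp phaseCurve
    exact L.hasFDerivAt.comp_hasDerivAt (0 : ℝ) (h0.prodMk hA)
  exact ⟨h1.fst, h1.snd⟩

/-- The Gauss lemma, in the form of the first variation of energy. -/
theorem metric_velocity_variation (hG : ContDiff ℝ ∞ G) (hs : ∀ x u v, G x u v = G x v u)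
    {A : E → C(unitInterval, E)} {w h : E}
    {a' : C(unitInterval, E)} (hA : HasDerivAt (fun s : ℝ => A (w + s • h)) a' 0)
    (hgeo : ∀ (t : unitInterval) k, G (position w (A w) t) (A w t) k =
      2⁻¹ * fderiv ℝ G (position w (A w) t) k (velocity w (A w) t) (velocity w (A w) t) -
        fderiv ℝ G (position w (A w) t) (velocity w (A w) t) (velocity w (A w) t) k)
    (hspeed : ∀ᶠ s : ℝ in 𝓝 0, ∀ t ∈ Icc (0 : ℝ) 1,
      G (position (w + s • h) (A (w + s • h)) t) (velocity (w + s • h) (A (w + s • h)) t)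
        (velocity (w + s • h) (A (w + s • h)) t) = G 0 (w + s • h) (w + s • h)) :
    G (position w (A w) 1) (velocity w (A w) 1) (position h a' 1) = G 0 w h := by
  -- This is the derivative, with respect to the parameter `s`, of the fact that each curve of the
  -- family has constant speed.
  have hvar : ∀ t : unitInterval,
      fderiv ℝ G (position w (A w) t) (position h a' t) (velocity w (A w) t)
        (velocity w (A w) t) + 2 * G (position w (A w) t) (velocity w (A w) t) (velocity h a' t) =
      2 * G 0 w h := by
    intro t
    obtain ⟨h1, h2⟩ := hasDerivAt_phaseCurve_param hA t
    have h3 := hasDerivAt_metric hG h1 h2 h2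
    have h0 : HasDerivAt (fun s : ℝ => w + s • h) h 0 := by
      simpa using ((hasDerivAt_id (0 : ℝ)).smul_const h).const_add w
    have h4 := hasDerivAt_metric hG (hasDerivAt_const (0 : ℝ) (0 : E)) h0 h0
    have h5 := h3.unique (h4.congr_of_eventuallyEq
      (hspeed.mono fun s hs' => hs' t t.2))
    simp only [zero_smul, add_zero, map_zero, zero_apply, zero_add] at h5
    rw [hs _ (velocity h a' t), hs _ h w] at h5
    linarith
  -- By the geodesic equation and `hvar`, the product of the velocity with the variation field grows
  -- at the constant rate `G 0 w h`. It starts from `0` because all curves start at the origin.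
  have hd : ∀ s : ℝ, HasDerivAt (fun s => G (position w (A w) s) (velocity w (A w) s)
      (position h a' s) - s * G 0 w h) _ s := fun s =>
    (hasDerivAt_metric hG (hasDerivAt_position w (A w) s) (hasDerivAt_velocity w (A w) s)
      (hasDerivAt_position h a' s)).sub ((hasDerivAt_id s).mul_const _)
  have key := constant_of_has_deriv_right_zero (a := 0) (b := 1)
    (f := fun s => G (position w (A w) s) (velocity w (A w) s) (position h a' s) - s * G 0 w h)
    (fun s _ => (hd s).continuousAt.continuousWithinAt) (fun s hs' => by
      refine ((hd s).congr_deriv ?_).hasDerivWithinAt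
      have hsI : s ∈ Icc (0 : ℝ) 1 := ⟨hs'.1, hs'.2.le⟩
      have h1 := hgeo ⟨s, hsI⟩ (position h a' s)
      have h2 := hvar ⟨s, hsI⟩
      simp only [projIcc_of_mem zero_le_one hsI]
      rw [h1]
      simp only at h2 ⊢
      linarith) 1 (by simp)
  simp only [position_zero_time, map_zero, zero_mul, sub_zero, one_mul] at key
  linarith

/-- Near the origin there is a smooth function `ρ`, comparable to the square of the norm, whose
square root has gradient of norm at most `1`, and such that `√(ρ y)` is the length of a path from
`0` to `y`. -/
theorem exists_normal_energy (hG : ContDiff ℝ ∞ G) (hs : ∀ x u v, G x u v = G x v u)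
    (hp : ∀ x v, v ≠ 0 → 0 < G x v v) {U : Set E} (hU : U ∈ 𝓝 (0 : E)) :
    ∃ ρ : E → ℝ, ρ 0 = 0 ∧ ∃ c > 0, ∀ᶠ y in 𝓝 (0 : E),
      ContDiffAt ℝ ∞ ρ y ∧ c * ‖y‖ ^ 2 ≤ ρ y ∧
      (∀ k, (fderiv ℝ ρ y k) ^ 2 ≤ 4 * ρ y * G y k k) ∧
      ∃ γ γ' : ℝ → E, (∀ t, HasDerivAt γ (γ' t) t) ∧ Continuous γ' ∧ γ 0 = 0 ∧ γ 1 = y ∧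
        ∀ t ∈ Icc (0 : ℝ) 1, γ t ∈ U ∧ G (γ t) (γ' t) (γ' t) = ρ y := by
  obtain ⟨f, hf, hf0, hf1, hGf⟩ := exists_geodesic_acceleration hG hp
  obtain ⟨A, hA, hA0, hA1, hAf⟩ := exists_smooth_acceleration hf hf0 hf1
  have hgeo : ∀ᶠ w in 𝓝 (0 : E), ∀ (t : unitInterval) k, G (position w (A w) t) (A w t) k =
      2⁻¹ * fderiv ℝ G (position w (A w) t) k (velocity w (A w) t) (velocity w (A w) t) -
        fderiv ℝ G (position w (A w) t) (velocity w (A w) t) (velocity w (A w) t) k :=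
    hAf.mono fun w hw t k => by rw [hw t, ← hGf]
  have hAc : ContinuousAt A 0 := hA1.continuousAt
  let ev : C(unitInterval, E × E) →L[ℝ] E :=
    (ContinuousLinearMap.fst ℝ E E).comp (ContinuousMap.evalCLM ℝ (1 : unitInterval))
  let L : E × C(unitInterval, E) →L[ℝ] E := ev.comp phaseCurve
  -- This is the exponential map at the origin. Its derivative there is the identity, since the
  -- acceleration depends on the initial velocity to second order.
  let X : E → E := fun w => position w (A w) 1
  have hXL : ∀ w, X w = L (w, A w) := fun w => rfl
  have hX : ∀ᶠ w in 𝓝 (0 : E), ContDiffAt ℝ ∞ X w := hA.mono fun w hw =>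
    L.contDiff.contDiffAt.comp w (contDiffAt_id.prodMk hw)
  have hX1 : HasFDerivAt X ((ContinuousLinearEquiv.refl ℝ E) : E →L[ℝ] E) 0 := by
    have h1 : HasFDerivAt X _ 0 := L.hasFDerivAt.comp (0 : E) ((hasFDerivAt_id (0 : E)).prodMk hA1)
    refine h1.congr_fderiv (ContinuousLinearMap.ext fun h => ?_)
    change position h 0 1 = h
    simp [position, velocity]
  have hX0 : X 0 = 0 := by rw [hXL, hA0]; exact map_zero L
  obtain ⟨e, h0s, he, heX, hesymm⟩ := exists_localDiffeomorph hX hX1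
  have h0t : (0 : E) ∈ e.target := by
    rw [← hX0, ← he]; exact e.map_source h0s
  have hsymm0 : e.symm 0 = 0 := by
    have := e.left_inv h0s
    rwa [he, hX0] at this
  have hsymmc : Tendsto e.symm (𝓝 0) (𝓝 0) := by
    have : ContinuousAt e.symm 0 := (hesymm.contDiffAt (e.open_target.mem_nhds h0t)).continuousAt
    rwa [ContinuousAt, hsymm0] at this
  obtain ⟨c, hc, hcG⟩ := exists_pos_mul_sq_le_of_posDef (hs 0) (hp 0)
  obtain ⟨r, hr, hrU⟩ := Metric.mem_nhds_iff.1 hU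
  have hAle : ∀ᶠ w in 𝓝 (0 : E), ‖A w‖ ≤ ‖w‖ := by
    have := hA1.isLittleO.def one_pos
    simpa [hA0] using this
  have hnorm : ∀ᶠ w in 𝓝 (0 : E), ‖w‖ + ‖A w‖ < r := by
    have h1 : ContinuousAt (fun w => ‖w‖ + ‖A w‖) (0 : E) := continuousAt_id.norm.add hAc.norm
    exact h1.eventually_lt_const (by simpa [hA0] using hr)
  -- The constant `c` comes from positivity of `G 0`. It is divided by `4` because `‖y‖ ≤ ‖w‖ + ‖A
  -- w‖ ≤ 2 * ‖w‖` for `y` the image of `w`.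
  refine ⟨fun y => G 0 (e.symm y) (e.symm y), by simp [hsymm0], c / 4, by positivity, ?_⟩
  filter_upwards [e.open_target.mem_nhds h0t,
    hsymmc.eventually (hgeo.eventually_nhds.and (hAle.and (hnorm.and hA)))]
    with y hy ⟨hgeo', hle, hlt, hAw⟩
  set w := e.symm y with hw
  have hyX : X w = y := by rw [← he, hw, e.right_inv hy]
  have hgeow := hgeo'.self_of_nhds
  have hS : ContDiffAt ℝ ∞ e.symm y := hesymm.contDiffAt (e.open_target.mem_nhds hy)
  refine ⟨?_, ?_, fun k => ?_, position w (A w), velocity w (A w), hasDerivAt_position _ _,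
    continuous_velocity _ _, position_zero_time _ _, hyX, fun t ht => ⟨hrU ?_,
      metric_velocity_eq hG hs hgeow ht⟩⟩
  · exact (((G 0).contDiff.contDiffAt.comp y hS).clm_apply hS)
  · have h1 : ‖y‖ ≤ 2 * ‖w‖ := by
      rw [← hyX]
      exact (norm_position_le w (A w) (by simp)).trans (by linarith)
    calc c / 4 * ‖y‖ ^ 2 ≤ c / 4 * (2 * ‖w‖) ^ 2 := by gcongr
      _ = c * ‖w‖ ^ 2 := by ring
      _ ≤ _ := hcG w
  -- With `h` the derivative of the inverse exponential map in the direction `k`, the variation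
  -- field ends at `k`. The Gauss lemma makes the derivative of `ρ` twice the product of `k` with
  -- the final velocity, whose squared length is `ρ y`; Cauchy–Schwarz finishes.
  · have hS1 := (hS.differentiableAt (by simp)).hasFDerivAt
    set h := fderiv ℝ e.symm y k with hh
    have h1 : fderiv ℝ (fun y => G 0 (e.symm y) (e.symm y)) y k = 2 * G 0 w h := by
      have h2 := ((G 0).hasFDerivAt.comp y hS1).clm_apply hS1
      have h3 := congrArg (fun B : E →L[ℝ] ℝ => B k) h2.fderiv
      have h4 : fderiv ℝ (fun y => G 0 (e.symm y) (e.symm y)) y k = G 0 w h + G 0 h w := h3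
      rw [h4, hs 0 h w]; ring
    have h0 : HasDerivAt (fun s : ℝ => w + s • h) h 0 := by
      simpa using ((hasDerivAt_id (0 : ℝ)).smul_const h).const_add w
    have hAd : HasDerivAt (fun s : ℝ => A (w + s • h)) (fderiv ℝ A w h) 0 :=
      HasFDerivAt.comp_hasDerivAt (x := (0 : ℝ)) (l := A)
        (by simpa using (hAw.differentiableAt (by simp)).hasFDerivAt) h0
    have hgauss := metric_velocity_variation hG hs hAd hgeow (by
      have : Tendsto (fun s : ℝ => w + s • h) (𝓝 0) (𝓝 w) := by
        have := h0.continuousAt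
        simpa [ContinuousAt] using this
      filter_upwards [this.eventually hgeo'] with s hs' t ht
      exact metric_velocity_eq hG hs hs' ht)
    have hXd : HasDerivAt (fun s : ℝ => X (w + s • h)) (position h (fderiv ℝ A w h) 1) 0 :=
      (hasDerivAt_phaseCurve_param hAd 1).1
    have hwS : w ∈ e.source := e.map_target hy
    have hXw : HasFDerivAt X (fderiv ℝ X w) w := by
      have : ContDiffAt ℝ ∞ X w := by
        rw [show X = e from funext fun p => (he p).symm]
        exact heX.contDiffAt (e.open_source.mem_nhds hwS)
      exact (this.differentiableAt (by simp)).hasFDerivAt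
    have hXd' : HasDerivAt (fun s : ℝ => X (w + s • h)) (fderiv ℝ X w h) 0 :=
      HasFDerivAt.comp_hasDerivAt (x := (0 : ℝ)) (l := X) (by simpa using hXw) h0
    have hid : fderiv ℝ X w h = k := by
      have h2 : HasFDerivAt (fun y => X (e.symm y)) ((fderiv ℝ X w).comp (fderiv ℝ e.symm y)) y :=
        HasFDerivAt.comp y hXw hS1
      have h3 : HasFDerivAt (fun y => X (e.symm y)) (ContinuousLinearMap.id ℝ E) y :=
        (hasFDerivAt_id y).congr_of_eventuallyEq (by
          filter_upwards [e.open_target.mem_nhds hy] with z hz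
          rw [← he, e.right_inv hz]; rfl)
      exact congrArg (fun B : E →L[ℝ] E => B k) (h2.unique h3)
    rw [hXd.unique hXd', hid, show position w (A w) 1 = y from hyX] at hgauss
    have hsp := metric_velocity_eq hG hs hgeow (t := 1) (by simp)
    rw [show position w (A w) 1 = y from hyX] at hsp
    rw [h1, ← hgauss, ← hsp, mul_pow]
    have := sq_le_of_posDef (hs y) (hp y) (velocity w (A w) 1) k
    linarith
  · rw [mem_ball_zero_iff]
    exact (norm_position_le w (A w) ht).trans_lt hlt

end NormalEnergy

/-! ### A Riemannian metric in a chart -/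

section GlobalMetric

variable {E : Type*} [NormedAddCommGroup E] [NormedSpace ℝ E] [FiniteDimensional ℝ E]

/-- A bilinear form on a finite dimensional space, as a continuous bilinear form. -/
noncomputable def toContinuousBilinear (b : E →ₗ[ℝ] E →ₗ[ℝ] ℝ) : E →L[ℝ] E →L[ℝ] ℝ :=
  LinearMap.toContinuousLinearMap
    ((LinearMap.toContinuousLinearMap : (E →ₗ[ℝ] ℝ) ≃ₗ[ℝ] E →L[ℝ] ℝ).toLinearMap ∘ₗ b)

@[simp] theorem toContinuousBilinear_apply (b : E →ₗ[ℝ] E →ₗ[ℝ] ℝ) (u v : E) :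
    toContinuousBilinear b u v = b u v := rfl

set_option synthInstance.maxHeartbeats 200000 in
/-- A Riemannian metric near the origin of a vector space coincides near the origin with a
Riemannian metric defined everywhere. -/
theorem exists_global_metric {b : E → E →ₗ[ℝ] E →ₗ[ℝ] ℝ} {U : Set E} (hU : IsOpen U)
    (h0 : (0 : E) ∈ U) (hb : ∀ u v, ContDiffOn ℝ ∞ (fun z => b z u v) U)
    (hs : ∀ z ∈ U, ∀ u v, b z u v = b z v u) (hp : ∀ z ∈ U, ∀ v, v ≠ 0 → 0 < b z v v) :
    ∃ G : E → E →L[ℝ] E →L[ℝ] ℝ, ContDiff ℝ ∞ G ∧ (∀ x u v, G x u v = G x v u) ∧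
      (∀ x v, v ≠ 0 → 0 < G x v v) ∧ ∀ᶠ z in 𝓝 (0 : E), ∀ u v, G z u v = b z u v := by
  obtain ⟨R, hR, hRU⟩ := Metric.nhds_basis_closedBall.mem_iff.1 (hU.mem_nhds h0)
  let f : ContDiffBump (0 : E) := ⟨R / 2, R, by positivity, by linarith⟩
  have hf0 : ∀ z, z ∉ Metric.closedBall (0 : E) R → f z = 0 := fun z hz =>
    f.zero_of_le_dist (not_le.1 fun h => hz h).le
  -- Convex combinations of positive definite forms are positive definite, so `b z` can be
  -- interpolated to the constant form `b 0` away from the origin.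
  let G : E → E →L[ℝ] E →L[ℝ] ℝ := fun z =>
    toContinuousBilinear (f z • b z + (1 - f z) • b 0)
  have hGa : ∀ z u v, G z u v = f z * b z u v + (1 - f z) * b 0 u v := fun z u v => rfl
  refine ⟨G, ?_, fun z u v => ?_, fun z v hv => ?_, ?_⟩
  · rw [contDiff_clm_apply_iff]
    intro u
    rw [contDiff_clm_apply_iff]
    intro v
    simp only [hGa]
    rw [contDiff_iff_contDiffAt]
    intro z
    by_cases hz : z ∈ U
    · have h1 : ContDiffAt ℝ ∞ (fun z => b z u v) z := (hb u v).contDiffAt (hU.mem_nhds hz)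
      exact (f.contDiff.contDiffAt.mul h1).add
        ((contDiffAt_const.sub f.contDiff.contDiffAt).mul contDiffAt_const)
    · have h1 : (fun z => f z * b z u v + (1 - f z) * b 0 u v) =ᶠ[𝓝 z] fun _ => b 0 u v := by
        have : (Metric.closedBall (0 : E) R)ᶜ ∈ 𝓝 z :=
          Metric.isClosed_closedBall.isOpen_compl.mem_nhds fun h => hz (hRU h)
        filter_upwards [this] with y hy
        simp [hf0 y hy]
      exact contDiffAt_const.congr_of_eventuallyEq h1
  · rw [hGa, hGa, hs 0 h0 u v]
    by_cases hz : z ∈ U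
    · rw [hs z hz u v]
    · rw [hf0 z fun h => hz (hRU h)]; simp
  · rw [hGa]
    have hb0 := hp 0 h0 v hv
    by_cases hz : z ∈ U
    · have hbz := hp z hz v hv
      rcases eq_or_lt_of_le (f.nonneg (x := z)) with h | h
      · rw [← h]; simpa using hb0
      · have h1 : 0 ≤ 1 - f z := by linarith [f.le_one (x := z)]
        positivity
    · rw [hf0 z fun h => hz (hRU h)]; simpa using hb0
  · filter_upwards [Metric.closedBall_mem_nhds (0 : E) f.rIn_pos] with z hz u v
    rw [hGa, f.one_of_mem_closedBall hz]; simp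

end GlobalMetric

/-! ### The metric of the manifold read in the coordinates of a chart. -/

section ChartMetric

variable {E : Type*} [NormedAddCommGroup E] [NormedSpace ℝ E]
    {M : Type*} [EMetricSpace M] [ChartedSpace E M] [IsManifold 𝓘(ℝ, E) ∞ M]
    [RiemannianBundle (fun x : M => TangentSpace 𝓘(ℝ, E) x)]

/-- The Riemannian metric at `p`, in the coordinates given by the chart at `x`. -/
noncomputable def chartMetric (x p : M) : E →ₗ[ℝ] E →ₗ[ℝ] ℝ :=
  LinearMap.mk₂ ℝ (fun u v =>
    inner ℝ ((trivializationAt E (TangentSpace 𝓘(ℝ, E)) x).symmL ℝ p u : TangentSpace 𝓘(ℝ, E) p)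
      ((trivializationAt E (TangentSpace 𝓘(ℝ, E)) x).symmL ℝ p v : TangentSpace 𝓘(ℝ, E) p))
    (fun _ _ _ => by rw [map_add, inner_add_left])
    (fun _ _ _ => by rw [map_smul, real_inner_smul_left, smul_eq_mul])
    (fun _ _ _ => by rw [map_add, inner_add_right])
    (fun _ _ _ => by rw [map_smul, real_inner_smul_right, smul_eq_mul])

theorem chartMetric_apply (x p : M) (u v : E) : chartMetric x p u v =
    inner ℝ ((trivializationAt E (TangentSpace 𝓘(ℝ, E)) x).symmL ℝ p u : TangentSpace 𝓘(ℝ, E) p)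
      ((trivializationAt E (TangentSpace 𝓘(ℝ, E)) x).symmL ℝ p v : TangentSpace 𝓘(ℝ, E) p) := rfl

theorem chartMetric_symm (x p : M) (u v : E) : chartMetric x p u v = chartMetric x p v u := by
  rw [chartMetric_apply, chartMetric_apply, real_inner_comm]

theorem chartMetric_continuousLinearMapAt {x p : M} (hp : p ∈ (chartAt E x).source)
    (v : TangentSpace 𝓘(ℝ, E) p) {u : E}
    (hu : u = (trivializationAt E (TangentSpace 𝓘(ℝ, E)) x).continuousLinearMapAt ℝ p v) :
    chartMetric x p u u = ‖v‖ ^ 2 := by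
  have hp' : p ∈ (trivializationAt E (TangentSpace 𝓘(ℝ, E)) x).baseSet := by simpa using hp
  have h1 := (trivializationAt E (TangentSpace 𝓘(ℝ, E)) x).symmL_continuousLinearMapAt
    (R := ℝ) hp' v
  rw [chartMetric_apply, hu, h1, real_inner_self_eq_norm_sq]

theorem chartMetric_pos {x p : M} (hp : p ∈ (chartAt E x).source) {v : E} (hv : v ≠ 0) :
    0 < chartMetric x p v v := by
  have hp' : p ∈ (trivializationAt E (TangentSpace 𝓘(ℝ, E)) x).baseSet := by simpa using hp
  rw [chartMetric_apply, real_inner_self_pos]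
  intro h
  have h1 := (trivializationAt E (TangentSpace 𝓘(ℝ, E)) x).continuousLinearMapAt_symmL
    (R := ℝ) hp' v
  rw [h, map_zero] at h1
  exact hv h1.symm

variable [IsContMDiffRiemannianBundle 𝓘(ℝ, E) ∞ E (fun x : M => TangentSpace 𝓘(ℝ, E) x)]

theorem contMDiffOn_chartMetric (x : M) (u v : E) :
    ContMDiffOn 𝓘(ℝ, E) 𝓘(ℝ, ℝ) ∞ (fun p => chartMetric x p u v) (chartAt E x).source := by
  have hsec : ∀ u : E, ContMDiffOn 𝓘(ℝ, E) (𝓘(ℝ, E).prod 𝓘(ℝ, E)) ∞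
      (fun p : M => (⟨p, (trivializationAt E (TangentSpace 𝓘(ℝ, E)) x).symm p u⟩ :
        TotalSpace E (TangentSpace 𝓘(ℝ, E) : M → Type _))) (chartAt E x).source := by
    intro u
    have hbase : (trivializationAt E (TangentSpace 𝓘(ℝ, E)) x).baseSet =
      (chartAt E x).source := by simp
    rw [← hbase, (trivializationAt E (TangentSpace 𝓘(ℝ, E)) x).contMDiffOn_section_baseSet_iff]
    refine (contMDiffOn_const (c := u)).congr fun p hp => ?_
    rw [(trivializationAt E (TangentSpace 𝓘(ℝ, E)) x).apply_mk_symm hp]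
  have h := ContMDiffOn.inner_bundle (E := fun p : M => TangentSpace 𝓘(ℝ, E) p)
    (b := fun p : M => p)
    (v := fun p => (trivializationAt E (TangentSpace 𝓘(ℝ, E)) x).symm p u)
    (w := fun p => (trivializationAt E (TangentSpace 𝓘(ℝ, E)) x).symm p v) (hsec u) (hsec v)
  refine h.congr fun p hp => ?_
  rw [chartMetric_apply]
  have hp' : p ∈ (trivializationAt E (TangentSpace 𝓘(ℝ, E)) x).baseSet := by simpa using hp
  have hL : ∀ u : E, (trivializationAt E (TangentSpace 𝓘(ℝ, E)) x).symmL ℝ p u =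
      (trivializationAt E (TangentSpace 𝓘(ℝ, E)) x).symm p u := fun u =>
    (trivializationAt E (TangentSpace 𝓘(ℝ, E)) x).symmL_apply hp' u
  rw [hL, hL]

end ChartMetric

/-! ### The squared riemannian distance to a point is smooth near the point -/

section SquaredDistance

variable {E : Type*} [NormedAddCommGroup E] [NormedSpace ℝ E]
    {M : Type*} [EMetricSpace M] [ChartedSpace E M] [IsManifold 𝓘(ℝ, E) ∞ M]
    [RiemannianBundle (fun x : M => TangentSpace 𝓘(ℝ, E) x)]

/-- The trivialization of the tangent bundle is the derivative of the chart, hence sends the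
velocity of `γ` to its coordinate velocity. This translates lengths of paths into coordinates. -/
theorem chartMetric_deriv_eq {x : M} {γ : ℝ → M} {t : ℝ}
    (hγ : MDifferentiableAt 𝓘(ℝ, ℝ) 𝓘(ℝ, E) γ t) (ht : γ t ∈ (chartAt E x).source) {u : E}
    (hu : HasDerivAt (fun s => extChartAt 𝓘(ℝ, E) x (γ s)) u t) :
    chartMetric x (γ t) u u =
      ‖(mfderiv 𝓘(ℝ, ℝ) 𝓘(ℝ, E) γ t (1 : ℝ) : TangentSpace 𝓘(ℝ, E) (γ t))‖ ^ 2 := by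
  apply chartMetric_continuousLinearMapAt ht
  rw [TangentBundle.continuousLinearMapAt_trivializationAt ht]
  have h1 : HasMFDerivAt 𝓘(ℝ, ℝ) 𝓘(ℝ, E) (fun s => extChartAt 𝓘(ℝ, E) x (γ s)) t _ :=
    (mdifferentiableAt_extChartAt (I := 𝓘(ℝ, E)) ht).hasMFDerivAt.comp t hγ.hasMFDerivAt
  have h2 := hasMFDerivAt_unique h1 hu.hasFDerivAt.hasMFDerivAt
  have h3 := DFunLike.congr_fun h2 (1 : ℝ)
  exact (h3.trans (one_smul ℝ u)).symm

/-- The path has constant speed `√ℓ` during unit time. Applied to geodesics from `x`, this is the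
upper bound for the distance. -/
theorem edist_le_of_path [IsRiemannianManifold 𝓘(ℝ, E) M] {x : M} {c c' : ℝ → E} {ℓ : ℝ}
    (hc : ∀ t, HasDerivAt c (c' t) t) (hc' : Continuous c')
    (hct : ∀ t ∈ Icc (0 : ℝ) 1, c t ∈ (extChartAt 𝓘(ℝ, E) x).target)
    (hℓ : ∀ t ∈ Icc (0 : ℝ) 1,
      chartMetric x ((extChartAt 𝓘(ℝ, E) x).symm (c t)) (c' t) (c' t) = ℓ) :
    edist ((extChartAt 𝓘(ℝ, E) x).symm (c 0)) ((extChartAt 𝓘(ℝ, E) x).symm (c 1)) ≤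
      ENNReal.ofReal √ℓ := by
  have hc1 : ContDiff ℝ 1 c := by
    rw [contDiff_one_iff_deriv]
    refine ⟨fun t => (hc t).differentiableAt, ?_⟩
    rwa [show deriv c = c' from funext fun t => (hc t).deriv]
  have hO : IsOpen (c ⁻¹' (extChartAt 𝓘(ℝ, E) x).target) :=
    (isOpen_extChartAt_target x).preimage hc1.continuous
  set γ : ℝ → M := fun t => (extChartAt 𝓘(ℝ, E) x).symm (c t) with hγ
  have hγs : ContMDiffOn 𝓘(ℝ, ℝ) 𝓘(ℝ, E) 1 γ (c ⁻¹' (extChartAt 𝓘(ℝ, E) x).target) :=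
    (contMDiffOn_extChartAt_symm x).comp hc1.contMDiff.contMDiffOn (subset_refl _)
  rw [IsRiemannianManifold.out (I := 𝓘(ℝ, E))]
  refine (Manifold.riemannianEDist_le_pathELength (hγs.mono hct) rfl rfl zero_le_one).trans ?_
  rw [Manifold.pathELength_eq_lintegral_mfderiv_Icc]
  have hle : ∀ t ∈ Icc (0 : ℝ) 1,
      ‖(mfderiv 𝓘(ℝ, ℝ) 𝓘(ℝ, E) γ t (1 : ℝ) : TangentSpace 𝓘(ℝ, E) (γ t))‖ₑ ≤
        ENNReal.ofReal √ℓ := by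
    intro t ht
    have hmem := hct t ht
    have h1 : MDifferentiableAt 𝓘(ℝ, ℝ) 𝓘(ℝ, E) γ t :=
      (hγs.contMDiffAt (hO.mem_nhds hmem)).mdifferentiableAt one_ne_zero
    have h2 : HasDerivAt (fun s => extChartAt 𝓘(ℝ, E) x (γ s)) (c' t) t := by
      refine (hc t).congr_of_eventuallyEq ?_
      filter_upwards [hO.mem_nhds hmem] with s hs
      exact (extChartAt 𝓘(ℝ, E) x).right_inv hs
    have h3 := chartMetric_deriv_eq (x := x) h1
      (extChartAt_source 𝓘(ℝ, E) x ▸ (extChartAt 𝓘(ℝ, E) x).map_target hmem) h2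
    rw [hℓ t ht] at h3
    rw [h3, Real.sqrt_sq (norm_nonneg _), ofReal_norm]
  calc _ ≤ ∫⁻ t in Icc (0 : ℝ) 1, ENNReal.ofReal √ℓ :=
        MeasureTheory.setLIntegral_mono' measurableSet_Icc hle
    _ = ENNReal.ofReal √ℓ := by simp

variable [FiniteDimensional ℝ E]

/-- The length of a path bounds the increase of the square root of a function whose gradient is
bounded as in the eikonal inequality. -/
theorem ofReal_sqrt_sub_le_pathELength {x : M} {γ : ℝ → M}
    (hγ : ContMDiff 𝓘(ℝ, ℝ) 𝓘(ℝ, E) 1 γ) (hγs : ∀ t ∈ Icc (0 : ℝ) 1, γ t ∈ (chartAt E x).source)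
    {ρ : E → ℝ}
    (hρ : ∀ t ∈ Icc (0 : ℝ) 1, ContDiffAt ℝ ∞ ρ (extChartAt 𝓘(ℝ, E) x (γ t)) ∧
      0 ≤ ρ (extChartAt 𝓘(ℝ, E) x (γ t)) ∧
      ∀ k, (fderiv ℝ ρ (extChartAt 𝓘(ℝ, E) x (γ t)) k) ^ 2 ≤
        4 * ρ (extChartAt 𝓘(ℝ, E) x (γ t)) * chartMetric x (γ t) k k) {ε : ℝ} (hε : 0 < ε) :
    ENNReal.ofReal (√(ρ (extChartAt 𝓘(ℝ, E) x (γ 1)) + ε ^ 2) -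
      √(ρ (extChartAt 𝓘(ℝ, E) x (γ 0)) + ε ^ 2)) ≤ Manifold.pathELength 𝓘(ℝ, E) γ 0 1 := by
  -- The term `ε ^ 2` keeps the square root differentiable where `ρ` vanishes, in particular at the
  -- starting point `x` in the application.
  set F : ℝ → ℝ := fun t => √(ρ (extChartAt 𝓘(ℝ, E) x (γ t)) + ε ^ 2) with hF
  have hφγ : ∀ t ∈ Icc (0 : ℝ) 1, ContDiffAt ℝ 1 (fun s => extChartAt 𝓘(ℝ, E) x (γ s)) t := by
    intro t ht
    rw [← contMDiffAt_iff_contDiffAt]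
    exact (contMDiffAt_extChartAt' (hγs t ht)).comp t (hγ t)
  have hFd : ∀ t ∈ Icc (0 : ℝ) 1, ContDiffAt ℝ 1 F t := by
    intro t ht
    obtain ⟨h1, h2, -⟩ := hρ t ht
    have h3 : ContDiffAt ℝ 1 (fun s => ρ (extChartAt 𝓘(ℝ, E) x (γ s)) + ε ^ 2) t :=
      (ContDiffAt.comp t (h1.of_le (by simp)) (hφγ t ht)).add contDiffAt_const
    exact h3.sqrt (by positivity)
  -- The gradient bound on `ρ` says that `√(ρ + ε ^ 2)` changes at most as fast as arc length.
  have hFle : ∀ t ∈ Icc (0 : ℝ) 1, ‖derivWithin F (Icc 0 1) t‖ₑ ≤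
      ‖(mfderiv 𝓘(ℝ, ℝ) 𝓘(ℝ, E) γ t (1 : ℝ) : TangentSpace 𝓘(ℝ, E) (γ t))‖ₑ := by
    intro t ht
    obtain ⟨h1, h2, h3⟩ := hρ t ht
    have hu := ((hφγ t ht).differentiableAt one_ne_zero).hasDerivAt
    set u := deriv (fun s => extChartAt 𝓘(ℝ, E) x (γ s)) t
    have h4 : HasDerivAt (fun s => ρ (extChartAt 𝓘(ℝ, E) x (γ s)) + ε ^ 2)
        (fderiv ℝ ρ (extChartAt 𝓘(ℝ, E) x (γ t)) u) t :=
      ((h1.differentiableAt (by simp)).hasFDerivAt.comp_hasDerivAt t hu).add_const _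
    have h5 : HasDerivAt F _ t := h4.sqrt (by positivity)
    rw [h5.hasDerivWithinAt.derivWithin (uniqueDiffOn_Icc zero_lt_one t ht)]
    rw [← ofReal_norm, ← ofReal_norm]
    apply ENNReal.ofReal_le_ofReal
    rw [Real.norm_eq_abs]
    refine abs_le_of_sq_le_sq ?_ (norm_nonneg _)
    rw [← chartMetric_deriv_eq ((hγ t).mdifferentiableAt one_ne_zero) (hγs t ht) hu]
    have h6 := h3 u
    have h7 : 0 ≤ chartMetric x (γ t) u u := by
      rw [chartMetric_apply]; exact real_inner_self_nonneg
    have h8 : 0 < ρ (extChartAt 𝓘(ℝ, E) x (γ t)) + ε ^ 2 := by positivity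
    rw [div_pow, mul_pow, Real.sq_sqrt h8.le, div_le_iff₀ (by positivity)]
    have := mul_nonneg (sq_nonneg ε) h7
    linarith
  calc ENNReal.ofReal (F 1 - F 0) ≤ ‖F 1 - F 0‖ₑ := by
        rw [← ofReal_norm]; exact ENNReal.ofReal_le_ofReal (le_abs_self _)
    _ ≤ ∫⁻ t in Icc (0 : ℝ) 1, ‖derivWithin F (Icc 0 1) t‖ₑ :=
        enorm_sub_le_lintegral_derivWithin_Icc_of_contDiffOn_Icc
          (fun t ht => (hFd t ht).contDiffWithinAt) zero_le_one
    _ ≤ _ := by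
        rw [Manifold.pathELength_eq_lintegral_mfderiv_Icc]
        exact MeasureTheory.setLIntegral_mono' measurableSet_Icc hFle

/-- The square of the distance to a point `x` of a riemannian manifold is smooth near `x`, and it is
comparable to the square of the norm in a chart. -/
theorem exists_smooth_sq_dist [IsRiemannianManifold 𝓘(ℝ, E) M]
    [IsContMDiffRiemannianBundle 𝓘(ℝ, E) ∞ E (fun x : M => TangentSpace 𝓘(ℝ, E) x)] (x : M) :
    ∃ r : M → ℝ, r x = 0 ∧ ∃ c > 0, ∀ᶠ y in 𝓝 x, edist y x = ENNReal.ofReal √(r y) ∧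
      ContMDiffAt 𝓘(ℝ, E) 𝓘(ℝ, ℝ) ∞ r y ∧
      c * ‖extChartAt 𝓘(ℝ, E) x y - extChartAt 𝓘(ℝ, E) x x‖ ^ 2 ≤ r y := by
  set φ := extChartAt 𝓘(ℝ, E) x with hφ
  let U : Set E := (fun z => φ x + z) ⁻¹' φ.target
  have hUo : IsOpen U := (isOpen_extChartAt_target x).preimage (by fun_prop)
  have h0U : (0 : E) ∈ U := by
    change φ x + 0 ∈ φ.target
    rw [add_zero]; exact mem_extChartAt_target x
  have hsrc : ∀ z ∈ U, φ.symm (φ x + z) ∈ (chartAt E x).source := fun z hz =>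
    extChartAt_source 𝓘(ℝ, E) x ▸ φ.map_target hz
  obtain ⟨G, hG, hGs, hGp, hGb⟩ := exists_global_metric
    (b := fun z => chartMetric x (φ.symm (φ x + z))) hUo h0U
    (fun u v => by
      rw [← contMDiffOn_iff_contDiffOn]
      refine (contMDiffOn_chartMetric x u v).comp
        ((contMDiffOn_extChartAt_symm x).comp
          (t := φ.target) (f := fun z : E => φ x + z) ?_ fun z hz => hz) hsrc
      exact (contDiff_const.add contDiff_id).contMDiff.contMDiffOn)
    (fun z _ u v => chartMetric_symm x _ u v) (fun z hz v hv => chartMetric_pos (hsrc z hz) hv)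
  obtain ⟨ρ, hρ0, c, hc, hρ⟩ := exists_normal_energy hG hGs hGp
    (inter_mem hGb (hUo.mem_nhds h0U))
  have hφt : Tendsto (fun y => φ y - φ x) (𝓝 x) (𝓝 0) := by
    have h1 : ContinuousAt (fun y => φ y - φ x) x :=
      (continuousAt_extChartAt x).sub continuousAt_const
    simpa [ContinuousAt] using h1
  have hO := (hφt.eventually (hρ.and hGb)).and (chart_source_mem_nhds E x)
  obtain ⟨R, hR, hRO⟩ := EMetric.mem_nhds_iff.1 hO
  refine ⟨fun y => ρ (φ y - φ x), by simp [hρ0], c, hc, ?_⟩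
  filter_upwards [Metric.eball_mem_nhds x hR] with y hyR
  obtain ⟨⟨⟨hy1, hy2, hy3, γ, γ', hγ, hγ', hγ0, hγ1, hγt⟩, hyG⟩, hys⟩ := hRO hyR
  have hleft : ∀ p ∈ (chartAt E x).source, φ.symm (φ p) = p := fun p hp =>
    φ.left_inv (extChartAt_source 𝓘(ℝ, E) x ▸ hp)
  have hρy : 0 ≤ ρ (φ y - φ x) := le_trans (by positivity) hy2
  refine ⟨le_antisymm ?_ ?_, ?_, hy2⟩
  · have h1 := edist_le_of_path (x := x) (c := fun t => φ x + γ t) (c' := γ')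
      (ℓ := ρ (φ y - φ x))
      (fun t => (hγ t).const_add _) hγ' (fun t ht => (hγt t ht).1.2)
      (fun t ht => by
        rw [← (hγt t ht).2]
        exact ((hγt t ht).1.1 _ _).symm)
    simp only [hγ0, hγ1, add_zero, add_sub_cancel] at h1
    rw [← hφ, hleft x (mem_chart_source E x), hleft y hys] at h1
    rwa [edist_comm]
  -- A path from `x` to `y` shorter than both `R` and `√ρ` stays in the ball of radius `R`, where
  -- the gradient bound holds; so its length is at least `√(ρ + ε ^ 2) - ε` for every `ε > 0`.
  · by_contra! hlt
    have hlt' : Manifold.riemannianEDist 𝓘(ℝ, E) x y <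
        min R (ENNReal.ofReal √(ρ (φ y - φ x))) := by
      rw [← IsRiemannianManifold.out (I := 𝓘(ℝ, E)), edist_comm]
      exact lt_min hyR hlt
    obtain ⟨η, hη0, hη1, hη, hηlen, -⟩ :=
      Manifold.exists_lt_locally_constant_of_riemannianEDist_lt hlt' zero_lt_one
    have hηO : ∀ t ∈ Icc (0 : ℝ) 1, η t ∈ Metric.eball x R := by
      intro t ht
      rw [Metric.mem_eball, edist_comm, IsRiemannianManifold.out (I := 𝓘(ℝ, E))]
      refine ((Manifold.riemannianEDist_le_pathELength hη.contMDiffOn hη0 rfl ht.1).trans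
        (Manifold.pathELength_mono le_rfl ht.2)).trans_lt (hηlen.trans_le (min_le_left _ _))
    have hkey : ∀ ε > 0, ENNReal.ofReal (√(ρ (φ y - φ x) + ε ^ 2) - ε) ≤
        Manifold.pathELength 𝓘(ℝ, E) η 0 1 := by
      intro ε hε
      have h1 := ofReal_sqrt_sub_le_pathELength (x := x) hη (fun t ht => (hRO (hηO t ht)).2)
        (ρ := fun z => ρ (z - φ x)) (fun t ht => by
          obtain ⟨⟨⟨h1, h2, h3, -⟩, h4⟩, h5⟩ := hRO (hηO t ht)
          refine ⟨ContDiffAt.comp (φ (η t)) h1 (contDiffAt_id.sub contDiffAt_const),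
            le_trans (by positivity) h2, fun k => ?_⟩
          have h6 := h3 k
          rw [h4, add_sub_cancel, hleft _ h5] at h6
          rwa [← fderiv_comp_sub] at h6) hε
      rw [hη0, hη1] at h1
      simpa only [← hφ, sub_self, hρ0, zero_add, Real.sqrt_sq hε.le] using h1
    have hlen := hηlen.trans_le (min_le_right _ _)
    have hfin : Manifold.pathELength 𝓘(ℝ, E) η 0 1 ≠ ⊤ := (hlen.trans ENNReal.ofReal_lt_top).ne
    have hlen' : (Manifold.pathELength 𝓘(ℝ, E) η 0 1).toReal < √(ρ (φ y - φ x)) :=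
      ENNReal.toReal_lt_of_lt_ofReal hlen
    set s := √(ρ (φ y - φ x))
    set ℓ := (Manifold.pathELength 𝓘(ℝ, E) η 0 1).toReal
    -- For this `ε` the bound gives `s - ε ≤ ℓ`, whereas `s - ε` is the midpoint of `ℓ` and `s`,
    -- hence larger than `ℓ`.
    have hε : 0 < (s - ℓ) / 2 := by linarith
    have h1 := (ENNReal.ofReal_le_iff_le_toReal hfin).1 (hkey _ hε)
    have h2 : s ≤ √(ρ (φ y - φ x) + ((s - ℓ) / 2) ^ 2) :=
      Real.sqrt_le_sqrt (by nlinarith)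
    linarith
  · have h1 : ContMDiffAt 𝓘(ℝ, E) 𝓘(ℝ, E) ∞ (fun y => φ y - φ x) y :=
      (contMDiffAt_extChartAt' hys).sub contMDiffAt_const
    exact ContMDiffAt.comp y hy1.contMDiffAt h1

end SquaredDistance

/-! ### Radial functions -/

section RadialCalculus

variable {E : Type*} [NormedAddCommGroup E] [NormedSpace ℝ E]

/-- A smooth function with a nondegenerate minimum increases in radial directions. -/
theorem eventually_fderiv_radial_pos {f : E → ℝ} (hf : ∀ᶠ v in 𝓝 (0 : E), ContDiffAt ℝ ∞ f v)
    (h0 : f 0 = 0) {c : ℝ} (hc : 0 < c) (hle : ∀ᶠ v in 𝓝 (0 : E), c * ‖v‖ ^ 2 ≤ f v) :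
    ∀ᶠ v in 𝓝 (0 : E), v ≠ 0 → 0 < fderiv ℝ f v v := by
  have hf0 := hf.self_of_nhds
  have hmin : fderiv ℝ f 0 = 0 := by
    apply IsLocalMin.fderiv_eq_zero
    filter_upwards [hle] with v hv
    rw [h0]; exact le_trans (by positivity) hv
  have hd : DifferentiableAt ℝ (fderiv ℝ f) 0 :=
    (hf0.fderiv_right (m := ∞) (by simp)).differentiableAt (by simp)
  -- The derivative at `v` in the direction `v` is compared with `B v v`, and `f v` with half of it,
  -- both up to `c / 4 * ‖v‖ ^ 2`. From `f v ≥ c * ‖v‖ ^ 2` the radial derivative is at least `5 * c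
  -- / 4 * ‖v‖ ^ 2`.
  set B := fderiv ℝ (fderiv ℝ f) 0
  have hB : ∀ᶠ v in 𝓝 (0 : E), ‖fderiv ℝ f v - B v‖ ≤ c / 4 * ‖v‖ := by
    have := hd.hasFDerivAt.isLittleO.def (show 0 < c / 4 by positivity)
    simpa [hmin] using this
  obtain ⟨ε, hε, H⟩ := Metric.eventually_nhds_iff_ball.1 (hB.and (hf.and hle))
  filter_upwards [Metric.ball_mem_nhds (0 : E) hε] with v hv hv0
  have hvpos : 0 < ‖v‖ := norm_pos_iff.2 hv0
  have hmem : ∀ t ∈ Icc (0 : ℝ) 1, t • v ∈ Metric.ball (0 : E) ε := by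
    intro t ht
    rw [mem_ball_zero_iff, norm_smul, Real.norm_eq_abs, abs_of_nonneg ht.1]
    rw [mem_ball_zero_iff] at hv
    exact (mul_le_of_le_one_left (norm_nonneg v) ht.2).trans_lt hv
  have hsm : ∀ t : ℝ, HasDerivAt (fun t : ℝ => t • v) v t := fun t => by
    simpa using (hasDerivAt_id t).smul_const v
  have hbound : ∀ t ∈ Icc (0 : ℝ) 1, ‖fderiv ℝ f (t • v) v - t * B v v‖ ≤ c / 4 * ‖v‖ ^ 2 := by
    intro t ht
    have h1 := (H _ (hmem t ht)).1
    have h2 := (fderiv ℝ f (t • v) - B (t • v)).le_opNorm v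
    have h3 : (fderiv ℝ f (t • v) - B (t • v)) v = fderiv ℝ f (t • v) v - t * B v v := by
      simp
    rw [h3] at h2
    refine h2.trans ?_
    have h4 : ‖t • v‖ ≤ ‖v‖ := by
      rw [norm_smul, Real.norm_eq_abs, abs_of_nonneg ht.1]
      exact mul_le_of_le_one_left (norm_nonneg v) ht.2
    calc _ ≤ c / 4 * ‖t • v‖ * ‖v‖ := by gcongr
      _ ≤ c / 4 * ‖v‖ * ‖v‖ := by gcongr
      _ = _ := by ring
  have hmv := (convex_Icc (0 : ℝ) 1).norm_image_sub_le_of_norm_hasDerivWithin_le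
    (f := fun t => f (t • v) - t ^ 2 / 2 * B v v)
    (f' := fun t => fderiv ℝ f (t • v) v - t * B v v) (C := c / 4 * ‖v‖ ^ 2)
    (fun t ht => by
      have h1 : HasDerivAt (fun t : ℝ => f (t • v)) (fderiv ℝ f (t • v) v) t :=
        (((H _ (hmem t ht)).2.1.differentiableAt (by simp)).hasFDerivAt).comp_hasDerivAt t (hsm t)
      have h2 : HasDerivAt (fun t : ℝ => t ^ 2 / 2 * B v v) (t * B v v) t := by
        have := (((hasDerivAt_id t).pow 2).div_const 2).mul_const (B v v)
        exact this.congr_deriv (by simp)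
      exact (h1.sub h2).hasDerivWithinAt) hbound (left_mem_Icc.2 zero_le_one)
    (right_mem_Icc.2 zero_le_one)
  simp only [one_smul, zero_smul, h0] at hmv
  have h1 := (le_abs_self _).trans hmv
  have h2 := (H v hv).2.2
  have h3 := (abs_le.1 (hbound 1 (right_mem_Icc.2 zero_le_one))).1
  simp only [one_smul] at h3
  have h4 : 0 < c * ‖v‖ ^ 2 := by positivity
  norm_num at h1
  nlinarith

end RadialCalculus

/-! ### Independence of the radial property from the chart. -/

section RadialManifold

variable {E : Type*} [NormedAddCommGroup E] [NormedSpace ℝ E]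
    {M : Type*} [TopologicalSpace M] [ChartedSpace E M] [IsManifold 𝓘(ℝ, E) ∞ M]

/-- A real function on a manifold is radial at `x` if, in every chart, it increases in the radial
directions from `x` near `x`. -/
def IsRadial (E : Type*) [NormedAddCommGroup E] [NormedSpace ℝ E]
    {M : Type*} [TopologicalSpace M] [ChartedSpace E M] (r : M → ℝ) (x : M) : Prop :=
  ∀ ψ ∈ IsManifold.maximalAtlas 𝓘(ℝ, E) ∞ M, x ∈ ψ.source →
    ∀ᶠ y in 𝓝 x, y ≠ x → 0 < fderiv ℝ (fun v => r (ψ.symm v)) (ψ y) (ψ y - ψ x)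

theorem contDiffAt_comp_symm {r : M → ℝ} {ψ : OpenPartialHomeomorph M E}
    (hψ : ψ ∈ IsManifold.maximalAtlas 𝓘(ℝ, E) ∞ M) {v : E} (hv : v ∈ ψ.target)
    (hr : ContMDiffAt 𝓘(ℝ, E) 𝓘(ℝ, ℝ) ∞ r (ψ.symm v)) :
    ContDiffAt ℝ ∞ (fun v => r (ψ.symm v)) v := by
  rw [← contMDiffAt_iff_contDiffAt]
  exact hr.comp v (contMDiffAt_symm_of_mem_maximalAtlas hψ hv)

theorem contDiffAt_transition {φ ψ : OpenPartialHomeomorph M E}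
    (hφ : φ ∈ IsManifold.maximalAtlas 𝓘(ℝ, E) ∞ M) (hψ : ψ ∈ IsManifold.maximalAtlas 𝓘(ℝ, E) ∞ M)
    {v : E} (hv : v ∈ ψ.target) (hv' : ψ.symm v ∈ φ.source) :
    ContDiffAt ℝ ∞ (fun v => φ (ψ.symm v)) v := by
  rw [← contMDiffAt_iff_contDiffAt]
  exact (contMDiffAt_of_mem_maximalAtlas hφ hv').comp v
    (contMDiffAt_symm_of_mem_maximalAtlas hψ hv)

/-- A quadratic lower bound survives a change of chart: the transition map is differentiable, so
norms in the two charts are comparable with some factor `K`, and `c` becomes `c / K ^ 2`. All charts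
are needed because later ones are adapted to submanifolds. -/
theorem isRadial_of_le {r : M → ℝ} {x : M} (hx : r x = 0)
    (hr : ∀ᶠ y in 𝓝 x, ContMDiffAt 𝓘(ℝ, E) 𝓘(ℝ, ℝ) ∞ r y) {c : ℝ} (hc : 0 < c)
    (hle : ∀ᶠ y in 𝓝 x, c * ‖chartAt E x y - chartAt E x x‖ ^ 2 ≤ r y) :
    IsRadial E r x := by
  intro ψ hψ hxψ
  have hx' : ψ x ∈ ψ.target := ψ.map_source hxψ
  have hsymm : Tendsto (fun v => ψ.symm (ψ x + v)) (𝓝 0) (𝓝 x) := by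
    have h1 : ContinuousAt ψ.symm (ψ x) := ψ.continuousAt_symm hx'
    have h2 : Tendsto (fun v => ψ x + v) (𝓝 (0 : E)) (𝓝 (ψ x)) := by
      have : ContinuousAt (fun v => ψ x + v) (0 : E) := by fun_prop
      simpa [ContinuousAt] using this
    have := h1.tendsto.comp h2
    rwa [ψ.left_inv hxψ] at this
  have htarget : ∀ᶠ v in 𝓝 (0 : E), ψ x + v ∈ ψ.target := by
    have h2 : Tendsto (fun v => ψ x + v) (𝓝 (0 : E)) (𝓝 (ψ x)) := by
      have : ContinuousAt (fun v => ψ x + v) (0 : E) := by fun_prop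
      simpa [ContinuousAt] using this
    exact h2 (ψ.open_target.mem_nhds hx')
  have hadd : ContDiff ℝ ∞ fun v : E => ψ x + v := contDiff_const.add contDiff_id
  have hbig : (fun v => v) =O[𝓝 (0 : E)]
      (fun v => chartAt E x (ψ.symm (ψ x + v)) - chartAt E x x) := by
    have hφ := IsManifold.chart_mem_maximalAtlas (I := 𝓘(ℝ, E)) (n := ∞) x
    have hxs := mem_chart_source E x
    have h1 : DifferentiableAt ℝ (fun z => ψ ((chartAt E x).symm z)) (chartAt E x x) :=
      (contDiffAt_transition hψ hφ ((chartAt E x).map_source hxs)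
        (by rwa [(chartAt E x).left_inv hxs])).differentiableAt (by simp)
    have h2 : Tendsto (fun v => chartAt E x (ψ.symm (ψ x + v))) (𝓝 0) (𝓝 (chartAt E x x)) :=
      ((chartAt E x).continuousAt hxs).tendsto.comp hsymm
    have h3 := h1.isBigO_sub.comp_tendsto h2
    refine h3.congr' ?_ EventuallyEq.rfl
    filter_upwards [htarget, hsymm ((chartAt E x).open_source.mem_nhds hxs)] with v hv hv'
    simp only [Function.comp_apply]
    rw [(chartAt E x).left_inv hv', (chartAt E x).left_inv hxs, ψ.right_inv hv]
    simp
  obtain ⟨K, hK, hbound⟩ := hbig.exists_pos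
  have hpos := eventually_fderiv_radial_pos (f := fun v => r (ψ.symm (ψ x + v)))
    (c := c / K ^ 2) (by
      filter_upwards [htarget, hsymm.eventually hr] with v hv hv'
      exact ContDiffAt.comp v (g := fun v => r (ψ.symm v)) (contDiffAt_comp_symm hψ hv hv')
        hadd.contDiffAt)
    (by simp [ψ.left_inv hxψ, hx]) (by positivity) (by
      filter_upwards [hbound.bound, hsymm.eventually hle] with v hv hv'
      refine le_trans ?_ hv'
      rw [div_mul_eq_mul_div, div_le_iff₀ (by positivity), mul_assoc, ← mul_pow]
      gcongr
      rwa [mul_comm])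
  have hlim : Tendsto (fun y => ψ y - ψ x) (𝓝 x) (𝓝 0) := by
    have : ContinuousAt (fun y => ψ y - ψ x) x := (ψ.continuousAt hxψ).sub continuousAt_const
    simpa [ContinuousAt] using this
  filter_upwards [hlim.eventually hpos, ψ.open_source.mem_nhds hxψ] with y hy hys hyx
  have h1 := hy (fun h => hyx (ψ.injOn hys hxψ (sub_eq_zero.1 h)))
  have h2 := fderiv_comp_add_left (𝕜 := ℝ) (f := fun v => r (ψ.symm v)) (ψ x) (x := ψ y - ψ x)
  rw [h2] at h1
  simpa using h1

end RadialManifold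

/-! ### Centered charts and slices -/

section Charts

variable {E : Type*} [NormedAddCommGroup E] [NormedSpace ℝ E]
    {M : Type*} [TopologicalSpace M] [ChartedSpace E M]

/-- A smooth chart of `M` that sends `p` to `0`. -/
structure IsCenteredChart (χ : OpenPartialHomeomorph M E) (p : M) : Prop where
  mem_atlas : χ ∈ IsManifold.maximalAtlas 𝓘(ℝ, E) ∞ M
  mem_source : p ∈ χ.source
  map_eq : χ p = 0

namespace IsCenteredChart

variable {χ : OpenPartialHomeomorph M E} {p : M}

theorem zero_mem_target (h : IsCenteredChart χ p) : (0 : E) ∈ χ.target := by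
  rw [← h.map_eq]; exact χ.map_source h.mem_source

theorem symm_zero (h : IsCenteredChart χ p) : χ.symm 0 = p := by
  rw [← h.map_eq]; exact χ.left_inv h.mem_source

theorem tendsto (h : IsCenteredChart χ p) : Tendsto χ (𝓝 p) (𝓝 0) := by
  have := (χ.continuousAt h.mem_source).tendsto
  rwa [h.map_eq] at this

theorem tendsto_symm (h : IsCenteredChart χ p) : Tendsto χ.symm (𝓝 0) (𝓝 p) := by
  have := (χ.continuousAt_symm h.zero_mem_target).tendsto
  rwa [h.symm_zero] at this

theorem eventually_source (h : IsCenteredChart χ p) : ∀ᶠ q in 𝓝 p, q ∈ χ.source :=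
  χ.open_source.mem_nhds h.mem_source

theorem eventually_target (h : IsCenteredChart χ p) : ∀ᶠ v in 𝓝 (0 : E), v ∈ χ.target :=
  χ.open_target.mem_nhds h.zero_mem_target

theorem eventually_left_inv (h : IsCenteredChart χ p) : ∀ᶠ q in 𝓝 p, χ.symm (χ q) = q :=
  h.eventually_source.mono fun _ => χ.left_inv

theorem eventually_right_inv (h : IsCenteredChart χ p) :
    ∀ᶠ v in 𝓝 (0 : E), χ (χ.symm v) = v :=
  h.eventually_target.mono fun _ => χ.right_inv

variable [IsManifold 𝓘(ℝ, E) ∞ M]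

theorem exists_comp [CompleteSpace E] (h : IsCenteredChart χ p) {Θ : E → E}
    (hΘ : ∀ᶠ v in 𝓝 0, ContDiffAt ℝ ∞ Θ v) (h0 : Θ 0 = 0) {A : E ≃L[ℝ] E}
    (hA : HasFDerivAt Θ (A : E →L[ℝ] E) 0) :
    ∃ χ' : OpenPartialHomeomorph M E, IsCenteredChart χ' p ∧ χ'.source ⊆ χ.source ∧
      ∀ q, χ' q = Θ (χ q) := by
  obtain ⟨e, he0, heΘ, hsm, hsm'⟩ := exists_localDiffeomorph hΘ hA
  refine ⟨χ.trans e, ⟨?_, ?_, ?_⟩, ?_, ?_⟩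
  · have h1 := (IsManifold.mem_maximalAtlas_iff_contMDiffOn (I := 𝓘(ℝ, E)) (n := ∞) χ).1 h.mem_atlas
    rw [IsManifold.mem_maximalAtlas_iff_contMDiffOn]
    constructor
    · refine (contMDiffOn_iff_contDiffOn.2 hsm).comp (h1.1.mono ?_) ?_
      · intro q hq; exact (χ.trans_source e ▸ hq).1
      · intro q hq; exact (χ.trans_source e ▸ hq).2
    · refine h1.2.comp ((contMDiffOn_iff_contDiffOn.2 hsm').mono ?_) ?_
      · intro q hq; exact (χ.trans_target e ▸ hq).1
      · intro q hq; exact (χ.trans_target e ▸ hq).2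
  · rw [χ.trans_source]; exact ⟨h.mem_source, by simpa [h.map_eq] using he0⟩
  · simp [h.map_eq, heΘ, h0]
  · rw [χ.trans_source]; exact inter_subset_left
  · intro q; simp [heΘ]

/-- Making the image a ball, hence convex, is what later yields connected slices and half balls. -/
theorem exists_shrink (h : IsCenteredChart χ p) {O : Set M} (hO : O ∈ 𝓝 p) :
    ∃ χ' : OpenPartialHomeomorph M E, IsCenteredChart χ' p ∧ χ'.source ⊆ χ.source ∧
      χ'.source ⊆ O ∧ (∀ q, χ' q = χ q) ∧ ∃ ε > 0, χ'.target = Metric.ball 0 ε := by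
  obtain ⟨ε, hε, hball⟩ := Metric.nhds_basis_ball.mem_iff.1
    (h.eventually_target.and (h.tendsto_symm.eventually hO))
  have hsub : Metric.ball 0 ε ⊆ χ.target := fun v hv => (hball hv).1
  refine ⟨(χ.symm.restrOpen (Metric.ball 0 ε) Metric.isOpen_ball).symm, ⟨?_, ?_, ?_⟩, ?_, ?_, ?_,
    ε, hε, ?_⟩
  · have h1 := (IsManifold.mem_maximalAtlas_iff_contMDiffOn (I := 𝓘(ℝ, E)) (n := ∞) χ).1 h.mem_atlas
    rw [IsManifold.mem_maximalAtlas_iff_contMDiffOn]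
    exact ⟨h1.1.mono fun q hq => hq.1, h1.2.mono fun q hq => hq.1⟩
  · exact ⟨h.mem_source, by simp [h.map_eq, hε]⟩
  · exact h.map_eq
  · exact fun q hq => hq.1
  · rintro q ⟨hq, hq'⟩
    have : O (χ.symm (χ q)) := (hball hq').2
    rwa [χ.left_inv hq] at this
  · exact fun q => rfl
  · exact inter_eq_right.2 hsub

theorem exists_of_mem_atlas [CompleteSpace E]
    (hχ : χ ∈ IsManifold.maximalAtlas 𝓘(ℝ, E) ∞ M) (hp : p ∈ χ.source) :
    ∃ χ' : OpenPartialHomeomorph M E, IsCenteredChart χ' p ∧ χ'.source = χ.source ∧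
      ∀ q, χ' q = χ q - χ p := by
  refine ⟨χ.trans (Homeomorph.subRight (χ p)).toOpenPartialHomeomorph, ⟨?_, ?_, ?_⟩, ?_, ?_⟩
  · have h1 := (IsManifold.mem_maximalAtlas_iff_contMDiffOn (I := 𝓘(ℝ, E)) (n := ∞) χ).1 hχ
    rw [IsManifold.mem_maximalAtlas_iff_contMDiffOn]
    have hs : ContDiff ℝ ∞ fun v : E => v - χ p := contDiff_id.sub contDiff_const
    have ha : ContDiff ℝ ∞ fun v : E => v + χ p := contDiff_id.add contDiff_const
    constructor
    · exact hs.contMDiff.comp_contMDiffOn (h1.1.mono (by simp))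
    · refine h1.2.comp ha.contMDiff.contMDiffOn ?_
      intro v hv
      simpa using hv
  · simpa using hp
  · simp
  · simp
  · intro q; simp

end IsCenteredChart

/-- Centring is harmless, as the chart value at a point of `S` lies in `V` and translation by it
preserves `V`. Conversely, the chart can be shrunk to where the equivalence holds. -/
theorem isSubmanifold_iff_exists_centered [CompleteSpace E] [IsManifold 𝓘(ℝ, E) ∞ M] {d : ℕ}
    {S : Set M} :
    IsSubmanifold E d S ↔ ∀ p ∈ S, ∃ χ : OpenPartialHomeomorph M E, IsCenteredChart χ p ∧
      ∃ V : Submodule ℝ E, Module.finrank ℝ V = d ∧ ∀ᶠ q in 𝓝 p, (q ∈ S ↔ χ q ∈ V) := by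
  constructor
  · intro h p hp
    obtain ⟨φ, hφ, hpφ, V, hV, hSV⟩ := h p hp
    obtain ⟨χ, hχ, hs, hχφ⟩ := IsCenteredChart.exists_of_mem_atlas hφ hpφ
    refine ⟨χ, hχ, V, hV, ?_⟩
    filter_upwards [φ.open_source.mem_nhds hpφ] with q hq
    rw [hSV q hq, hχφ, Submodule.sub_mem_iff_left _ ((hSV p hpφ).1 hp)]
  · intro h p hp
    obtain ⟨χ, hχ, V, hV, hSV⟩ := h p hp
    obtain ⟨χ', hχ', -, hO, heq, -⟩ := hχ.exists_shrink hSV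
    exact ⟨χ', hχ'.mem_atlas, hχ'.mem_source, V, hV, fun q hq => by rw [heq]; exact hO hq⟩

/-- A chart around a point of a submanifold whose image is a ball and in which the submanifold is
a linear subspace. -/
theorem IsSubmanifold.exists_ball_chart [CompleteSpace E] [IsManifold 𝓘(ℝ, E) ∞ M] {d : ℕ}
    {S : Set M} (h : IsSubmanifold E d S) {p : M} (hp : p ∈ S) {O : Set M} (hO : O ∈ 𝓝 p) :
    ∃ χ : OpenPartialHomeomorph M E, IsCenteredChart χ p ∧ χ.source ⊆ O ∧
      ∃ V : Submodule ℝ E, Module.finrank ℝ V = d ∧ (∀ q ∈ χ.source, (q ∈ S ↔ χ q ∈ V)) ∧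
      ∃ ε > 0, χ.target = Metric.ball 0 ε := by
  obtain ⟨χ, hχ, V, hV, hSV⟩ := isSubmanifold_iff_exists_centered.1 h p hp
  obtain ⟨χ', hχ', -, hO', heq, hε⟩ := hχ.exists_shrink (inter_mem hSV hO)
  exact ⟨χ', hχ', fun q hq => (hO' hq).2, V, hV, fun q hq => by rw [heq]; exact (hO' hq).1, hε⟩

section Submanifold

variable [CompleteSpace E] [IsManifold 𝓘(ℝ, E) ∞ M] {d : ℕ} {S T : Set M}

theorem IsSubmanifold.congr_nhds (h : IsSubmanifold E d S) (hT : T ⊆ S)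
    (hn : ∀ p ∈ T, T ∈ 𝓝[S] p) : IsSubmanifold E d T := by
  rw [isSubmanifold_iff_exists_centered] at h ⊢
  intro p hp
  obtain ⟨χ, hχ, V, hV, hSV⟩ := h p (hT hp)
  refine ⟨χ, hχ, V, hV, ?_⟩
  filter_upwards [hSV, mem_nhdsWithin_iff_eventually.1 (hn p hp)] with q hq hq'
  rw [← hq]
  exact ⟨fun h => hT h, hq'⟩

/-- In a chart with image a ball, the slice corresponds to the convex intersection of the ball with
`V`. -/
theorem IsSubmanifold.exists_preconnected (h : IsSubmanifold E d S) {p : M} (hp : p ∈ S)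
    {O : Set M} (hO : O ∈ 𝓝 p) : ∃ N ⊆ O, N ∈ 𝓝 p ∧ IsPreconnected (S ∩ N) := by
  obtain ⟨χ, hχ, hsO, V, hV, hSV, ε, hε, htar⟩ := h.exists_ball_chart hp hO
  refine ⟨χ.source, hsO, hχ.eventually_source, ?_⟩
  have : S ∩ χ.source = χ.symm '' (Metric.ball 0 ε ∩ V) := by
    ext q
    constructor
    · rintro ⟨hq, hqs⟩
      exact ⟨χ q, ⟨htar ▸ χ.map_source hqs, (hSV q hqs).1 hq⟩, χ.left_inv hqs⟩
    · rintro ⟨v, ⟨hv, hvV⟩, rfl⟩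
      rw [← htar] at hv
      refine ⟨(hSV _ (χ.map_target hv)).2 ?_, χ.map_target hv⟩
      rwa [χ.right_inv hv]
  rw [this]
  refine ((convex_ball (0 : E) ε).inter V.convex).isPreconnected.image _ ?_
  exact χ.continuousOn_symm.mono fun v hv => htar ▸ hv.1

/-- Connected components of relatively open subsets of a submanifold are relatively open. -/
theorem IsSubmanifold.connectedComponentIn_mem_nhdsWithin (h : IsSubmanifold E d S) {K : Set M}
    (hKS : K ⊆ S) {p y : M} (hp : p ∈ connectedComponentIn K y) (hK : K ∈ 𝓝[S] p) :
    connectedComponentIn K y ∈ 𝓝[S] p := by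
  have hpK : p ∈ K := connectedComponentIn_subset K y hp
  obtain ⟨N, hNO, hN, hconn⟩ := h.exists_preconnected (hKS hpK)
    (mem_nhdsWithin_iff_eventually.1 hK)
  rw [connectedComponentIn_eq hp]
  have : S ∩ N ⊆ connectedComponentIn K p :=
    hconn.subset_connectedComponentIn ⟨hKS hpK, mem_of_mem_nhds hN⟩ fun q hq => hNO hq.2 hq.1
  exact mem_of_superset (inter_mem self_mem_nhdsWithin (mem_nhdsWithin_of_mem_nhds hN)) this

theorem IsSubmanifold.connectedComponentIn (h : IsSubmanifold E d S) (y : M) :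
    IsSubmanifold E d (connectedComponentIn S y) :=
  h.congr_nhds (connectedComponentIn_subset S y) fun _ hp =>
    h.connectedComponentIn_mem_nhdsWithin subset_rfl hp self_mem_nhdsWithin

theorem mem_relInterior {M : Type*} [TopologicalSpace M] {S F : Set M} {p : M} :
    p ∈ relInterior S F ↔ p ∈ S ∧ F ∈ 𝓝[S] p := by
  constructor
  · rintro ⟨⟨q, hq⟩, hqi, rfl⟩
    exact ⟨hq, preimage_coe_mem_nhds_subtype.1 (mem_interior_iff_mem_nhds.1 hqi)⟩
  · rintro ⟨hp, hF⟩
    exact ⟨⟨p, hp⟩, mem_interior_iff_mem_nhds.2 (preimage_coe_mem_nhds_subtype.2 hF), rfl⟩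

end Submanifold

end Charts

/-! ### Invariance of dimension and the intrinsic interior -/

theorem exists_projection {E : Type*} [NormedAddCommGroup E] [NormedSpace ℝ E]
    [FiniteDimensional ℝ E] (V : Submodule ℝ E) :
    ∃ P : E →L[ℝ] V, ∀ v : V, P v = v := by
  obtain ⟨P, hP⟩ := V.subtype.exists_leftInverse_of_injective V.ker_subtype
  exact ⟨LinearMap.toContinuousLinearMap P, fun v => LinearMap.congr_fun hP v⟩

theorem hasDerivAt_mem_submodule {E : Type*} [NormedAddCommGroup E] [NormedSpace ℝ E]
    [FiniteDimensional ℝ E] {V : Submodule ℝ E} {γ : ℝ → E} {γ' : E} (h : HasDerivAt γ γ' 0)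
    (h0 : γ 0 = 0) (hV : ∀ᶠ s in 𝓝 0, γ s ∈ V) : γ' ∈ V := by
  have h1 := h.tendsto_slope_zero
  refine V.closed_of_finiteDimensional.mem_of_tendsto h1 ?_
  filter_upwards [mem_nhdsWithin_of_mem_nhds hV] with s hs
  rw [zero_add, h0, sub_zero]
  exact V.smul_mem _ hs

section Charts

variable {E : Type*} [NormedAddCommGroup E] [NormedSpace ℝ E] [FiniteDimensional ℝ E]
    {M : Type*} [TopologicalSpace M] [ChartedSpace E M] [IsManifold 𝓘(ℝ, E) ∞ M]

section Transition

variable {φ ψ : OpenPartialHomeomorph M E} {p : M}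

theorem eventually_contDiffAt_transition (hφ : IsCenteredChart φ p) (hψ : IsCenteredChart ψ p) :
    ∀ᶠ v in 𝓝 0, ContDiffAt ℝ ∞ (fun v => φ (ψ.symm v)) v := by
  filter_upwards [hψ.eventually_target, hψ.tendsto_symm.eventually hφ.eventually_source]
    with v hv hv'
  exact contDiffAt_transition hφ.mem_atlas hψ.mem_atlas hv hv'

theorem exists_fderiv_transition (hφ : IsCenteredChart φ p) (hψ : IsCenteredChart ψ p) :
    ∃ A : E ≃L[ℝ] E, HasFDerivAt (fun v => φ (ψ.symm v)) (A : E →L[ℝ] E) 0 := by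
  have h1 := ((eventually_contDiffAt_transition hφ hψ).self_of_nhds.differentiableAt
    (by simp)).hasFDerivAt
  have h2 := ((eventually_contDiffAt_transition hψ hφ).self_of_nhds.differentiableAt
    (by simp)).hasFDerivAt
  have e1 : φ (ψ.symm 0) = 0 := by rw [hψ.symm_zero, hφ.map_eq]
  have e2 : ψ (φ.symm 0) = 0 := by rw [hφ.symm_zero, hψ.map_eq]
  have h12 : HasFDerivAt (fun v => φ (ψ.symm (ψ (φ.symm v)))) _ 0 :=
    HasFDerivAt.comp (0 : E) (g := fun v => φ (ψ.symm v)) (f := fun v => ψ (φ.symm v))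
      (by simpa only [e2] using h1) h2
  have h21 : HasFDerivAt (fun v => ψ (φ.symm (φ (ψ.symm v)))) _ 0 :=
    HasFDerivAt.comp (0 : E) (g := fun v => ψ (φ.symm v)) (f := fun v => φ (ψ.symm v))
      (by simpa only [e1] using h2) h1
  have i12 : (fun v => φ (ψ.symm (ψ (φ.symm v)))) =ᶠ[𝓝 0] fun v => v := by
    filter_upwards [hφ.eventually_right_inv, hφ.tendsto_symm.eventually hψ.eventually_left_inv]
      with v hv hv'
    rw [hv', hv]
  have i21 : (fun v => ψ (φ.symm (φ (ψ.symm v)))) =ᶠ[𝓝 0] fun v => v := by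
    filter_upwards [hψ.eventually_right_inv, hψ.tendsto_symm.eventually hφ.eventually_left_inv]
      with v hv hv'
    rw [hv', hv]
  have u12 := (h12.congr_of_eventuallyEq i12.symm).unique (hasFDerivAt_id 0)
  have u21 := (h21.congr_of_eventuallyEq i21.symm).unique (hasFDerivAt_id 0)
  exact ⟨ContinuousLinearEquiv.equivOfInverse _ _ (fun v => by simpa using congr($u21 v))
    (fun v => by simpa using congr($u12 v)), h1⟩

/-- The derivative of a transition map preserves tangent spaces. -/
theorem fderiv_transition_mem (hφ : IsCenteredChart φ p) (hψ : IsCenteredChart ψ p)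
    {A : E →L[ℝ] E} (hA : HasFDerivAt (fun v => φ (ψ.symm v)) A 0) {S T : Set M} (hTS : T ⊆ S)
    {V V' : Submodule ℝ E} (hV : ∀ᶠ q in 𝓝 p, (q ∈ S ↔ φ q ∈ V))
    (hV' : ∀ᶠ q in 𝓝 p, (q ∈ T ↔ ψ q ∈ V')) {w : E} (hw : w ∈ V') : A w ∈ V := by
  have hs : Tendsto (fun s : ℝ => s • w) (𝓝 0) (𝓝 0) := by
    have : Continuous fun s : ℝ => s • w := by fun_prop
    simpa using this.tendsto 0
  have hsm : HasDerivAt (fun t : ℝ => t • w) w 0 := by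
    simpa using (hasDerivAt_id (0 : ℝ)).smul_const w
  refine hasDerivAt_mem_submodule (V := V) (γ := fun s => φ (ψ.symm (s • w))) ?_ ?_ ?_
  · exact HasFDerivAt.comp_hasDerivAt (0 : ℝ) (l := fun v => φ (ψ.symm v))
      (by simpa using hA) hsm
  · simp [hψ.symm_zero, hφ.map_eq]
  · filter_upwards [hs.eventually (hψ.tendsto_symm.eventually (hV.and hV')),
      hs.eventually hψ.eventually_right_inv] with s hs hs'
    refine hs.1.1 (hTS (hs.2.2 ?_))
    rw [hs']
    exact V'.smul_mem _ hw

end Transition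

variable {d : ℕ} {S T : Set M}

/-- A submanifold that is contained in a submanifold of the same dimension is open in it. -/
theorem IsSubmanifold.mem_nhdsWithin_of_subset (hS : IsSubmanifold E d S)
    (hT : IsSubmanifold E d T) (hTS : T ⊆ S) {p : M} (hp : p ∈ T) : T ∈ 𝓝[S] p := by
  obtain ⟨χ, hχ, V, hVd, hV⟩ := isSubmanifold_iff_exists_centered.1 hS p (hTS hp)
  obtain ⟨φ, hφ, V', hVd', hV'⟩ := isSubmanifold_iff_exists_centered.1 hT p hp
  obtain ⟨A, hA⟩ := exists_fderiv_transition hχ hφ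
  obtain ⟨P, hP⟩ := exists_projection V
  have hAV : ∀ w : V', A w ∈ V := fun w => fderiv_transition_mem hχ hφ hA hTS hV hV' w.2
  have hstrict : HasStrictFDerivAt (fun v => χ (φ.symm v)) (A : E →L[ℝ] E) 0 :=
    (eventually_contDiffAt_transition hχ hφ).self_of_nhds.hasStrictFDerivAt' hA (by simp)
  have hG : HasStrictFDerivAt (fun w : V' => P (χ (φ.symm w)))
      (P.comp ((A : E →L[ℝ] E).comp V'.subtypeL)) 0 := by
    have h1 : HasStrictFDerivAt (fun w : V' => (w : E)) V'.subtypeL 0 :=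
      V'.subtypeL.hasStrictFDerivAt
    exact P.hasStrictFDerivAt.comp (0 : V')
      (HasStrictFDerivAt.comp (0 : V') (g := fun v => χ (φ.symm v)) (by simpa using hstrict) h1)
  have hinj : Function.Injective (P.comp ((A : E →L[ℝ] E).comp V'.subtypeL)) := by
    intro w w' h
    have h1 : P (A w) = P (A w') := h
    have e : ∀ w : V', P (A w) = ⟨A w, hAV w⟩ := fun w => hP ⟨A w, hAV w⟩
    rw [e, e] at h1
    have := congrArg Subtype.val h1
    exact Subtype.ext (A.injective this)
  -- The inclusion of tangent spaces is injective, and equality of dimensions makes it surjective.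
  -- The map from `V'` to `V` is then open at the origin, which is the smooth substitute for
  -- invariance of domain.
  have hsurj : Function.Surjective (P.comp ((A : E →L[ℝ] E).comp V'.subtypeL)) :=
    (LinearMap.injective_iff_surjective_of_finrank_eq_finrank (hVd'.trans hVd.symm)).1 hinj
  have hmap := hG.map_nhds_eq_of_surj (LinearMap.range_eq_top.2 hsurj)
  have e0 : P (χ (φ.symm ((0 : V') : E))) = 0 := by
    simp [hφ.symm_zero, hχ.map_eq]
  rw [e0] at hmap
  have hcoe : Tendsto (fun w : V' => (w : E)) (𝓝 0) (𝓝 0) :=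
    (continuous_subtype_val (p := fun v => v ∈ V')).tendsto 0
  have hgood : ∀ᶠ w : V' in 𝓝 0, φ.symm w ∈ T ∧ φ.symm w ∈ χ.source ∧ χ (φ.symm w) ∈ V := by
    filter_upwards [hcoe.eventually (hφ.tendsto_symm.eventually
      (hχ.eventually_source.and (hV.and hV'))), hcoe.eventually hφ.eventually_right_inv] with w hw hw'
    have hT' : φ.symm w ∈ T := hw.2.2.2 (by rw [hw']; exact w.2)
    exact ⟨hT', hw.1, hw.2.1.1 (hTS hT')⟩
  have himg := image_mem_map (m := (fun w : V' => P (χ (φ.symm w)))) hgood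
  rw [hmap, nhds_subtype_eq_comap] at himg
  obtain ⟨U, hU, hUsub⟩ := himg
  rw [mem_nhdsWithin_iff_eventually]
  filter_upwards [hχ.tendsto.eventually hU, hV, hχ.eventually_source] with q hqU hqV hqs hqS
  obtain ⟨w, ⟨hwT, hws, hwV⟩, hw⟩ := hUsub (show (⟨χ q, hqV.1 hqS⟩ : V) ∈ Subtype.val ⁻¹' U from hqU)
  have h1 : P (χ (φ.symm w)) = ⟨χ (φ.symm w), hwV⟩ := hP ⟨_, hwV⟩
  simp only [h1] at hw
  have h2 : χ (φ.symm w) = χ q := congrArg Subtype.val hw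
  rwa [← χ.injOn hws hqs h2]

/-- The union of the submanifolds of dimension `m` contained in `F`. -/
def intrinsicInterior (E : Type*) [NormedAddCommGroup E] [NormedSpace ℝ E]
    {M : Type*} [TopologicalSpace M] [ChartedSpace E M] (m : ℕ) (F : Set M) : Set M :=
  {p | ∃ T ⊆ F, p ∈ T ∧ IsSubmanifold E m T}

/-- The interior of a face hence does not depend on the chosen submanifold, only on the carrier and
the dimension. -/
theorem IsSubmanifold.relInterior_eq (hS : IsSubmanifold E d S) {F : Set M} (hF : F ⊆ S) :
    relInterior S F = intrinsicInterior E d F := by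
  ext p
  rw [mem_relInterior]
  constructor
  · rintro ⟨hp, hFp⟩
    obtain ⟨U, hU, hpU, hUF⟩ := mem_nhdsWithin.1 hFp
    exact ⟨U ∩ S, hUF, ⟨hpU, hp⟩, hS.congr_nhds inter_subset_right fun q hq =>
      inter_mem (mem_nhdsWithin_of_mem_nhds (hU.mem_nhds hq.1)) self_mem_nhdsWithin⟩
  · rintro ⟨T, hTF, hpT, hT⟩
    exact ⟨hF (hTF hpT), mem_of_superset
      (hS.mem_nhdsWithin_of_subset hT (hTF.trans hF) hpT) hTF⟩

theorem relInterior_mem_nhdsWithin {F : Set M} {p : M} (hp : p ∈ relInterior S F) :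
    relInterior S F ∈ 𝓝[S] p :=
  (eventually_mem_nhdsWithin.and
    (eventually_eventually_nhdsWithin.2 (mem_relInterior.1 hp).2)).mono fun _ => mem_relInterior.2

theorem isSubmanifold_relInterior (hS : IsSubmanifold E d S) (F : Set M) :
    IsSubmanifold E d (relInterior S F) :=
  hS.congr_nhds (fun _ hp => (mem_relInterior.1 hp).1) fun _ => relInterior_mem_nhdsWithin

end Charts

/-! ### Transversality to level sets -/

section Transverse

variable {E : Type*} [NormedAddCommGroup E] [NormedSpace ℝ E]
    {M : Type*} [TopologicalSpace M] [ChartedSpace E M]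

/-- The function `r` has a nonzero derivative at `z` along some curve in `T`. -/
def IsTransverse (E : Type*) [NormedAddCommGroup E] [NormedSpace ℝ E]
    {M : Type*} [TopologicalSpace M] [ChartedSpace E M] (r : M → ℝ) (T : Set M) (z : M) : Prop :=
  ∃ γ : ℝ → M, γ 0 = z ∧ MDifferentiableAt 𝓘(ℝ, ℝ) 𝓘(ℝ, E) γ 0 ∧ (∀ᶠ s in 𝓝 0, γ s ∈ T) ∧
    deriv (fun s => r (γ s)) 0 ≠ 0

theorem IsTransverse.of_nhdsWithin {r : M → ℝ} {S T : Set M} {z : M} (h : IsTransverse E r S z)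
    (hT : T ∈ 𝓝[S] z) : IsTransverse E r T z := by
  obtain ⟨γ, h0, hd, hS, hr⟩ := h
  refine ⟨γ, h0, hd, ?_, hr⟩
  have hc : Tendsto γ (𝓝 0) (𝓝 z) := by simpa [ContinuousAt, h0] using hd.continuousAt
  exact (hc.eventually (mem_nhdsWithin_iff_eventually.1 hT)).mp (hS.mono fun s hs h => h hs)

variable [FiniteDimensional ℝ E] [IsManifold 𝓘(ℝ, E) ∞ M]

theorem IsTransverse.exists_tangent {r : M → ℝ} {T : Set M} {z : M} (h : IsTransverse E r T z)
    (hr : ContMDiffAt 𝓘(ℝ, E) 𝓘(ℝ, ℝ) ∞ r z) {χ : OpenPartialHomeomorph M E}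
    (hχ : IsCenteredChart χ z) {V : Submodule ℝ E} (hV : ∀ᶠ q in 𝓝 z, (q ∈ T ↔ χ q ∈ V)) :
    ∃ t ∈ V, fderiv ℝ (fun v => r (χ.symm v)) 0 t ≠ 0 := by
  obtain ⟨γ, h0, hd, hT, hne⟩ := h
  have hc : Tendsto γ (𝓝 0) (𝓝 z) := by simpa [ContinuousAt, h0] using hd.continuousAt
  have hχd : MDifferentiableAt 𝓘(ℝ, E) 𝓘(ℝ, E) χ z :=
    (contMDiffAt_of_mem_maximalAtlas hχ.mem_atlas hχ.mem_source).mdifferentiableAt (by simp)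
  have hcurve : DifferentiableAt ℝ (fun s => χ (γ s)) 0 := by
    rw [← mdifferentiableAt_iff_differentiableAt]
    exact MDifferentiableAt.comp (0 : ℝ) (g := χ) (by rwa [h0]) hd
  have hrd : DifferentiableAt ℝ (fun v => r (χ.symm v)) 0 :=
    (contDiffAt_comp_symm hχ.mem_atlas hχ.zero_mem_target
      (by rwa [hχ.symm_zero])).differentiableAt (by simp)
  refine ⟨deriv (fun s => χ (γ s)) 0, ?_, ?_⟩
  · refine hasDerivAt_mem_submodule hcurve.hasDerivAt (by rw [h0, hχ.map_eq]) ?_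
    filter_upwards [hT, hc.eventually hV] with s hs hs'
    exact hs'.1 hs
  · have h1 : HasDerivAt (fun s => r (χ.symm (χ (γ s))))
        (fderiv ℝ (fun v => r (χ.symm v)) 0 (deriv (fun s => χ (γ s)) 0)) 0 :=
      HasFDerivAt.comp_hasDerivAt (0 : ℝ) (l := fun v => r (χ.symm v))
        (by simpa [h0, hχ.map_eq] using hrd.hasFDerivAt) hcurve.hasDerivAt
    have h2 : (fun s => r (γ s)) =ᶠ[𝓝 0] fun s => r (χ.symm (χ (γ s))) := by
      filter_upwards [hc.eventually hχ.eventually_left_inv] with s hs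
      rw [hs]
    rwa [(h1.congr_of_eventuallyEq h2).deriv] at hne

/-- A function that is radial at `x` is transverse, near `x`, to the submanifolds through `x`. -/
theorem IsRadial.eventually_isTransverse {r : M → ℝ} {x : M} (h : IsRadial E r x)
    (hr : ∀ᶠ q in 𝓝 x, ContMDiffAt 𝓘(ℝ, E) 𝓘(ℝ, ℝ) ∞ r q) {d : ℕ} {S : Set M}
    (hS : IsSubmanifold E d S) (hx : x ∈ S) :
    ∀ᶠ z in 𝓝 x, z ∈ S → z ≠ x → IsTransverse E r S z := by
  obtain ⟨χ, hχ, -, V, -, hV, ε, hε, htar⟩ := hS.exists_ball_chart hx univ_mem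
  filter_upwards [h χ hχ.mem_atlas hχ.mem_source, hr, hχ.eventually_source] with z hz hrz hzs hzS hzx
  have hpos := hz hzx
  rw [hχ.map_eq, sub_zero] at hpos
  set v := χ z with hv
  have hvt : v ∈ χ.target := χ.map_source hzs
  have hline : ContDiff ℝ ∞ fun s : ℝ => (1 + s) • v :=
    (contDiff_const.add contDiff_id).smul contDiff_const
  have hlim : Tendsto (fun s : ℝ => (1 + s) • v) (𝓝 0) (𝓝 v) := by
    simpa using hline.continuous.tendsto 0
  have hd : HasDerivAt (fun s : ℝ => (1 + s) • v) v 0 := by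
    simpa using ((hasDerivAt_id (0 : ℝ)).const_add 1).smul_const v
  -- The curve moves along the ray from `x` through `z`, which stays in the linear subspace
  -- representing `S`; the derivative of `r` along it is the radial one.
  refine ⟨fun s => χ.symm ((1 + s) • v), ?_, ?_, ?_, ?_⟩
  · simp [hv, χ.left_inv hzs]
  · have h1 : MDifferentiableAt 𝓘(ℝ, E) 𝓘(ℝ, E) χ.symm v :=
      (contMDiffAt_symm_of_mem_maximalAtlas hχ.mem_atlas hvt).mdifferentiableAt (by simp)
    exact MDifferentiableAt.comp (0 : ℝ) (g := χ.symm) (by simpa using h1)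
      hd.differentiableAt.mdifferentiableAt
  · filter_upwards [hlim.eventually (χ.open_target.mem_nhds hvt)] with s hs
    refine (hV _ (χ.map_target hs)).2 ?_
    rw [χ.right_inv hs]
    exact V.smul_mem _ ((hV z hzs).1 hzS)
  · have hrd : DifferentiableAt ℝ (fun v => r (χ.symm v)) v :=
      (contDiffAt_comp_symm hχ.mem_atlas hvt
        (by rwa [hv, χ.left_inv hzs])).differentiableAt (by simp)
    have h1 : HasDerivAt (fun s : ℝ => r (χ.symm ((1 + s) • v)))
        (fderiv ℝ (fun v => r (χ.symm v)) v v) 0 :=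
      HasFDerivAt.comp_hasDerivAt (0 : ℝ) (l := fun v => r (χ.symm v))
        (by simpa using hrd.hasFDerivAt) hd
    rw [h1.deriv]
    exact hpos.ne'

/-- A chart can be modified in a given direction so that a given function, with a nonzero
derivative in this direction, becomes affine. -/
theorem IsCenteredChart.exists_straighten {χ : OpenPartialHomeomorph M E} {z : M}
    (hχ : IsCenteredChart χ z) {r : M → ℝ}
    (hr : ∀ᶠ q in 𝓝 z, ContMDiffAt 𝓘(ℝ, E) 𝓘(ℝ, ℝ) ∞ r q) {t : E}
    (ht : fderiv ℝ (fun v => r (χ.symm v)) 0 t ≠ 0) :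
    ∃ (ℓ : E →L[ℝ] ℝ) (χ' : OpenPartialHomeomorph M E), ℓ t ≠ 0 ∧ IsCenteredChart χ' z ∧
      (∀ q, ∃ c : ℝ, χ' q = χ q + c • t) ∧ ∀ᶠ q in 𝓝 z, r q = r z + ℓ (χ' q) := by
  set f : E → ℝ := fun v => r (χ.symm v) with hf
  set ℓ := fderiv ℝ f 0 with hℓ
  have hsm : ∀ᶠ v in 𝓝 0, ContDiffAt ℝ ∞ f v := by
    filter_upwards [hχ.eventually_target, hχ.tendsto_symm.eventually hr] with v hv hv'
    exact contDiffAt_comp_symm hχ.mem_atlas hv hv'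
  have hd : HasFDerivAt f ℓ 0 := (hsm.self_of_nhds.differentiableAt (by simp)).hasFDerivAt
  have hd' : HasFDerivAt (fun v : E => v + ((f v - f 0 - ℓ v) / ℓ t) • t)
      ((ContinuousLinearEquiv.refl ℝ E : E ≃L[ℝ] E) : E →L[ℝ] E) 0 := by
    have h1 : HasFDerivAt (fun v => f v - f 0 - ℓ v) (ℓ - ℓ) 0 :=
      (hd.sub_const _).sub ℓ.hasFDerivAt
    have h2 := (hasFDerivAt_id (𝕜 := ℝ) (0 : E)).add
      ((h1.const_mul (ℓ t)⁻¹).smul_const t)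
    refine (h2.congr_of_eventuallyEq (Eventually.of_forall fun v => ?_)).congr_fderiv
      (ContinuousLinearMap.ext fun v => ?_)
    · simp only [Pi.add_apply, id_eq]
      rw [div_eq_inv_mul]
    · simp
  -- Only the coordinate along `t` is corrected, so membership in subspaces containing `t` does not
  -- change. The correction vanishes to first order, so the derivative is the identity.
  obtain ⟨χ', hχ', hs, hχ'e⟩ := hχ.exists_comp (Θ := fun v => v + ((f v - f 0 - ℓ v) / ℓ t) • t)
    (by
      filter_upwards [hsm] with v hv
      exact contDiffAt_id.add ((((hv.sub contDiffAt_const).sub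
        ℓ.contDiff.contDiffAt).div_const _).smul contDiffAt_const))
    (by simp) hd'
  refine ⟨ℓ, χ', ht, hχ', fun q => ⟨_, hχ'e q⟩, ?_⟩
  filter_upwards [hχ.eventually_left_inv] with q hq
  rw [hχ'e, map_add, map_smul, smul_eq_mul, div_mul_cancel₀ _ ht]
  simp only [hf, hq, hχ.symm_zero]
  ring

theorem finrank_inf_ker {V : Submodule ℝ E} {ℓ : E →L[ℝ] ℝ} {t : E} (htV : t ∈ V)
    (ht : ℓ t ≠ 0) :
    Module.finrank ℝ (V ⊓ ℓ.ker : Submodule ℝ E) = Module.finrank ℝ V - 1 := by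
  have hne : (ℓ : E →ₗ[ℝ] ℝ).domRestrict V ≠ 0 := fun h =>
    ht (by simpa using LinearMap.congr_fun h ⟨t, htV⟩)
  have h1 := Module.Dual.finrank_ker_add_one_of_ne_zero (f := (ℓ : E →ₗ[ℝ] ℝ).domRestrict V) hne
  have h2 : (V ⊓ ℓ.ker : Submodule ℝ E) = (((ℓ : E →ₗ[ℝ] ℝ).domRestrict V).ker).map V.subtype := by
    rw [← Submodule.map_comap_subtype]
    rfl
  rw [h2, Submodule.finrank_map_subtype_eq]
  omega

/-- Near each of its points, the set `L` is a regular part of a level set of `r`, and it is closed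
and does not contain `x`. -/
structure IsLevel (E : Type*) [NormedAddCommGroup E] [NormedSpace ℝ E]
    {M : Type*} [TopologicalSpace M] [ChartedSpace E M] (r : M → ℝ) (x : M) (L : Set M) :
    Prop where
  isClosed : IsClosed L
  notMem : x ∉ L
  contMDiffAt : ∀ z ∈ L, ∀ᶠ q in 𝓝 z, ContMDiffAt 𝓘(ℝ, E) 𝓘(ℝ, ℝ) ∞ r q
  mem_iff : ∀ z ∈ L, ∀ᶠ q in 𝓝 z, (q ∈ L ↔ r q = r z)

variable {r : M → ℝ} {x : M} {L : Set M} {d : ℕ} {S T : Set M}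

/-- Straightening `r` along a direction `t` tangent to `S` keeps `V` and turns `L` into the kernel
of `ℓ`. As `ℓ t ≠ 0`, this kernel cuts `V` in a hyperplane. -/
theorem IsLevel.isSubmanifold_inter (hL : IsLevel E r x L) (hS : IsSubmanifold E d S)
    (htr : ∀ z ∈ L ∩ S, IsTransverse E r S z) : IsSubmanifold E (d - 1) (L ∩ S) := by
  rw [isSubmanifold_iff_exists_centered]
  rintro z ⟨hzL, hzS⟩
  obtain ⟨χ, hχ, V, hVd, hV⟩ := isSubmanifold_iff_exists_centered.1 hS z hzS
  obtain ⟨t, htV, ht⟩ := (htr z ⟨hzL, hzS⟩).exists_tangent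
    (hL.contMDiffAt z hzL).self_of_nhds hχ hV
  obtain ⟨ℓ, χ', hℓ, hχ', hadd, hrℓ⟩ := hχ.exists_straighten (hL.contMDiffAt z hzL) ht
  refine ⟨χ', hχ', V ⊓ ℓ.ker, by rw [finrank_inf_ker htV hℓ, hVd], ?_⟩
  filter_upwards [hrℓ, hV, hL.mem_iff z hzL] with q h1 h2 h3
  obtain ⟨c, hc⟩ := hadd q
  have h4 : χ' q ∈ V ↔ χ q ∈ V := by
    rw [hc]; exact V.add_mem_iff_left (V.smul_mem c htV)
  rw [mem_inter_iff, h2, h3, h1, Submodule.mem_inf, h4, add_eq_left]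
  exact and_comm

/-- A chart adapted to a submanifold and to a submanifold of it. -/
theorem exists_flag_chart {d' : ℕ} (hS : IsSubmanifold E d S) (hT : IsSubmanifold E d' T)
    (hTS : T ⊆ S) {z : M} (hz : z ∈ T) :
    ∃ (χ : OpenPartialHomeomorph M E) (V V' : Submodule ℝ E), IsCenteredChart χ z ∧ V' ≤ V ∧
      Module.finrank ℝ V = d ∧ Module.finrank ℝ V' = d' ∧
      (∀ᶠ q in 𝓝 z, (q ∈ S ↔ χ q ∈ V)) ∧ ∀ᶠ q in 𝓝 z, (q ∈ T ↔ χ q ∈ V') := by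
  obtain ⟨φ, hφ, V, hVd, hV⟩ := isSubmanifold_iff_exists_centered.1 hS z (hTS hz)
  obtain ⟨ψ, hψ, V', hVd', hV'⟩ := isSubmanifold_iff_exists_centered.1 hT z hz
  obtain ⟨A, hA⟩ := exists_fderiv_transition hφ hψ
  obtain ⟨P, hP⟩ := exists_projection V'
  set V₁ : Submodule ℝ E := V.map (A.symm : E →ₗ[ℝ] E) with hV₁
  have hmem : ∀ v, v ∈ V₁ ↔ A v ∈ V := by
    intro v
    rw [hV₁, Submodule.mem_map]
    constructor
    · rintro ⟨w, hw, rfl⟩; simpa using hw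
    · intro h; exact ⟨A v, h, by simp⟩
  have hle : V' ≤ V₁ := fun w hw =>
    (hmem w).2 (fderiv_transition_mem hφ hψ hA hTS hV hV' hw)
  have hfin : Module.finrank ℝ V₁ = d := by
    rw [← hVd]
    exact LinearEquiv.finrank_map_eq A.symm.toLinearEquiv V
  -- The map `τ` is the transition to the chart `φ`, normalized to have derivative the identity.
  -- Replacing it by `τ v - τ (pr v) + pr v` fixes `V'` pointwise and alters `τ` only by vectors of
  -- `V₁`, so it flattens `T` without spoiling `S`.
  set τ : E → E := fun v => A.symm (φ (ψ.symm v)) with hτ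
  set pr : E →L[ℝ] E := V'.subtypeL.comp P with hpr
  have hprV : ∀ v, pr v ∈ V' := fun v => (P v).2
  have hprid : ∀ v ∈ V', pr v = v := fun v hv => by
    have := congrArg Subtype.val (hP ⟨v, hv⟩)
    exact this
  have hpr0 : Tendsto pr (𝓝 0) (𝓝 0) := by simpa using pr.continuous.tendsto 0
  have hτsm : ∀ᶠ v in 𝓝 0, ContDiffAt ℝ ∞ τ v := by
    filter_upwards [eventually_contDiffAt_transition hφ hψ] with v hv
    exact A.symm.contDiff.contDiffAt.comp v hv
  have hτ0 : τ 0 = 0 := by simp [hτ, hψ.symm_zero, hφ.map_eq]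
  have hτd : HasFDerivAt τ (ContinuousLinearMap.id ℝ E) 0 :=
    ((A.symm : E →L[ℝ] E).hasFDerivAt.comp (0 : E) hA).congr_fderiv
      (ContinuousLinearMap.ext fun v => by simp)
  have hηd : HasFDerivAt (fun v => τ v - τ (pr v) + pr v)
      ((ContinuousLinearEquiv.refl ℝ E : E ≃L[ℝ] E) : E →L[ℝ] E) 0 := by
    have h1 : HasFDerivAt (fun v => τ (pr v)) ((ContinuousLinearMap.id ℝ E).comp pr) 0 :=
      HasFDerivAt.comp (0 : E) (g := τ) (by simpa using hτd) pr.hasFDerivAt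
    exact ((hτd.sub h1).add pr.hasFDerivAt).congr_fderiv (ContinuousLinearMap.ext fun v => by simp)
  obtain ⟨χ, hχ, -, hχe⟩ := hψ.exists_comp (Θ := fun v => τ v - τ (pr v) + pr v)
    (by
      filter_upwards [hτsm, hpr0.eventually hτsm] with v hv hv'
      exact (hv.sub (hv'.comp v pr.contDiff.contDiffAt)).add pr.contDiff.contDiffAt)
    (by simp [hτ0]) hηd
  have hχV' : ∀ v ∈ V', τ v - τ (pr v) + pr v = v := fun v hv => by rw [hprid v hv]; abel
  refine ⟨χ, V₁, V', hχ, hle, hfin, hVd', ?_, ?_⟩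
  · have hprT : ∀ᶠ v in 𝓝 (0 : E), τ (pr v) ∈ V₁ := by
      filter_upwards [hpr0.eventually (hψ.tendsto_symm.eventually (hV.and hV')),
        hpr0.eventually hψ.eventually_right_inv] with v hv hv'
      rw [hmem]
      simp only [hτ, ContinuousLinearEquiv.apply_symm_apply]
      exact hv.1.1 (hTS (hv.2.2 (by rw [hv']; exact hprV v)))
    filter_upwards [hV, hψ.tendsto.eventually hprT, hψ.eventually_left_inv] with q h1 h2 h3
    rw [h1, hχe, V₁.add_mem_iff_left (hle (hprV _)), V₁.sub_mem_iff_left h2, hmem]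
    simp [hτ, h3]
  · have hχψ : Tendsto (fun q => ψ.symm (χ q)) (𝓝 z) (𝓝 z) := hψ.tendsto_symm.comp hχ.tendsto
    filter_upwards [hV', hχ.eventually_source, hχψ.eventually hχ.eventually_source,
      hχ.tendsto.eventually hψ.eventually_right_inv] with q h1 h2 h3 h4
    rw [h1]
    constructor
    · intro h
      rw [hχe, hχV' _ h]; exact h
    · intro h
      have h5 : χ (ψ.symm (χ q)) = χ q := by
        rw [hχe (ψ.symm (χ q)), h4, hχV' _ h]
      have h6 := χ.injOn h3 h2 h5
      have h7 : ψ q = χ q := by rw [← h4, h6]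
      rwa [h7]

theorem relInterior_subset {S F : Set M} : relInterior S F ⊆ F := by
  rintro _ ⟨q, hq, rfl⟩
  exact (interior_subset hq : q ∈ ((↑) : S → M) ⁻¹' F)

theorem exists_isOpen_relInterior (S F : Set M) : ∃ U, IsOpen U ∧ relInterior S F = S ∩ U := by
  obtain ⟨U, hU, hUe⟩ := isOpen_induced_iff.1 (isOpen_interior (s := ((↑) : S → M) ⁻¹' F))
  refine ⟨U, hU, ?_⟩
  rw [relInterior, ← hUe, Subtype.image_preimage_coe]

/-- Near a smooth point `z` of its boundary, a closed domain `F` in a submanifold `S` is a half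
space, hence a hypersurface that is transverse to the boundary meets both the interior of `F` and
the complement of `F`. -/
theorem IsLevel.mem_closure_of_boundary (hL : IsLevel E r x L) (hS : IsSubmanifold E (d + 1) S)
    (hT : IsSubmanifold E d T) {F : Set M} (hF : IsClosed F) (hFS : F ⊆ S) {z : M} (hzT : z ∈ T)
    (hTF : T ⊆ F) (hbdry : ∀ᶠ q in 𝓝 z, (q ∈ F \ relInterior S F ↔ q ∈ T))
    (hcl : z ∈ closure (relInterior S F)) (htr : IsTransverse E r T z) (hzL : z ∈ L) :
    z ∈ closure (L ∩ relInterior S F) ∧ z ∈ closure (L ∩ (S \ F)) := by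
  obtain ⟨χ₀, V, V', hχ₀, hle, hVd, hVd', hV₀, hV'₀⟩ :=
    exists_flag_chart hS hT (hTF.trans hFS) hzT
  obtain ⟨t, htV', ht⟩ := htr.exists_tangent (hL.contMDiffAt z hzL).self_of_nhds hχ₀ hV'₀
  obtain ⟨ℓ, χ₁, hℓ, hχ₁, hadd, hrℓ⟩ := hχ₀.exists_straighten (hL.contMDiffAt z hzL) ht
  have hiff : ∀ W : Submodule ℝ E, t ∈ W → ∀ q, (χ₁ q ∈ W ↔ χ₀ q ∈ W) := by
    intro W hW q
    obtain ⟨c, hc⟩ := hadd q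
    rw [hc]; exact W.add_mem_iff_left (W.smul_mem c hW)
  obtain ⟨χ, hχ, -, hO, hχe, ε, hε, htar⟩ := hχ₁.exists_shrink
    (hV₀.and (hV'₀.and (hrℓ.and ((hL.mem_iff z hzL).and hbdry))))
  have hSV : ∀ q ∈ χ.source, (q ∈ S ↔ χ q ∈ V) := fun q hq => by
    rw [hχe, hiff V (hle htV')]; exact (hO hq).1
  have hTV : ∀ q ∈ χ.source, (q ∈ T ↔ χ q ∈ V') := fun q hq => by
    rw [hχe, hiff V' htV']; exact (hO hq).2.1
  have hLℓ : ∀ q ∈ χ.source, (q ∈ L ↔ ℓ (χ q) = 0) := fun q hq => by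
    have h := (hO hq).2.2
    rw [h.2.1, h.1, hχe, add_eq_left]
  have hFT : ∀ q ∈ χ.source, (q ∈ F \ relInterior S F ↔ q ∈ T) := fun q hq => (hO hq).2.2.2.2
  obtain ⟨v, hvV, hvV'⟩ : ∃ v ∈ V, v ∉ V' := by
    by_contra! h
    have := Submodule.finrank_mono (show V ≤ V' from h)
    omega
  -- Subtracting a multiple of `t` makes the direction `u` tangent to the level set while it still
  -- leaves `V'`.
  set u := v - (ℓ v / ℓ t) • t with hu
  have huV : u ∈ V := V.sub_mem hvV (V.smul_mem _ (hle htV'))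
  have huV' : u ∉ V' := fun h => hvV' ((V'.sub_mem_iff_left (V'.smul_mem _ htV')).1 h)
  have huℓ : ℓ u = 0 := by simp [hu, hℓ]
  obtain ⟨g₀, hg₀u, hg₀⟩ := Submodule.exists_le_ker_of_notMem huV'
  set g : E →L[ℝ] ℝ := LinearMap.toContinuousLinearMap g₀
  have hgu : g u ≠ 0 := hg₀u
  have hVg : V' = V ⊓ g.ker := by
    refine Submodule.eq_of_le_of_finrank_eq (le_inf hle hg₀) ?_
    rw [finrank_inf_ker huV hgu]
    omega
  have hzs := hχ.mem_source
  obtain ⟨hzF, hzI⟩ := (hFT z hzs).2 hzT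
  obtain ⟨U, hU, hUe⟩ := exists_isOpen_relInterior S F
  -- For `σ = 1` and `σ = -1` these are the two open halves of the ball of `V` cut out by `V' = V ⊓
  -- g.ker`.
  set H : ℝ → Set E := fun σ => Metric.ball 0 ε ∩ (V ∩ {v | 0 < σ * g v}) with hH
  have hHpre : ∀ σ, IsPreconnected (χ.symm '' H σ) := by
    intro σ
    refine IsPreconnected.image (Convex.isPreconnected ?_) _
      (χ.continuousOn_symm.mono fun v hv => htar ▸ hv.1)
    refine (convex_ball _ _).inter (V.convex.inter ?_)
    exact convex_halfSpace_gt (f := fun v => σ * g v)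
      ⟨fun v w => by simp [mul_add], fun c v => by simp; ring⟩ 0
  have hHS : ∀ σ, χ.symm '' H σ ⊆ S := by
    rintro σ _ ⟨v, ⟨hv, hv', -⟩, rfl⟩
    rw [← htar] at hv
    refine (hSV _ (χ.map_target hv)).2 ?_
    rwa [χ.right_inv hv]
  -- A half is connected and misses `T`, hence the boundary of `F`; so it cannot meet both the
  -- interior and the complement of `F`.
  have hdich : ∀ σ, χ.symm '' H σ ⊆ relInterior S F ∨ χ.symm '' H σ ⊆ Fᶜ := by
    intro σ
    have := isPreconnected_iff_subset_of_disjoint.1 (hHpre σ) U Fᶜ hU hF.isOpen_compl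
      (by
        rintro q hq
        by_cases hqF : q ∈ F
        · left
          suffices q ∈ relInterior S F from (hUe.subset this).2
          by_contra hqI
          obtain ⟨v, ⟨hv, hv', hv''⟩, rfl⟩ := hq
          rw [← htar] at hv
          have h1 := (hTV _ (χ.map_target hv)).1 ((hFT _ (χ.map_target hv)).1 ⟨hqF, hqI⟩)
          rw [χ.right_inv hv, hVg] at h1
          have h2 : g v = 0 := h1.2
          simp [h2] at hv''
        · exact Or.inr hqF)
      (by
        rw [eq_empty_iff_forall_notMem]
        rintro q ⟨hq, hqU, hqF⟩
        exact hqF (relInterior_subset (hUe.superset ⟨hHS σ hq, hqU⟩)))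
    refine this.imp (fun h q hq => ?_) id
    rw [hUe]; exact ⟨hHS σ hq, h hq⟩
  have hcover : ∀ q ∈ χ.source, q ∈ S → q ∈ χ.symm '' H 1 ∨ q ∈ χ.symm '' H (-1) ∨ q ∈ T := by
    intro q hq hqS
    have hqb : χ q ∈ Metric.ball 0 ε := htar ▸ χ.map_source hq
    have hqV := (hSV q hq).1 hqS
    rcases lt_trichotomy (g (χ q)) 0 with h | h | h
    · exact Or.inr (Or.inl ⟨χ q, ⟨hqb, hqV, by simpa using h⟩, χ.left_inv hq⟩)
    · refine Or.inr (Or.inr ((hTV q hq).2 ?_))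
      rw [hVg]; exact ⟨hqV, h⟩
    · exact Or.inl ⟨χ q, ⟨hqb, hqV, by simpa using h⟩, χ.left_inv hq⟩
  have hnotint : ¬ (χ.symm '' H 1 ⊆ relInterior S F ∧ χ.symm '' H (-1) ⊆ relInterior S F) := by
    rintro ⟨h1, h2⟩
    refine hzI (mem_relInterior.2 ⟨hFS hzF, mem_nhdsWithin_iff_eventually.2 ?_⟩)
    filter_upwards [hχ.eventually_source] with q hq hqS
    rcases hcover q hq hqS with h | h | h
    · exact relInterior_subset (h1 h)
    · exact relInterior_subset (h2 h)
    · exact hTF h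
  have hnotext : ¬ (χ.symm '' H 1 ⊆ Fᶜ ∧ χ.symm '' H (-1) ⊆ Fᶜ) := by
    rintro ⟨h1, h2⟩
    obtain ⟨q, hq, hqI⟩ := mem_closure_iff.1 hcl _ χ.open_source hzs
    have hqF := relInterior_subset hqI
    rcases hcover q hq (hFS hqF) with h | h | h
    · exact h1 h hqF
    · exact h2 h hqF
    · exact ((hFT q hq).2 h).2 hqI
  have hlim : ∀ σ : ℝ, σ ≠ 0 → ∀ G, χ.symm '' H σ ⊆ G → z ∈ closure (L ∩ (S ∩ G)) := by
    intro σ hσ G hG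
    -- The factor `σ * g u` gives the point on the line through `u` the sign required by `H σ`,
    -- whatever the sign of `g u`.
    have hlim0 : Tendsto (fun c : ℝ => (c * (σ * g u)) • u) (𝓝[>] 0) (𝓝 0) := by
      have : Continuous fun c : ℝ => (c * (σ * g u)) • u := by fun_prop
      refine Tendsto.mono_left ?_ nhdsWithin_le_nhds
      simpa using this.tendsto 0
    refine mem_closure_of_tendsto (hχ.tendsto_symm.comp hlim0) ?_
    filter_upwards [hlim0.eventually hχ.eventually_target, self_mem_nhdsWithin] with c hc hc0
    have hmem : χ.symm ((c * (σ * g u)) • u) ∈ χ.symm '' H σ := by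
      refine ⟨_, ⟨htar ▸ hc, V.smul_mem _ huV, ?_⟩, rfl⟩
      have : σ * g ((c * (σ * g u)) • u) = c * (σ * g u) ^ 2 := by simp; ring
      rw [mem_ofPred_eq, this]
      have := mul_ne_zero hσ hgu
      have hc0' : 0 < c := hc0
      positivity
    refine ⟨(hLℓ _ (χ.map_target hc)).2 ?_, hHS σ hmem, hG hmem⟩
    rw [χ.right_inv hc, map_smul, huℓ, smul_zero]
  have hin : ∀ σ : ℝ, σ ≠ 0 → χ.symm '' H σ ⊆ relInterior S F → z ∈ closure (L ∩ relInterior S F) :=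
    fun σ hσ h => closure_mono (inter_subset_inter_right _ inter_subset_right) (hlim σ hσ _ h)
  have hout : ∀ σ : ℝ, σ ≠ 0 → χ.symm '' H σ ⊆ Fᶜ → z ∈ closure (L ∩ (S \ F)) :=
    fun σ hσ h => hlim σ hσ _ h
  have h1 : (1 : ℝ) ≠ 0 := one_ne_zero
  have h2 : (-1 : ℝ) ≠ 0 := neg_ne_zero.2 h1
  rcases hdich 1 with h | h <;> rcases hdich (-1) with h' | h'
  · exact absurd ⟨h, h'⟩ hnotint
  · exact ⟨hin 1 h1 h, hout (-1) h2 h'⟩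
  · exact ⟨hin (-1) h2 h', hout 1 h1 h⟩
  · exact absurd ⟨h, h'⟩ hnotext

end Transverse

/-! ### Faces of polyhedra -/

section Polyhedra

variable {E : Type*} [NormedAddCommGroup E] [NormedSpace ℝ E] [FiniteDimensional ℝ E]
    {M : Type*} [TopologicalSpace M] [ChartedSpace E M] [IsManifold 𝓘(ℝ, E) ∞ M]

theorem isSubmanifold_singleton (p : M) : IsSubmanifold E 0 ({p} : Set M) := by
  rw [isSubmanifold_iff_exists_centered]
  rintro q rfl
  obtain ⟨χ, hχ, -, -⟩ := IsCenteredChart.exists_of_mem_atlas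
    (IsManifold.chart_mem_maximalAtlas (I := 𝓘(ℝ, E)) (n := ∞) q) (mem_chart_source E q)
  refine ⟨χ, hχ, ⊥, finrank_bot ℝ E, ?_⟩
  filter_upwards [hχ.eventually_source] with y hy
  rw [mem_singleton_iff, Submodule.mem_bot, ← hχ.map_eq]
  exact ⟨fun h => by rw [h], fun h => χ.injOn hy hχ.mem_source h⟩

/-- The properties of a single face of dimension `m`. -/
structure IsSmoothFace (E : Type*) [NormedAddCommGroup E] [NormedSpace ℝ E]
    {M : Type*} [TopologicalSpace M] [ChartedSpace E M] (m : ℕ) (f : Face M) : Prop where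
  isConnected : IsConnected f.carrier
  isCompact : IsCompact f.carrier
  exists_submanifold : ∃ S, IsSubmanifold E m S ∧ f.carrier ⊆ S ∧
    f.interior = relInterior S f.carrier
  eq_closure : f.carrier = closure f.interior

theorem IsSmoothFace.interior_eq {m : ℕ} {f : Face M} (h : IsSmoothFace E m f) :
    f.interior = intrinsicInterior E m f.carrier := by
  obtain ⟨S, hS, hfS, hf⟩ := h.exists_submanifold
  rw [hf, hS.relInterior_eq hfS]

theorem IsSmoothFace.interior_subset {m : ℕ} {f : Face M} (h : IsSmoothFace E m f) :
    f.interior ⊆ f.carrier := h.eq_closure ▸ subset_closure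

theorem IsSmoothFace.eq_of_carrier_eq {m : ℕ} {f f' : Face M} (h : IsSmoothFace E m f)
    (h' : IsSmoothFace E m f') (heq : f.carrier = f'.carrier) : f = f' := by
  ext1
  · exact heq
  · rw [h.interior_eq, h'.interior_eq, heq]

variable {A : Set M} {d : ℕ} {P : FacedSet M}

theorem isSmoothFace_singleton [T1Space M] (p : M) :
    IsSmoothFace E 0 (⟨{p}, {p}⟩ : Face M) where
  isConnected := isConnected_singleton
  isCompact := isCompact_singleton
  exists_submanifold := by
    refine ⟨{p}, isSubmanifold_singleton p, subset_rfl, ?_⟩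
    ext q
    rw [mem_relInterior]
    exact ⟨fun h => ⟨h, self_mem_nhdsWithin⟩, fun h => h.1⟩
  eq_closure := by simp

namespace IsCompactSmoothPolyhedron

theorem face_spec [T1Space M] (hP : IsCompactSmoothPolyhedron E A d P) :
    ∀ {k : ℕ} {f : Face M}, f ∈ P.faces k →
      k ≤ d ∧ IsSmoothFace E (d - k) f ∧ f.carrier ⊆ P.carrier := by
  induction hP with
  | zero P finite subset faces_zero faces_succ =>
    intro k f hf
    cases k with
    | zero =>
      rw [faces_zero] at hf
      obtain ⟨p, hp, rfl⟩ := hf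
      exact ⟨le_rfl, isSmoothFace_singleton p, by simpa using hp⟩
    | succ k => simp [faces_succ] at hf
  | succ d P m F S r s carrier_eq disjoint connected compact submanifold submanifold_connected
      submanifold_subset subset_submanifold interior_eq interior_nonempty closure_interior
      boundary_eq side_connected side_polyhedron sides_inter sides_inter_faces faces_zero
      faces_succ ih =>
    intro k f hf
    cases k with
    | zero =>
      rw [faces_zero] at hf
      obtain ⟨i, rfl⟩ := hf
      refine ⟨zero_le, ⟨connected i, compact i, ⟨S i, submanifold i, subset_submanifold i,
        interior_eq i⟩, closure_interior i⟩, ?_⟩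
      rw [carrier_eq]; exact subset_iUnion (fun i => (F i).carrier) i
    | succ k =>
      simp only [faces_succ, mem_iUnion] at hf
      obtain ⟨i, j, hf⟩ := hf
      obtain ⟨h1, h2, h3⟩ := ih i j hf
      refine ⟨Nat.succ_le_succ h1, by rwa [Nat.succ_sub_succ], h3.trans ?_⟩
      have : (s i j).carrier ⊆ (F i).boundary := by
        rw [boundary_eq]; exact subset_iUnion (fun j => (s i j).carrier) j
      rw [carrier_eq]
      exact this.trans (sdiff_subset.trans (subset_iUnion (fun i => (F i).carrier) i))

theorem finite_faces (hP : IsCompactSmoothPolyhedron E A d P) :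
    {f | ∃ k, f ∈ P.faces k}.Finite := by
  induction hP with
  | zero P finite subset faces_zero faces_succ =>
    refine (finite.image fun p => (⟨{p}, {p}⟩ : Face M)).subset ?_
    rintro f ⟨k, hf⟩
    cases k with
    | zero =>
      rw [faces_zero] at hf
      obtain ⟨p, hp, rfl⟩ := hf
      exact ⟨p, hp, rfl⟩
    | succ k => simp [faces_succ] at hf
  | succ d P m F S r s carrier_eq disjoint connected compact submanifold submanifold_connected
      submanifold_subset subset_submanifold interior_eq interior_nonempty closure_interior
      boundary_eq side_connected side_polyhedron sides_inter sides_inter_faces faces_zero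
      faces_succ ih =>
    refine ((finite_range F).union (finite_iUnion fun i => finite_iUnion (ih i))).subset ?_
    rintro f ⟨k, hf⟩
    cases k with
    | zero => left; rwa [faces_zero] at hf
    | succ k =>
      right
      simp only [faces_succ, mem_iUnion] at hf
      obtain ⟨i, j, hf⟩ := hf
      exact mem_iUnion₂.2 ⟨i, j, k, hf⟩

theorem carrier_eq_iUnion (hP : IsCompactSmoothPolyhedron E A d P) :
    P.carrier = ⋃ f ∈ P.faces 0, f.carrier := by
  cases hP with
  | zero P finite subset faces_zero faces_succ =>
    ext p
    simp only [faces_zero, mem_iUnion]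
    constructor
    · exact fun hp => ⟨_, ⟨p, hp, rfl⟩, rfl⟩
    · rintro ⟨_, ⟨q, hq, rfl⟩, rfl⟩
      exact hq
  | succ d P m F S r s carrier_eq disjoint connected compact submanifold submanifold_connected
      submanifold_subset subset_submanifold interior_eq interior_nonempty closure_interior
      boundary_eq side_connected side_polyhedron sides_inter sides_inter_faces faces_zero
      faces_succ =>
    rw [carrier_eq, faces_zero, biUnion_range]

theorem face_subset_of_mem (hP : IsCompactSmoothPolyhedron E A d P) {k : ℕ} {f c : Face M}
    (hf : f ∈ P.faces k) (hc : c ∈ P.faces 0) {y : M} (hyf : y ∈ f.carrier) (hyc : y ∈ c.carrier)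
    [T1Space M] : f.carrier ⊆ c.carrier := by
  cases hP with
  | zero P finite subset faces_zero faces_succ =>
    cases k with
    | zero =>
      rw [faces_zero] at hf
      obtain ⟨p, hp, rfl⟩ := hf
      obtain rfl : y = p := hyf
      simpa using hyc
    | succ k => simp [faces_succ] at hf
  | succ d P m F S r s carrier_eq disjoint connected compact submanifold submanifold_connected
      submanifold_subset subset_submanifold interior_eq interior_nonempty closure_interior
      boundary_eq side_connected side_polyhedron sides_inter sides_inter_faces faces_zero
      faces_succ =>
    rw [faces_zero] at hc
    obtain ⟨i, rfl⟩ := hc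
    have key : ∀ i', y ∈ (F i').carrier → i' = i := fun i' h => by
      by_contra hne
      exact (disjoint i' i hne).ne_of_mem h hyc rfl
    cases k with
    | zero =>
      rw [faces_zero] at hf
      obtain ⟨i', rfl⟩ := hf
      rw [key i' hyf]
    | succ k =>
      simp only [faces_succ, mem_iUnion] at hf
      obtain ⟨i', j, hf⟩ := hf
      have h1 := ((side_polyhedron i' j).face_spec hf).2.2
      have h2 : (s i' j).carrier ⊆ (F i').boundary := by
        rw [boundary_eq]; exact subset_iUnion (fun j => (s i' j).carrier) j
      have h3 := h1.trans (h2.trans sdiff_subset)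
      rwa [← key i' (h3 hyf)]

variable [T2Space M]

theorem eq_of_mem (hP : IsCompactSmoothPolyhedron E A d P) {f c : Face M}
    (hf : f ∈ P.faces 0) (hc : c ∈ P.faces 0) {y : M} (hyf : y ∈ f.carrier)
    (hyc : y ∈ c.carrier) : f = c :=
  (hP.face_spec hf).2.1.eq_of_carrier_eq (hP.face_spec hc).2.1
    ((hP.face_subset_of_mem hf hc hyf hyc).antisymm (hP.face_subset_of_mem hc hf hyc hyf))

theorem isCompact (hP : IsCompactSmoothPolyhedron E A d P) : IsCompact P.carrier := by
  rw [hP.carrier_eq_iUnion]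
  exact (hP.finite_faces.subset fun f hf => ⟨0, hf⟩).isCompact_biUnion
    fun f hf => (hP.face_spec hf).2.1.isCompact

/-- Codimension `0` faces are finitely many, closed and disjoint, so connectedness leaves only one.
Applied to a side, it provides the single interior used in the transversality argument. -/
theorem exists_faces_zero_eq (hP : IsCompactSmoothPolyhedron E A d P)
    (hconn : IsConnected P.carrier) : ∃ g, P.faces 0 = {g} ∧ g.carrier = P.carrier := by
  obtain ⟨y, hy⟩ := hconn.nonempty
  have hy' := hy
  rw [hP.carrier_eq_iUnion] at hy'
  obtain ⟨g, hg, hyg⟩ := mem_iUnion₂.1 hy'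
  have hclosed : ∀ T : Set (Face M), T ⊆ P.faces 0 → IsClosed (⋃ f ∈ T, f.carrier) := fun T hT =>
    ((hP.finite_faces.subset fun f hf => ⟨0, hf⟩).subset hT).isClosed_biUnion
      fun f hf => (hP.face_spec (hT hf)).2.1.isCompact.isClosed
  have hsub : P.carrier ⊆ g.carrier := by
    have h := isPreconnected_iff_subset_of_disjoint_closed.1 hconn.isPreconnected g.carrier
      (⋃ f ∈ P.faces 0 \ {g}, f.carrier) (hP.face_spec hg).2.1.isCompact.isClosed
      (hclosed _ sdiff_subset)
      (by
        rw [hP.carrier_eq_iUnion]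
        refine iUnion₂_subset fun f hf => ?_
        by_cases hfg : f = g
        · rw [hfg]; exact subset_union_left
        · exact (subset_biUnion_of_mem (u := fun f : Face M => f.carrier)
            (show f ∈ P.faces 0 \ {g} from ⟨hf, hfg⟩)).trans subset_union_right)
      (by
        rw [eq_empty_iff_forall_notMem]
        rintro z ⟨-, hzg, hz⟩
        obtain ⟨f, hf, hzf⟩ := mem_iUnion₂.1 hz
        exact hf.2 (hP.eq_of_mem hf.1 hg hzf hzg))
    refine h.resolve_right fun h => ?_
    obtain ⟨f, hf, hyf⟩ := mem_iUnion₂.1 (h hy)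
    exact hf.2 (hP.eq_of_mem hf.1 hg hyf hyg)
  refine ⟨g, ?_, (hP.face_spec hg).2.2.antisymm hsub⟩
  ext f
  refine ⟨fun hf => ?_, fun hf => hf ▸ hg⟩
  obtain ⟨z, hz⟩ := (hP.face_spec hf).2.1.isConnected.nonempty
  exact hP.eq_of_mem hf hg hz (hsub ((hP.face_spec hf).2.2 hz))

end IsCompactSmoothPolyhedron

/-- The part of a set with faces that consists of the faces contained in `C`. -/
def FacedSet.restrict {M : Type*} (P : FacedSet M) (C : Set M) : FacedSet M :=
  ⟨C, fun k => {f ∈ P.faces k | f.carrier ⊆ C}⟩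

/-- A slice of a connected side may be disconnected, whereas sides must be connected; the slice is
split into its codimension `0` faces. -/
theorem IsCompactSmoothPolyhedron.restrict [T2Space M] (hP : IsCompactSmoothPolyhedron E A d P)
    {c : Face M} (hc : c ∈ P.faces 0) :
    IsCompactSmoothPolyhedron E A d (P.restrict c.carrier) := by
  have hcP := (hP.face_spec hc).2.2
  have heq : ∀ {f}, f ∈ P.faces 0 → ∀ y ∈ f.carrier, y ∈ c.carrier → f = c :=
    fun hf y hy hyc => hP.eq_of_mem hf hc hy hyc
  have hspec := fun {k f} (hf : f ∈ P.faces k) => hP.face_spec hf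
  cases hP with
  | zero P finite subset faces_zero faces_succ =>
    refine .zero _ (finite.subset hcP) (hcP.trans subset) ?_ fun k => ?_
    · ext f
      simp only [FacedSet.restrict, faces_zero, mem_ofPred_eq]
      constructor
      · rintro ⟨⟨p, hp, rfl⟩, hpc⟩
        exact ⟨p, by simpa using hpc, rfl⟩
      · rintro ⟨p, hp, rfl⟩
        exact ⟨⟨p, hcP hp, rfl⟩, by simpa using hp⟩
    · simp [FacedSet.restrict, faces_succ]
  | succ d P m F S r s carrier_eq disjoint connected compact submanifold submanifold_connected
      submanifold_subset subset_submanifold interior_eq interior_nonempty closure_interior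
      boundary_eq side_connected side_polyhedron sides_inter sides_inter_faces faces_zero
      faces_succ =>
    have hc' := hc
    rw [faces_zero] at hc'
    obtain ⟨i, rfl⟩ := hc'
    refine .succ d _ 1 (fun _ => F i) (fun _ => S i) (fun _ => r i) (fun _ => s i)
      (iUnion_const _).symm (fun a b hab => absurd (Subsingleton.elim a b) hab)
      (fun _ => connected i) (fun _ => compact i) (fun _ => submanifold i)
      (fun _ => submanifold_connected i) (fun _ => submanifold_subset i)
      (fun _ => subset_submanifold i) (fun _ => interior_eq i) (fun _ => interior_nonempty i)
      (fun _ => closure_interior i) (fun _ => boundary_eq i) (fun _ => side_connected i)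
      (fun _ => side_polyhedron i) (fun _ => sides_inter i) (fun _ => sides_inter_faces i) ?_ ?_
    · rw [range_const]
      ext f
      constructor
      · rintro ⟨hf, hfc⟩
        obtain ⟨z, hz⟩ := (hspec hf).2.1.isConnected.nonempty
        exact heq hf z hz (hfc hz)
      · rintro rfl
        exact ⟨hc, subset_rfl⟩
    · intro k
      ext f
      simp only [mem_iUnion, exists_const]
      have hside : ∀ i' j, (s i' j).carrier ⊆ (F i').carrier := fun i' j => by
        have : (s i' j).carrier ⊆ (F i').boundary := by
          rw [boundary_eq]; exact subset_iUnion (fun j => (s i' j).carrier) j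
        exact this.trans sdiff_subset
      constructor
      · rintro ⟨hf, hfc⟩
        obtain ⟨z, hz⟩ := (hspec hf).2.1.isConnected.nonempty
        simp only [faces_succ, mem_iUnion] at hf
        obtain ⟨i', j, hf⟩ := hf
        have hzF := hside i' j (((side_polyhedron i' j).face_spec hf).2.2 hz)
        obtain rfl : i' = i := by
          by_contra hne
          exact (disjoint i' i hne).ne_of_mem hzF (hfc hz) rfl
        exact ⟨j, hf⟩
      · rintro ⟨j, hf⟩
        refine ⟨?_, ((side_polyhedron i j).face_spec hf).2.2.trans (hside i j)⟩
        simp only [faces_succ, mem_iUnion]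
        exact ⟨i, j, hf⟩

/-- The inductive step in the definition of a polyhedron, with arbitrary finite index types. -/
theorem IsCompactSmoothPolyhedron.succ_of_finite {ι : Type*} [Finite ι] {κ : ι → Type*}
    [∀ i, Finite (κ i)] (F : ι → Face M) (S : ι → Set M) (s : (i : ι) → κ i → FacedSet M)
    (carrier_eq : P.carrier = ⋃ i, (F i).carrier)
    (disjoint : ∀ i i', i ≠ i' → Disjoint (F i).carrier (F i').carrier)
    (connected : ∀ i, IsConnected (F i).carrier)
    (compact : ∀ i, IsCompact (F i).carrier)
    (submanifold : ∀ i, IsSubmanifold E (d + 1) (S i))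
    (submanifold_connected : ∀ i, IsConnected (S i))
    (submanifold_subset : ∀ i, S i ⊆ A)
    (subset_submanifold : ∀ i, (F i).carrier ⊆ S i)
    (interior_eq : ∀ i, (F i).interior = relInterior (S i) (F i).carrier)
    (interior_nonempty : ∀ i, (F i).interior.Nonempty)
    (closure_interior : ∀ i, (F i).carrier = closure (F i).interior)
    (boundary_eq : ∀ i, (F i).boundary = ⋃ j, (s i j).carrier)
    (side_connected : ∀ i j, IsConnected (s i j).carrier)
    (side_polyhedron : ∀ i j, IsCompactSmoothPolyhedron E A d (s i j))
    (sides_inter : ∀ i j j', j ≠ j' →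
      (s i j).carrier ∩ (s i j').carrier = (s i j).boundary ∩ (s i j').boundary)
    (sides_inter_faces : ∀ i j j', j ≠ j' → ∃ U : Set (Face M),
      (∀ f ∈ U, ∃ k, f ∈ (s i j).faces k ∧ f ∈ (s i j').faces k) ∧
      (s i j).carrier ∩ (s i j').carrier = ⋃ f ∈ U, f.carrier)
    (faces_zero : P.faces 0 = range F)
    (faces_succ : ∀ k, P.faces (k + 1) = ⋃ i, ⋃ j, (s i j).faces k) :
    IsCompactSmoothPolyhedron E A (d + 1) P := by
  set e := (Finite.equivFin ι).symm
  set e' := fun i => (Finite.equivFin (κ (e i))).symm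
  refine .succ d P _ (fun i => F (e i)) (fun i => S (e i)) _ (fun i j => s (e i) (e' i j))
    ?_ (fun i i' h => disjoint _ _ (e.injective.ne h)) (fun i => connected _)
    (fun i => compact _) (fun i => submanifold _) (fun i => submanifold_connected _)
    (fun i => submanifold_subset _) (fun i => subset_submanifold _) (fun i => interior_eq _)
    (fun i => interior_nonempty _) (fun i => closure_interior _) (fun i => ?_)
    (fun i j => side_connected _ _) (fun i j => side_polyhedron _ _)
    (fun i j j' h => sides_inter _ _ _ ((e' i).injective.ne h))
    (fun i j j' h => sides_inter_faces _ _ _ ((e' i).injective.ne h)) ?_ (fun k => ?_)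
  · rw [carrier_eq]
    exact (e.surjective.iUnion_comp fun i => (F i).carrier).symm
  · rw [boundary_eq]
    exact ((e' i).surjective.iUnion_comp fun j => (s (e i) j).carrier).symm
  · rw [faces_zero]
    exact (e.surjective.range_comp F).symm
  · rw [faces_succ, ← e.surjective.iUnion_comp fun i => ⋃ j, (s i j).faces k]
    exact iUnion_congr fun i => ((e' i).surjective.iUnion_comp fun j => (s (e i) j).faces k).symm

end Polyhedra

/-! ### Components of a compact domain in a submanifold -/

section Components

variable {E : Type*} [NormedAddCommGroup E] [NormedSpace ℝ E] [FiniteDimensional ℝ E]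
    {M : Type*} [TopologicalSpace M] [ChartedSpace E M] [IsManifold 𝓘(ℝ, E) ∞ M] [T2Space M]

/-- The set of connected components of `K`. -/
def components {M : Type*} [TopologicalSpace M] (K : Set M) : Set (Set M) :=
  connectedComponentIn K '' K

theorem eq_of_mem_components {K C C' : Set M} (hC : C ∈ components K) (hC' : C' ∈ components K)
    {y : M} (hy : y ∈ C) (hy' : y ∈ C') : C = C' := by
  obtain ⟨p, -, rfl⟩ := hC
  obtain ⟨p', -, rfl⟩ := hC'
  rw [connectedComponentIn_eq hy, connectedComponentIn_eq hy']

theorem subset_of_mem_components {K C : Set M} (hC : C ∈ components K) : C ⊆ K := by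
  obtain ⟨p, -, rfl⟩ := hC
  exact connectedComponentIn_subset K p

theorem eq_connectedComponentIn_of_mem_components {K C : Set M} (hC : C ∈ components K) {y : M}
    (hy : y ∈ C) : C = connectedComponentIn K y := by
  obtain ⟨p, -, rfl⟩ := hC
  exact connectedComponentIn_eq hy

theorem isConnected_of_mem_components {K C : Set M} (hC : C ∈ components K) : IsConnected C := by
  obtain ⟨p, hp, rfl⟩ := hC
  exact isConnected_connectedComponentIn_iff.2 hp

theorem subset_of_mem_components_of_isPreconnected {K C B : Set M} (hC : C ∈ components K)
    (hB : IsPreconnected B) (hBK : B ⊆ K) {y : M} (hyC : y ∈ C) (hyB : y ∈ B) : B ⊆ C := by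
  obtain ⟨p, hp, rfl⟩ := hC
  rw [connectedComponentIn_eq hyC]
  exact hB.subset_connectedComponentIn hyB hBK

theorem sUnion_components (K : Set M) : ⋃₀ components K = K := by
  apply subset_antisymm
  · exact sUnion_subset fun C hC => subset_of_mem_components hC
  · exact fun y hy => ⟨_, ⟨y, hy, rfl⟩, mem_connectedComponentIn hy⟩

theorem isCompact_of_mem_components {K C : Set M} (hK : IsCompact K) (hC : C ∈ components K) :
    IsCompact C := by
  refine hK.of_isClosed_subset ?_ (subset_of_mem_components hC)
  refine isClosed_of_closure_subset fun y hy => ?_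
  have hsub : closure C ⊆ K := hK.isClosed.closure_subset_iff.2 (subset_of_mem_components hC)
  obtain ⟨z, hz⟩ := (isConnected_of_mem_components hC).nonempty
  exact subset_of_mem_components_of_isPreconnected hC
    (isConnected_of_mem_components hC).isPreconnected.closure hsub hz (subset_closure hz) hy

variable {m : ℕ} {W K I : Set M}

/-- A compact domain in a submanifold has finitely many components if only finitely many of them
meet its boundary. -/
theorem finite_components (hW : IsSubmanifold E m W) (hK : IsCompact K) (hKW : K ⊆ W)
    (hI : ∀ p ∈ I, K ∈ 𝓝[W] p) (hfin : (connectedComponentIn K '' (K \ I)).Finite) :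
    (components K).Finite := by
  have hloc : ∀ y ∈ K, ∃ N ∈ 𝓝[K] y, ∃ T : Set (Set M), T.Finite ∧
      ∀ C ∈ components K, (C ∩ N).Nonempty → C ∈ T := by
    intro y hy
    obtain ⟨N, -, hN, hconn⟩ := hW.exists_preconnected (hKW hy) univ_mem
    refine ⟨N, mem_nhdsWithin_of_mem_nhds hN,
      insert (connectedComponentIn K y) (connectedComponentIn K '' (K \ I)), hfin.insert _, ?_⟩
    rintro C hC ⟨z, hzC, hzN⟩
    -- A component inside `I` is open and closed in `W`, hence contains the connected slice `W ∩ N`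
    -- and is the component of `y`. All others meet `K \ I` and are in the given finite set.
    by_cases hCI : C ⊆ I
    · left
      have hopen : ∀ p ∈ C, C ∈ 𝓝[W] p := by
        intro p hp
        rw [eq_connectedComponentIn_of_mem_components hC hp]
        exact hW.connectedComponentIn_mem_nhdsWithin hKW
          (mem_connectedComponentIn (subset_of_mem_components hC hp)) (hI p (hCI hp))
      have hsub : W ∩ N ⊆ C := by
        have hclosed := (isCompact_of_mem_components hK hC).isClosed
        choose! U hU hpU hUC using fun p hp => mem_nhdsWithin.1 (hopen p hp)
        have h := isPreconnected_iff_subset_of_disjoint.1 hconn (⋃ p ∈ C, U p) Cᶜ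
          (isOpen_biUnion hU) hclosed.isOpen_compl
          (fun q _ => by
            by_cases hq : q ∈ C
            · exact Or.inl (mem_biUnion hq (hpU q hq))
            · exact Or.inr hq)
          (by
            rw [eq_empty_iff_forall_notMem]
            rintro q ⟨hqW, hqU, hqC⟩
            obtain ⟨p, hp, hqp⟩ := mem_iUnion₂.1 hqU
            exact hqC (hUC p hp ⟨hqp, hqW.1⟩))
        have hzW : z ∈ W ∩ N := ⟨hKW (subset_of_mem_components hC hzC), hzN⟩
        rcases h with h | h
        · intro q hq
          obtain ⟨p, hp, hqp⟩ := mem_iUnion₂.1 (h hq)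
          exact hUC p hp ⟨hqp, hq.1⟩
        · exact absurd hzC (h hzW)
      exact eq_connectedComponentIn_of_mem_components hC (hsub ⟨hKW hy, mem_of_mem_nhds hN⟩)
    · right
      obtain ⟨p, hp, hpI⟩ := not_subset.1 hCI
      exact ⟨p, ⟨subset_of_mem_components hC hp, hpI⟩,
        (eq_connectedComponentIn_of_mem_components hC hp).symm⟩
  refine IsCompact.induction_on (p := fun N => ∃ T : Set (Set M), T.Finite ∧
      ∀ C ∈ components K, (C ∩ N).Nonempty → C ∈ T) hK ⟨∅, finite_empty, by simp⟩ ?_ ?_ hloc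
    |>.elim fun T hT => hT.1.subset fun C hC => hT.2 C hC ?_
  · rintro N N' hNN' ⟨T, hT, h⟩
    exact ⟨T, hT, fun C hC hne => h C hC (hne.mono (inter_subset_inter_right _ hNN'))⟩
  · rintro N N' ⟨T, hT, h⟩ ⟨T', hT', h'⟩
    refine ⟨T ∪ T', hT.union hT', fun C hC hne => ?_⟩
    rw [inter_union_distrib_left, union_nonempty] at hne
    exact hne.imp (h C hC) (h' C hC)
  · rw [inter_eq_left.2 (subset_of_mem_components hC)]
    exact (isConnected_of_mem_components hC).nonempty

/-- Closure commutes with the finite union over components, so a point of `C` is a limit of `C' ∩ I`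
for one component `C'`; as `C'` is closed and components are disjoint, `C' = C`. -/
theorem eq_closure_of_mem_components (hK : IsCompact K) (hfin : (components K).Finite)
    (hIK : I ⊆ K) (hcl : ∀ y ∈ K, y ∈ closure I) {C : Set M} (hC : C ∈ components K) :
    C = closure (C ∩ I) := by
  refine subset_antisymm (fun y hy => ?_)
    ((isCompact_of_mem_components hK hC).isClosed.closure_subset_iff.2 inter_subset_left)
  have h1 : I = ⋃ C' ∈ components K, C' ∩ I := by
    rw [← iUnion₂_inter, ← sUnion_eq_biUnion, sUnion_components, inter_eq_right.2 hIK]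
  have h2 := hcl y (subset_of_mem_components hC hy)
  rw [h1, hfin.closure_biUnion] at h2
  obtain ⟨C', hC', hy'⟩ := mem_iUnion₂.1 h2
  have h3 : y ∈ C' := (isCompact_of_mem_components hK hC').isClosed.closure_subset_iff.2
    inter_subset_left hy'
  rwa [eq_of_mem_components hC hC' hy h3]

/-- Points of `K \ I` are limits of `W \ K`, so they are not interior to `C`. At points of `I` the
component is relatively open because `W` is locally connected. -/
theorem intrinsicInterior_of_mem_components (hW : IsSubmanifold E m W) (hKW : K ⊆ W)
    (hI : ∀ p ∈ I, K ∈ 𝓝[W] p) (hout : ∀ y ∈ K \ I, y ∈ closure (W \ K))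
    {C : Set M} (hC : C ∈ components K) : intrinsicInterior E m C = C ∩ I := by
  have hCK := subset_of_mem_components hC
  rw [← hW.relInterior_eq (hCK.trans hKW)]
  ext p
  rw [mem_relInterior]
  constructor
  · rintro ⟨hpW, hp⟩
    have hpC : p ∈ C := mem_of_mem_nhdsWithin hpW hp
    refine ⟨hpC, by_contra fun hpI => ?_⟩
    have h1 := hout p ⟨hCK hpC, hpI⟩
    obtain ⟨U, hU, hpU, hUC⟩ := mem_nhdsWithin.1 hp
    obtain ⟨q, hqU, hqW, hqK⟩ := mem_closure_iff.1 h1 U hU hpU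
    exact hqK (hCK (hUC ⟨hqU, hqW⟩))
  · rintro ⟨hpC, hpI⟩
    refine ⟨hKW (hCK hpC), ?_⟩
    rw [eq_connectedComponentIn_of_mem_components hC hpC]
    exact hW.connectedComponentIn_mem_nhdsWithin hKW (mem_connectedComponentIn (hCK hpC)) (hI p hpI)

variable {A : Set M}

/-- The components of a compact domain in a submanifold, whose boundary is a union of polyhedra,
form a polyhedron. -/
theorem exists_polyhedron_of_components (hW : IsSubmanifold E (m + 1) W) (hWA : W ⊆ A)
    (hK : IsCompact K) (hKW : K ⊆ W) (hIK : I ⊆ K) (hfin : (components K).Finite)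
    (hcl : ∀ y ∈ K, y ∈ closure I)
    (hint : ∀ C ∈ components K, intrinsicInterior E (m + 1) C = C ∩ I)
    {J : Type*} [Finite J] (Z : J → FacedSet M)
    (hZ : ∀ j, IsCompactSmoothPolyhedron E A m (Z j)) (hKI : K \ I = ⋃ j, (Z j).carrier)
    (hinter : ∀ j j', j ≠ j' → (Z j).carrier ∩ (Z j').carrier ⊆ (Z j).boundary)
    (hfaces : ∀ j j', j ≠ j' → ∀ y ∈ (Z j).carrier ∩ (Z j').carrier,
      ∃ k, ∃ e ∈ (Z j).faces k, e ∈ (Z j').faces k ∧ y ∈ e.carrier) :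
    ∃ Q : FacedSet M, Q.carrier = K ∧ IsCompactSmoothPolyhedron E A (m + 1) Q ∧
      Q.faces 0 = (fun C => ⟨C, C ∩ I⟩) '' components K ∧
      ∀ k, Q.faces (k + 1) = ⋃ j, (Z j).faces k := by
  have hZK : ∀ j, (Z j).carrier ⊆ K \ I := fun j =>
    hKI ▸ subset_iUnion (fun j => (Z j).carrier) j
  have hspec := fun {j k f} (hf : f ∈ (Z j).faces k) => (hZ j).face_spec hf
  let ι := components K
  -- The sides of a component are the codimension `0` faces of the polyhedra `Z j` contained in it,
  -- labelled by `j`. Distinct sides with the same label are disjoint, so intersections only concern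
  -- different labels.
  let κ : ι → Type _ := fun C =>
    {q : J × Face M // q.2 ∈ (Z q.1).faces 0 ∧ q.2.carrier ⊆ C.1}
  have : Finite ι := hfin.to_subtype
  have : ∀ C, Finite (κ C) := fun C => by
    have h1 : (⋃ j, (Prod.mk j) '' {f | ∃ k, f ∈ (Z j).faces k}).Finite :=
      finite_iUnion fun j => ((hZ j).finite_faces).image _
    refine (h1.subset ?_ : {q : J × Face M | q.2 ∈ (Z q.1).faces 0 ∧ q.2.carrier ⊆ C.1}.Finite).to_subtype
    rintro ⟨j, f⟩ ⟨hf, -⟩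
    exact mem_iUnion.2 ⟨j, f, ⟨0, hf⟩, rfl⟩
  have hCW : ∀ C ∈ components K, C ⊆ W := fun C hC => (subset_of_mem_components hC).trans hKW
  have hclC : ∀ C ∈ components K, C = closure (C ∩ I) := fun C hC =>
    eq_closure_of_mem_components hK hfin hIK hcl hC
  have hne : ∀ C ∈ components K, (C ∩ I).Nonempty := fun C hC => by
    rw [← closure_nonempty_iff, ← hclC C hC]
    exact (isConnected_of_mem_components hC).nonempty
  have hcomp : ∀ C : ι, ∃ y ∈ C.1, C.1 ⊆ connectedComponentIn W y := by
    rintro ⟨C, hC⟩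
    obtain ⟨y, hy⟩ := (isConnected_of_mem_components hC).nonempty
    exact ⟨y, hy, (isConnected_of_mem_components hC).isPreconnected.subset_connectedComponentIn hy
      (hCW C hC)⟩
  choose y hyC hCy using hcomp
  have hside : ∀ {j c} (_ : c ∈ (Z j).faces 0), IsConnected c.carrier ∧ c.carrier ⊆ K \ I :=
    fun hc => ⟨(hspec hc).2.1.isConnected, (hspec hc).2.2.trans (hZK _)⟩
  have hexists : ∀ {j k f}, f ∈ (Z j).faces k → ∃ c ∈ (Z j).faces 0, f.carrier ⊆ c.carrier := by
    intro j k f hf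
    obtain ⟨z, hz⟩ := (hspec hf).2.1.isConnected.nonempty
    have hz' := (hspec hf).2.2 hz
    rw [(hZ j).carrier_eq_iUnion] at hz'
    obtain ⟨c, hc, hzc⟩ := mem_iUnion₂.1 hz'
    exact ⟨c, hc, (hZ j).face_subset_of_mem hf hc hz hzc⟩
  have hexistsC : ∀ {j c}, c ∈ (Z j).faces 0 → ∃ C : ι, c.carrier ⊆ C.1 := by
    intro j c hc
    obtain ⟨z, hz⟩ := (hside hc).1.nonempty
    have hzK := ((hside hc).2 hz).1
    exact ⟨⟨_, z, hzK, rfl⟩, (hside hc).1.isPreconnected.subset_connectedComponentIn hz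
      ((hside hc).2.trans sdiff_subset)⟩
  have hbd : ∀ {j c}, c ∈ (Z j).faces 0 →
      ((Z j).restrict c.carrier).boundary = c.carrier ∩ (Z j).boundary := by
    intro j c hc
    ext z
    simp only [FacedSet.boundary, FacedSet.restrict, Set.mem_sdiff, mem_inter_iff, mem_iUnion,
      mem_ofPred_eq, exists_prop, not_exists, not_and]
    constructor
    · rintro ⟨hz, h⟩
      refine ⟨hz, (hspec hc).2.2 hz, fun f hf hzf => ?_⟩
      have hzf' := (hspec hf).2.1.interior_subset hzf
      exact h f ⟨hf, (hZ j).face_subset_of_mem hf hc hzf' hz⟩ hzf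
    · rintro ⟨hz, -, h⟩
      exact ⟨hz, fun f hf => h f hf.1⟩
  refine ⟨⟨K, fun k => Nat.casesOn k ((fun C => ⟨C, C ∩ I⟩) '' components K)
    fun k => ⋃ j, (Z j).faces k⟩, rfl, ?_, rfl, fun k => rfl⟩
  refine .succ_of_finite (ι := ι) (κ := κ) (fun C => ⟨C, C ∩ I⟩)
    (fun C => connectedComponentIn W (y C))
    (fun C q => (Z q.1.1).restrict q.1.2.carrier) ?_ ?_ (fun C => isConnected_of_mem_components C.2)
    (fun C => isCompact_of_mem_components hK C.2) (fun C => hW.connectedComponentIn _)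
    (fun C => isConnected_connectedComponentIn_iff.2 (hCW C C.2 (hyC C)))
    (fun C => (connectedComponentIn_subset _ _).trans hWA)
    (fun C => hCy C) (fun C => ?_) (fun C => hne C C.2) (fun C => hclC C C.2)
    (fun C => ?_) (fun C q => (hside q.2.1).1) (fun C q => (hZ _).restrict q.2.1)
    (fun C q q' hqq' => ?_) (fun C q q' hqq' => ?_) ?_ (fun k => ?_)
  · conv_lhs => rw [← sUnion_components K, sUnion_eq_iUnion]
  · intro C C' h
    rw [disjoint_left]
    intro z hz hz'
    exact h (Subtype.ext (eq_of_mem_components C.2 C'.2 hz hz'))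
  · rw [(hW.connectedComponentIn _).relInterior_eq (hCy C), hint C C.2]
  · ext z
    simp only [Face.boundary, FacedSet.restrict, Set.mem_sdiff, mem_inter_iff, not_and, mem_iUnion]
    constructor
    · rintro ⟨hzC, hzI⟩
      have hz : z ∈ K \ I := ⟨subset_of_mem_components C.2 hzC, hzI hzC⟩
      rw [hKI] at hz
      obtain ⟨j, hj⟩ := mem_iUnion.1 hz
      rw [(hZ j).carrier_eq_iUnion] at hj
      obtain ⟨c, hc, hzc⟩ := mem_iUnion₂.1 hj
      exact ⟨⟨⟨j, c⟩, hc, subset_of_mem_components_of_isPreconnected C.2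
        (hside hc).1.isPreconnected ((hside hc).2.trans sdiff_subset) hzC hzc⟩, hzc⟩
    · rintro ⟨q, hq⟩
      exact ⟨q.2.2 hq, fun _ => ((hside q.2.1).2 hq).2⟩
  · rw [hbd q.2.1, hbd q'.2.1]
    refine subset_antisymm (fun z hz => ?_) (inter_subset_inter inter_subset_left inter_subset_left)
    have hzq := (hspec q.2.1).2.2 hz.1
    have hzq' := (hspec q'.2.1).2.2 hz.2
    by_cases hj : q.1.1 = q'.1.1
    · exfalso
      obtain ⟨⟨j, c⟩, hc, hcC⟩ := q
      obtain ⟨⟨j', c'⟩, hc', hcC'⟩ := q'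
      obtain rfl : j = j' := hj
      obtain rfl : c = c' := (hZ j).eq_of_mem hc hc' hz.1 hz.2
      exact hqq' rfl
    · exact ⟨⟨hz.1, hinter _ _ hj ⟨hzq, hzq'⟩⟩, ⟨hz.2, hinter _ _ (Ne.symm hj) ⟨hzq', hzq⟩⟩⟩
  · refine ⟨{e | (∃ k, e ∈ ((Z q.1.1).restrict q.1.2.carrier).faces k ∧
      e ∈ ((Z q'.1.1).restrict q'.1.2.carrier).faces k)}, fun f hf => hf, ?_⟩
    refine subset_antisymm (fun z hz => ?_) (iUnion₂_subset ?_)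
    · have hzq := (hspec q.2.1).2.2 hz.1
      have hzq' := (hspec q'.2.1).2.2 hz.2
      have hj : q.1.1 ≠ q'.1.1 := by
        intro hj
        obtain ⟨⟨j, c⟩, hc, hcC⟩ := q
        obtain ⟨⟨j', c'⟩, hc', hcC'⟩ := q'
        obtain rfl : j = j' := hj
        obtain rfl : c = c' := (hZ j).eq_of_mem hc hc' hz.1 hz.2
        exact hqq' rfl
      obtain ⟨k, e, he, he', hze⟩ := hfaces _ _ hj z ⟨hzq, hzq'⟩
      exact mem_biUnion (show e ∈ {e | _} from ⟨k, ⟨he, (hZ _).face_subset_of_mem he q.2.1 hze hz.1⟩,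
        ⟨he', (hZ _).face_subset_of_mem he' q'.2.1 hze hz.2⟩⟩) hze
    · rintro e ⟨k, he, he'⟩
      exact subset_inter he.2 he'.2
  · exact image_eq_range _ _
  · ext f
    simp only [mem_iUnion]
    constructor
    · rintro ⟨j, hf⟩
      obtain ⟨c, hc, hfc⟩ := hexists hf
      obtain ⟨C, hC⟩ := hexistsC hc
      exact ⟨C, ⟨⟨j, c⟩, hc, hC⟩, hf, hfc⟩
    · rintro ⟨C, q, hf⟩
      exact ⟨q.1.1, hf.1⟩

end Components

/-! ### Links of polyhedra -/

section Link

variable {E : Type*} [NormedAddCommGroup E] [NormedSpace ℝ E] [FiniteDimensional ℝ E]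
    {M : Type*} [TopologicalSpace M] [ChartedSpace E M] [IsManifold 𝓘(ℝ, E) ∞ M] [T2Space M]

theorem IsSubmanifold.finite_of_isCompact {W K : Set M} (hW : IsSubmanifold E 0 W)
    (hK : IsCompact K) (hKW : K ⊆ W) : K.Finite := by
  refine hK.induction_on finite_empty (fun _ _ h h' => h'.subset h) (fun _ _ h h' => h.union h')
    fun y hy => ⟨{y}, ?_, finite_singleton y⟩
  obtain ⟨χ, hχ, V, hVd, hV⟩ := isSubmanifold_iff_exists_centered.1 hW y (hKW hy)
  rw [Submodule.finrank_eq_zero] at hVd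
  rw [mem_nhdsWithin_iff_eventually]
  filter_upwards [hV, hχ.eventually_source] with q hq hqs hqK
  have h1 := hq.1 (hKW hqK)
  rw [hVd, Submodule.mem_bot, ← hχ.map_eq] at h1
  exact χ.injOn hqs hχ.mem_source h1

/-- The part of the conclusion on the intersection of a polyhedron with a small sphere around one
of its points that is proved by induction on the dimension. -/
structure HasLink (E : Type*) [NormedAddCommGroup E] [NormedSpace ℝ E]
    {M : Type*} [TopologicalSpace M] [ChartedSpace E M] (x : M) (d : ℕ) (P : FacedSet M)
    (L : Set M) : Prop where
  interior_eq : ∀ k, ∀ f ∈ P.faces k, x ∈ f.carrier → ∀ C ∈ components (L ∩ f.carrier),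
    intrinsicInterior E (d - 1 - k) C = C ∩ f.interior
  exists_polyhedron : ∃ Q : FacedSet M, Q.carrier = L ∩ P.carrier ∧
    IsCompactSmoothPolyhedron E L (d - 1) Q ∧
    ∀ k C, (∃ c ∈ Q.faces k, c.carrier = C) ↔
      ∃ f ∈ P.faces k, x ∈ f.carrier ∧ C ∈ components (L ∩ f.carrier)

variable {r : M → ℝ} {x : M} {L : Set M} {d : ℕ}

theorem components_inter_singleton_of_notMem (hx : x ∉ L) : components (L ∩ {x}) = ∅ := by
  have : L ∩ {x} = ∅ := by
    rw [eq_empty_iff_forall_notMem]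
    rintro y ⟨hy, rfl⟩
    exact hx hy
  simp [components, this]

/-- Each codimension `0` face of the link is the closure of its interior, which lies in the interior
of `g`. -/
theorem HasLink.subset_closure {P : FacedSet M} (h : HasLink E x d P L) {g : Face M}
    (hg : P.faces 0 = {g}) : L ∩ P.carrier ⊆ closure (L ∩ g.interior) := by
  intro y hy
  obtain ⟨Q, hQ, hQp, hQf⟩ := h.exists_polyhedron
  rw [← hQ, hQp.carrier_eq_iUnion] at hy
  obtain ⟨c, hc, hyc⟩ := mem_iUnion₂.1 hy
  obtain ⟨f, hf, hxf, hC⟩ := (hQf 0 c.carrier).1 ⟨c, hc, rfl⟩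
  have hspec := (hQp.face_spec hc).2.1
  rw [hspec.eq_closure, hspec.interior_eq, h.interior_eq 0 f hf hxf _ hC] at hyc
  rw [hg] at hf
  obtain rfl : f = g := hf
  refine closure_mono ?_ hyc
  exact inter_subset_inter_left _ ((subset_of_mem_components hC).trans inter_subset_left)

/-- The intersection of a small sphere around `x` with a face containing `x`, if this is known for
the sides of the face. -/
theorem exists_link_of_face {F : Face M} {S : Set M} {J : Type*} [Finite J] {s : J → FacedSet M}
    (hS : IsSubmanifold E (d + 1) S) (hFS : F.carrier ⊆ S) (hFc : IsCompact F.carrier)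
    (hFint : F.interior = relInterior S F.carrier) (hFcl : F.carrier = closure F.interior)
    (hbd : F.boundary = ⋃ j, (s j).carrier) (hconn : ∀ j, IsConnected (s j).carrier)
    (hpoly : ∀ j, IsCompactSmoothPolyhedron E univ d (s j))
    (hinter : ∀ j j', j ≠ j' →
      (s j).carrier ∩ (s j').carrier = (s j).boundary ∩ (s j').boundary)
    (hinterf : ∀ j j', j ≠ j' → ∃ U : Set (Face M),
      (∀ f ∈ U, ∃ k, f ∈ (s j).faces k ∧ f ∈ (s j').faces k) ∧
      (s j).carrier ∩ (s j').carrier = ⋃ f ∈ U, f.carrier)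
    (hL : IsLevel E r x L) (htrS : ∀ z ∈ L ∩ S, IsTransverse E r S z)
    (hlink : ∀ j, x ∈ (s j).carrier → HasLink E x d (s j) L)
    (htr : ∀ j, x ∈ (s j).carrier → ∀ g ∈ (s j).faces 0, ∀ z ∈ L ∩ g.interior,
      IsTransverse E r g.interior z)
    (hdisj : ∀ j k, ∀ f ∈ (s j).faces k, x ∉ f.carrier → Disjoint L f.carrier) :
    (∀ C ∈ components (L ∩ F.carrier), intrinsicInterior E d C = C ∩ F.interior) ∧
    ∃ Q : FacedSet M, Q.carrier = L ∩ F.carrier ∧ IsCompactSmoothPolyhedron E L d Q ∧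
      (∀ C, (∃ c ∈ Q.faces 0, c.carrier = C) ↔ C ∈ components (L ∩ F.carrier)) ∧
      ∀ k C, (∃ c ∈ Q.faces (k + 1), c.carrier = C) ↔
        ∃ j, ∃ f ∈ (s j).faces k, x ∈ f.carrier ∧ C ∈ components (L ∩ f.carrier) := by
  have hW : IsSubmanifold E d (L ∩ S) := hL.isSubmanifold_inter hS htrS
  have hKW : L ∩ F.carrier ⊆ L ∩ S := inter_subset_inter_right _ hFS
  have hK : IsCompact (L ∩ F.carrier) := hFc.inter_left hL.isClosed
  have hIF : F.interior ⊆ F.carrier := hFcl ▸ subset_closure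
  have hIK : L ∩ F.interior ⊆ L ∩ F.carrier := inter_subset_inter_right _ hIF
  have hI : ∀ p ∈ L ∩ F.interior, L ∩ F.carrier ∈ 𝓝[L ∩ S] p := by
    rintro p ⟨hpL, hp⟩
    rw [hFint, mem_relInterior] at hp
    exact inter_mem (mem_of_superset self_mem_nhdsWithin inter_subset_left)
      (nhdsWithin_mono p inter_subset_right hp.2)
  have hKI : (L ∩ F.carrier) \ (L ∩ F.interior) = ⋃ j, L ∩ (s j).carrier := by
    rw [← inter_iUnion, ← hbd, Face.boundary, inter_sdiff_distrib_left]
  have hdisj' : ∀ j, x ∉ (s j).carrier → L ∩ (s j).carrier = ∅ := by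
    intro j hj
    rw [(hpoly j).carrier_eq_iUnion, inter_iUnion₂]
    simp only [iUnion_eq_empty]
    intro f hf
    exact (hdisj j 0 f hf fun h => hj (((hpoly j).face_spec hf).2.2 h)).inter_eq
  -- The half space argument needs an interior point of a side. The points of `L` interior to the
  -- side are dense in its slice by induction, and the two closures are closed.
  have hfront : ∀ y ∈ (L ∩ F.carrier) \ (L ∩ F.interior),
      y ∈ closure (L ∩ F.interior) ∧ y ∈ closure (L ∩ (S \ F.carrier)) := by
    intro y hy
    rw [hKI] at hy
    obtain ⟨j, hy⟩ := mem_iUnion.1 hy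
    have hxj : x ∈ (s j).carrier := by
      by_contra h
      rw [hdisj' j h] at hy
      exact hy
    obtain ⟨g, hg, hgc⟩ := (hpoly j).exists_faces_zero_eq (hconn j)
    have hgm : g ∈ (s j).faces 0 := hg ▸ mem_singleton g
    obtain ⟨-, hgs, -⟩ := (hpoly j).face_spec hgm
    obtain ⟨S', hS', hgS', hgi⟩ := hgs.exists_submanifold
    have hgF : g.carrier ⊆ F.boundary := by
      rw [hbd, hgc]; exact subset_iUnion (fun j => (s j).carrier) j
    have key : L ∩ g.interior ⊆ closure (L ∩ F.interior) ∩ closure (L ∩ (S \ F.carrier)) := by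
      rintro z ⟨hzL, hzg⟩
      have hzF := hgF (hgs.interior_subset hzg)
      rw [hFint]
      refine hL.mem_closure_of_boundary hS (T := g.interior) ?_ hFc.isClosed hFS hzg
        (hgs.interior_subset.trans (hgF.trans sdiff_subset)) ?_ ?_ (htr j hxj g hgm z ⟨hzL, hzg⟩)
        hzL
      · rw [hgi]; exact isSubmanifold_relInterior hS' _
      -- No other side passes near an interior point of `g`, since distinct sides meet only along
      -- their boundaries.
      · have h1 : ∀ᶠ q in 𝓝 z, ∀ j', j' ≠ j → q ∉ (s j').carrier := by
          rw [eventually_all]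
          intro j'
          by_cases hj' : j' = j
          · exact Eventually.of_forall fun q h => absurd hj' h
          · have hz : z ∉ (s j').carrier := by
              intro hz
              have := (hinter j j' (Ne.symm hj')).subset ⟨hgc ▸ hgs.interior_subset hzg, hz⟩
              exact this.1.2 (mem_biUnion hgm hzg)
            filter_upwards [(hpoly j').isCompact.isClosed.isOpen_compl.mem_nhds hz] with q hq _
            exact hq
        have h2 : ∀ᶠ q in 𝓝 z, q ∈ S' → q ∈ g.interior := by
          rw [hgi] at hzg ⊢
          exact mem_nhdsWithin_iff_eventually.1 (relInterior_mem_nhdsWithin hzg)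
        filter_upwards [h1, h2] with q hq hq'
        have hFb : F.carrier \ relInterior S F.carrier = F.boundary := by
          rw [← hFint]; rfl
        rw [hFb]
        constructor
        · intro h
          rw [hbd] at h
          obtain ⟨j', hj'⟩ := mem_iUnion.1 h
          obtain rfl : j' = j := by
            by_contra hne
            exact hq j' hne hj'
          exact hq' (hgS' (hgc ▸ hj'))
        · exact fun h => hgF (hgs.interior_subset h)
      · rw [← hFint, ← hFcl]; exact hzF.1
    have h3 := closure_minimal key (isClosed_closure.inter isClosed_closure)
    exact h3 ((hlink j hxj).subset_closure hg hy)
  -- Each connected face of the link of a side lies in a single component, and such faces are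
  -- finitely many.
  have hfinB : (connectedComponentIn (L ∩ F.carrier) ''
      ((L ∩ F.carrier) \ (L ∩ F.interior))).Finite := by
    rw [hKI, image_iUnion]
    refine finite_iUnion fun j => ?_
    by_cases hxj : x ∈ (s j).carrier
    · obtain ⟨Q, hQ, hQp, -⟩ := (hlink j hxj).exists_polyhedron
      refine ((hQp.finite_faces).image fun c =>
        ⋃ z ∈ c.carrier, connectedComponentIn (L ∩ F.carrier) z).subset ?_
      rintro _ ⟨y, hy, rfl⟩
      have hy' := hy
      rw [← hQ, hQp.carrier_eq_iUnion] at hy'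
      obtain ⟨c, hc, hyc⟩ := mem_iUnion₂.1 hy'
      obtain ⟨-, hcs, hcQ⟩ := hQp.face_spec hc
      have hcK : c.carrier ⊆ L ∩ F.carrier := by
        have : (s j).carrier ⊆ F.boundary := by
          rw [hbd]; exact subset_iUnion (fun j => (s j).carrier) j
        rw [hQ] at hcQ
        exact hcQ.trans (inter_subset_inter_right _ (this.trans sdiff_subset))
      have hsub := hcs.isConnected.isPreconnected.subset_connectedComponentIn hyc hcK
      refine ⟨c, ⟨0, hc⟩, subset_antisymm (iUnion₂_subset fun z hz => ?_) ?_⟩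
      · rw [connectedComponentIn_eq (hsub hz)]
      · exact subset_biUnion_of_mem
          (u := fun z => connectedComponentIn (L ∩ F.carrier) z) hyc
    · simp [hdisj' j hxj]
  have hfin := finite_components hW hK hKW hI hfinB
  have hcl : ∀ y ∈ L ∩ F.carrier, y ∈ closure (L ∩ F.interior) := by
    intro y hy
    by_cases hyI : y ∈ L ∩ F.interior
    · exact subset_closure hyI
    · exact (hfront y ⟨hy, hyI⟩).1
  have hint' : ∀ C ∈ components (L ∩ F.carrier),
      intrinsicInterior E d C = C ∩ (L ∩ F.interior) := by
    intro C hC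
    refine intrinsicInterior_of_mem_components hW hKW hI (fun y hy => ?_) hC
    refine closure_mono ?_ (hfront y hy).2
    rintro z ⟨hzL, hzS, hzF⟩
    exact ⟨⟨hzL, hzS⟩, fun h => hzF h.2⟩
  have hint : ∀ C ∈ components (L ∩ F.carrier), intrinsicInterior E d C = C ∩ F.interior := by
    intro C hC
    rw [hint' C hC, ← inter_assoc, inter_eq_left.2
      ((subset_of_mem_components hC).trans inter_subset_left)]
  refine ⟨hint, ?_⟩
  -- For `d = 0` the face `F` is one-dimensional and its slice is finite. A side through `x` is the
  -- point `x` itself and misses `L`, so there are no faces of positive codimension.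
  cases d with
  | zero =>
    have hKfin := hW.finite_of_isCompact hK hKW
    refine ⟨⟨L ∩ F.carrier, fun k => Nat.casesOn k {f | ∃ p ∈ L ∩ F.carrier, f = ⟨{p}, {p}⟩}
      fun _ => ∅⟩, rfl, .zero _ hKfin inter_subset_left rfl fun k => rfl, fun C => ?_,
      fun k C => ?_⟩
    · have hsingle : ∀ p ∈ L ∩ F.carrier, connectedComponentIn (L ∩ F.carrier) p = {p} := by
        intro p hp
        refine subset_antisymm (fun q hq => ?_)
          (singleton_subset_iff.2 (mem_connectedComponentIn hp))
        by_contra hne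
        refine (isPreconnected_connectedComponentIn.infinite_of_nontrivial
          ⟨q, hq, p, mem_connectedComponentIn hp, hne⟩) ?_
        exact hKfin.subset (connectedComponentIn_subset _ _)
      constructor
      · rintro ⟨_, ⟨p, hp, rfl⟩, rfl⟩
        exact ⟨p, hp, hsingle p hp⟩
      · rintro ⟨p, hp, rfl⟩
        exact ⟨_, ⟨p, hp, rfl⟩, (hsingle p hp).symm⟩
    · constructor
      · rintro ⟨c, hc, -⟩
        exact absurd hc (notMem_empty c)
      · rintro ⟨j, f, hf, hxf, hC⟩
        exfalso
        have hj := hpoly j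
        cases hj with
        | zero P finite subset faces_zero faces_succ =>
          cases k with
          | zero =>
            rw [faces_zero] at hf
            obtain ⟨p, hp, rfl⟩ := hf
            obtain rfl : x = p := hxf
            simp only at hC
            rw [components_inter_singleton_of_notMem hL.notMem] at hC
            exact hC
          | succ k => simp [faces_succ] at hf
  | succ m =>
    have hZ : ∀ j : {j // x ∈ (s j).carrier}, ∃ Q : FacedSet M, Q.carrier = L ∩ (s j).carrier ∧
        IsCompactSmoothPolyhedron E L m Q ∧
        ∀ k C, (∃ c ∈ Q.faces k, c.carrier = C) ↔
          ∃ f ∈ (s j).faces k, x ∈ f.carrier ∧ C ∈ components (L ∩ f.carrier) :=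
      fun j => (hlink j j.2).exists_polyhedron
    choose Z hZc hZp hZf using hZ
    have hne : ∀ {j j' : {j // x ∈ (s j).carrier}}, j ≠ j' → j.1 ≠ j'.1 :=
      fun h h' => h (Subtype.ext h')
    have hcov : (L ∩ F.carrier) \ (L ∩ F.interior) = ⋃ j, (Z j).carrier := by
      rw [hKI]
      ext y
      simp only [mem_iUnion, hZc]
      constructor
      · rintro ⟨j, hy⟩
        refine ⟨⟨j, ?_⟩, hy⟩
        by_contra h
        rw [hdisj' j h] at hy
        exact hy
      · rintro ⟨j, hy⟩
        exact ⟨j, hy⟩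
    have hZinter : ∀ j j', j ≠ j' → (Z j).carrier ∩ (Z j').carrier ⊆ (Z j).boundary := by
      rintro j j' hjj' y ⟨hy, hy'⟩
      -- A point interior to a face of the link of one side is interior to that side, so it cannot
      -- lie on another side.
      refine ⟨hy, fun h => ?_⟩
      obtain ⟨c, hc, hyc⟩ := mem_iUnion₂.1 h
      obtain ⟨f, hf, hxf, hC⟩ := (hZf j 0 c.carrier).1 ⟨c, hc, rfl⟩
      have h1 : c.interior = c.carrier ∩ f.interior :=
        ((hZp j).face_spec hc).2.1.interior_eq.trans ((hlink j j.2).interior_eq 0 f hf hxf _ hC)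
      rw [h1] at hyc
      rw [hZc] at hy hy'
      have h2 := (hinter j j' (hne hjj')).subset ⟨hy.2, hy'.2⟩
      exact h2.1.2 (mem_biUnion hf hyc.2)
    have hZfaces : ∀ j j', j ≠ j' → ∀ y ∈ (Z j).carrier ∩ (Z j').carrier,
        ∃ k, ∃ e ∈ (Z j).faces k, e ∈ (Z j').faces k ∧ y ∈ e.carrier := by
      rintro j j' hjj' y ⟨hy, hy'⟩
      rw [hZc] at hy hy'
      obtain ⟨U, hU, hUeq⟩ := hinterf j j' (hne hjj')
      obtain ⟨f, hfU, hyf⟩ := mem_iUnion₂.1 (hUeq.subset ⟨hy.2, hy'.2⟩)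
      obtain ⟨k, hf, hf'⟩ := hU f hfU
      have hxf : x ∈ f.carrier := by
        by_contra h
        exact (hdisj j k f hf h).ne_of_mem hy.1 hyf rfl
      have hC : connectedComponentIn (L ∩ f.carrier) y ∈ components (L ∩ f.carrier) :=
        ⟨y, ⟨hy.1, hyf⟩, rfl⟩
      obtain ⟨c, hc, hcC⟩ := (hZf j k _).2 ⟨f, hf, hxf, hC⟩
      obtain ⟨c', hc', hcC'⟩ := (hZf j' k _).2 ⟨f, hf', hxf, hC⟩
      -- The faces arising from the two sides are the same component of `L ∩ f` and have the same
      -- dimension, so their interiors agree as well.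
      have heq := ((hZp j).face_spec hc).2.1.eq_of_carrier_eq ((hZp j').face_spec hc').2.1
        (hcC.trans hcC'.symm)
      refine ⟨k, c, hc, heq ▸ hc', ?_⟩
      rw [hcC]
      exact mem_connectedComponentIn ⟨hy.1, hyf⟩
    obtain ⟨Q, hQc, hQp, hQ0, hQs⟩ := exists_polyhedron_of_components hW inter_subset_left hK hKW
      hIK hfin hcl hint' Z hZp hcov hZinter hZfaces
    refine ⟨Q, hQc, hQp, fun C => ?_, fun k C => ?_⟩
    · rw [hQ0]
      constructor
      · rintro ⟨_, ⟨C, hC, rfl⟩, rfl⟩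
        exact hC
      · intro hC
        exact ⟨_, ⟨C, hC, rfl⟩, rfl⟩
    · rw [hQs]
      simp only [mem_iUnion]
      constructor
      · rintro ⟨c, ⟨j, hc⟩, hcC⟩
        exact ⟨j, (hZf j k C).1 ⟨c, hc, hcC⟩⟩
      · rintro ⟨j, f, hf, hxf, hC⟩
        obtain ⟨c, hc, hcC⟩ := (hZf ⟨j, ((hpoly j).face_spec hf).2.2 hxf⟩ k C).2 ⟨f, hf, hxf, hC⟩
        exact ⟨c, ⟨_, hc⟩, hcC⟩

/-- The filter of small regular pieces of level sets of `r` close to `x`. -/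
def levels (E : Type*) [NormedAddCommGroup E] [NormedSpace ℝ E]
    {M : Type*} [TopologicalSpace M] [ChartedSpace E M] (r : M → ℝ) (x : M) : Filter (Set M) :=
  (𝓝 x).smallSets ⊓ 𝓟 {L | IsLevel E r x L}

theorem eventually_levels_isLevel : ∀ᶠ L in levels E r x, IsLevel E r x L :=
  mem_inf_of_right (mem_principal_self _)

theorem eventually_levels_forall {p : M → Prop} (h : ∀ᶠ q in 𝓝 x, p q) :
    ∀ᶠ L in levels E r x, ∀ q ∈ L, p q :=
  mem_inf_of_left (eventually_smallSets_forall.2 h)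

theorem eventually_levels_isTransverse (hr : ∀ᶠ q in 𝓝 x, ContMDiffAt 𝓘(ℝ, E) 𝓘(ℝ, ℝ) ∞ r q)
    (hrad : IsRadial E r x) {S : Set M} (hS : IsSubmanifold E d S) (hx : x ∈ S) :
    ∀ᶠ L in levels E r x, ∀ z ∈ L ∩ S, IsTransverse E r S z := by
  filter_upwards [eventually_levels_isLevel,
    eventually_levels_forall (hrad.eventually_isTransverse hr hS hx)] with L hL h
  exact fun z hz => h z hz.1 hz.2 fun hzx => hL.notMem (hzx ▸ hz.1)

theorem IsCompactSmoothPolyhedron.eventually_levels_disjoint {A : Set M} {P : FacedSet M}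
    (hP : IsCompactSmoothPolyhedron E A d P) :
    ∀ᶠ L in levels E r x, ∀ k, ∀ f ∈ P.faces k, x ∉ f.carrier → Disjoint L f.carrier := by
  have h : ∀ᶠ L in levels E r x, ∀ f ∈ {f | ∃ k, f ∈ P.faces k}, x ∉ f.carrier →
      Disjoint L f.carrier := by
    rw [eventually_all_finite hP.finite_faces]
    rintro f ⟨k, hf⟩
    by_cases hx : x ∈ f.carrier
    · exact Eventually.of_forall fun L h => absurd hx h
    · have := (hP.face_spec hf).2.1.isCompact.isClosed.isOpen_compl.mem_nhds hx
      filter_upwards [eventually_levels_forall this] with L hL _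
      exact disjoint_left.2 hL
  exact h.mono fun L hL k f hf => hL f ⟨k, hf⟩

/-- Induction on the dimension. Only the codimension `0` face through `x` matters, the others being
avoided by small `L`. The filter `levels` combines the finitely many smallness conditions. -/
theorem IsCompactSmoothPolyhedron.eventually_hasLink {P : FacedSet M}
    (hP : IsCompactSmoothPolyhedron E univ d P)
    (hr : ∀ᶠ q in 𝓝 x, ContMDiffAt 𝓘(ℝ, E) 𝓘(ℝ, ℝ) ∞ r q) (hrad : IsRadial E r x)
    (hx : x ∈ P.carrier) : ∀ᶠ L in levels E r x, HasLink E x d P L := by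
  have hP' := hP
  induction hP with
  | zero P finite subset faces_zero faces_succ =>
    filter_upwards [eventually_levels_isLevel, hP'.eventually_levels_disjoint] with L hL hdisj
    have hempty : ∀ k, ∀ f ∈ P.faces k, x ∈ f.carrier → components (L ∩ f.carrier) = ∅ := by
      intro k f hf hxf
      cases k with
      | zero =>
        rw [faces_zero] at hf
        obtain ⟨p, hp, rfl⟩ := hf
        obtain rfl : x = p := hxf
        exact components_inter_singleton_of_notMem hL.notMem
      | succ k => simp [faces_succ] at hf
    have hLP : L ∩ P.carrier = ∅ := by
      rw [eq_empty_iff_forall_notMem]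
      rintro y ⟨hyL, hyP⟩
      have hy : (⟨{y}, {y}⟩ : Face M) ∈ P.faces 0 := by
        rw [faces_zero]; exact ⟨y, hyP, rfl⟩
      by_cases hxy : x = y
      · exact hL.notMem (hxy ▸ hyL)
      · exact (hdisj 0 _ hy hxy).ne_of_mem hyL rfl rfl
    -- The link of a point is empty; here `d - 1` is `0` by truncated subtraction, and the empty set
    -- is a polyhedron of dimension `0`.
    refine ⟨fun k f hf hxf C hC => ?_, ⟨∅, fun _ => ∅⟩, hLP.symm, ?_, fun k C => ?_⟩
    · rw [hempty k f hf hxf] at hC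
      exact absurd hC (notMem_empty C)
    · refine .zero _ finite_empty (empty_subset _) ?_ fun k => rfl
      simp
    · constructor
      · rintro ⟨c, hc, -⟩
        exact absurd hc (notMem_empty c)
      · rintro ⟨f, hf, hxf, hC⟩
        rw [hempty k f hf hxf] at hC
        exact absurd hC (notMem_empty C)
  | succ d P m F S n s carrier_eq disjoint connected compact submanifold submanifold_connected
      submanifold_subset subset_submanifold interior_eq interior_nonempty closure_interior
      boundary_eq side_connected side_polyhedron sides_inter sides_inter_faces faces_zero
      faces_succ ih =>
    have hx' := hx
    rw [carrier_eq] at hx'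
    obtain ⟨i, hxi⟩ := mem_iUnion.1 hx'
    have hside : ∀ i' j, (s i' j).carrier ⊆ (F i').carrier := fun i' j => by
      have : (s i' j).carrier ⊆ (F i').boundary := by
        rw [boundary_eq]; exact subset_iUnion (fun j => (s i' j).carrier) j
      exact this.trans sdiff_subset
    have hF : ∀ i', x ∈ (F i').carrier → i' = i := fun i' h => by
      by_contra hne
      exact (disjoint i' i hne).ne_of_mem h hxi rfl
    have hlink : ∀ᶠ L in levels E r x, ∀ j, x ∈ (s i j).carrier → HasLink E x d (s i j) L := by
      rw [eventually_all]
      intro j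
      by_cases hxj : x ∈ (s i j).carrier
      · exact (ih i j hxj (side_polyhedron i j)).mono fun L h _ => h
      · exact Eventually.of_forall fun L h => absurd h hxj
    have htr : ∀ᶠ L in levels E r x, ∀ j, x ∈ (s i j).carrier → ∀ g ∈ (s i j).faces 0,
        ∀ z ∈ L ∩ g.interior, IsTransverse E r g.interior z := by
      rw [eventually_all]
      intro j
      by_cases hxj : x ∈ (s i j).carrier
      · obtain ⟨g, hg, hgc⟩ := (side_polyhedron i j).exists_faces_zero_eq (side_connected i j)
        have hgs := ((side_polyhedron i j).face_spec (hg ▸ mem_singleton g)).2.1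
        obtain ⟨S', hS', hgS', hgi⟩ := hgs.exists_submanifold
        filter_upwards [eventually_levels_isTransverse hr hrad hS' (hgS' (hgc ▸ hxj))]
          with L hL _ g' hg' z hz
        rw [hg] at hg'
        obtain rfl : g' = g := hg'
        rw [hgi] at hz ⊢
        exact (hL z ⟨hz.1, (mem_relInterior.1 hz.2).1⟩).of_nhdsWithin
          (relInterior_mem_nhdsWithin hz.2)
      · exact Eventually.of_forall fun L h => absurd h hxj
    filter_upwards [eventually_levels_isLevel, hP'.eventually_levels_disjoint, hlink, htr,
      eventually_levels_isTransverse hr hrad (submanifold i) (subset_submanifold i hxi)]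
      with L hL hdisj hlink htr htrS
    have hdisj' : ∀ j k, ∀ f ∈ (s i j).faces k, x ∉ f.carrier → Disjoint L f.carrier := by
      intro j k f hf
      refine hdisj (k + 1) f ?_
      simp only [faces_succ, mem_iUnion]
      exact ⟨i, j, hf⟩
    obtain ⟨hint, Q, hQc, hQp, hQ0, hQs⟩ := exists_link_of_face (submanifold i)
      (subset_submanifold i) (compact i) (interior_eq i) (closure_interior i) (boundary_eq i)
      (side_connected i) (side_polyhedron i) (sides_inter i) (sides_inter_faces i) hL htrS hlink htr
      hdisj'
    have hmem_zero : ∀ f ∈ P.faces 0, x ∈ f.carrier → f = F i := by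
      intro f hf hxf
      rw [faces_zero] at hf
      obtain ⟨i', rfl⟩ := hf
      rw [hF i' hxf]
    have hmem_succ : ∀ k, ∀ f ∈ P.faces (k + 1), x ∈ f.carrier → ∃ j, f ∈ (s i j).faces k := by
      intro k f hf hxf
      simp only [faces_succ, mem_iUnion] at hf
      obtain ⟨i', j, hf⟩ := hf
      obtain rfl := hF i' (hside i' j (((side_polyhedron i' j).face_spec hf).2.2 hxf))
      exact ⟨j, hf⟩
    refine ⟨fun k f hf hxf C hC => ?_, Q, ?_, hQp, fun k C => ?_⟩
    · cases k with
      | zero =>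
        obtain rfl := hmem_zero f hf hxf
        exact hint C hC
      | succ k =>
        obtain ⟨j, hfj⟩ := hmem_succ k f hf hxf
        have hxj := ((side_polyhedron i j).face_spec hfj).2.2 hxf
        rw [← (hlink j hxj).interior_eq k f hfj hxf C hC]
        congr 1
        omega
    · rw [hQc, carrier_eq]
      refine subset_antisymm
        (inter_subset_inter_right _ (subset_iUnion (fun i => (F i).carrier) i)) ?_
      rintro y ⟨hyL, hy⟩
      obtain ⟨i', hyi'⟩ := mem_iUnion.1 hy
      have hxi' : x ∈ (F i').carrier := by
        by_contra h
        exact (hdisj 0 (F i') (faces_zero ▸ mem_range_self i') h).ne_of_mem hyL hyi' rfl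
      rw [← hF i' hxi']
      exact ⟨hyL, hyi'⟩
    · cases k with
      | zero =>
        rw [hQ0]
        constructor
        · exact fun hC => ⟨F i, faces_zero ▸ mem_range_self i, hxi, hC⟩
        · rintro ⟨f, hf, hxf, hC⟩
          rwa [hmem_zero f hf hxf] at hC
      | succ k =>
        rw [hQs]
        constructor
        · rintro ⟨j, f, hf, hxf, hC⟩
          refine ⟨f, ?_, hxf, hC⟩
          simp only [faces_succ, mem_iUnion]
          exact ⟨i, j, hf⟩
        · rintro ⟨f, hf, hxf, hC⟩
          obtain ⟨j, hfj⟩ := hmem_succ k f hf hxf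
          exact ⟨j, f, hfj, hxf, hC⟩

theorem isSubmanifold_univ : IsSubmanifold E (Module.finrank ℝ E) (univ : Set M) := fun p _ =>
  ⟨chartAt E p, IsManifold.chart_mem_maximalAtlas p, mem_chart_source E p, ⊤, finrank_top ℝ E,
    fun _ _ => by simp⟩

end Link

/-! ### Small metric spheres -/

section Sphere

variable {E : Type*} [NormedAddCommGroup E] [NormedSpace ℝ E] [FiniteDimensional ℝ E]
    {M : Type*} [EMetricSpace M] [ChartedSpace E M] [IsManifold 𝓘(ℝ, E) ∞ M]

/-- Where the distance is `√r`, having the same distance to `x` means having the same value of `r`,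
so small spheres are level sets as required by `levels`. -/
theorem exists_forall_sphere {r : M → ℝ} {x : M}
    (hr : ∀ᶠ y in 𝓝 x, edist y x = ENNReal.ofReal √(r y) ∧
      ContMDiffAt 𝓘(ℝ, E) 𝓘(ℝ, ℝ) ∞ r y ∧ 0 ≤ r y) {p : Set M → Prop}
    (hp : ∀ᶠ L in levels E r x, p L) :
    ∃ δ₀ : ℝ, 0 < δ₀ ∧ ∀ δ : ℝ, 0 < δ → δ ≤ δ₀ → p (sphere x δ) := by
  rw [levels, eventually_inf_principal, eventually_smallSets] at hp
  obtain ⟨O, hO, hpO⟩ := hp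
  obtain ⟨ε, hε, hball⟩ := EMetric.mem_nhds_iff.1
    (inter_mem (eventually_eventually_nhds.2 hr) hO)
  -- With `δ₀` below the radius of a ball of good points, whole spheres of radius at most `δ₀` lie
  -- in that ball, with no distant parts.
  obtain ⟨δ₀, hδ₀, hδε⟩ := ENNReal.lt_iff_exists_real_btwn.1 hε
  have hδ₀pos : 0 < δ₀ := by simpa using hδε.1
  refine ⟨δ₀, hδ₀pos, fun δ hδ hδδ₀ => ?_⟩
  have hsub : ∀ y ∈ sphere x δ, (∀ᶠ y in 𝓝 y, edist y x = ENNReal.ofReal √(r y) ∧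
      ContMDiffAt 𝓘(ℝ, E) 𝓘(ℝ, ℝ) ∞ r y ∧ 0 ≤ r y) ∧ y ∈ O := by
    intro y hy
    refine hball ?_
    have hy' : edist y x = ENNReal.ofReal δ := hy
    exact (hy'.trans_le (ENNReal.ofReal_le_ofReal hδδ₀)).trans_lt hδε.2
  refine hpO _ (fun y hy => (hsub y hy).2) ⟨?_, ?_, ?_, ?_⟩
  · exact isClosed_eq (continuous_id.edist continuous_const) continuous_const
  · intro h
    have h' : edist x x = ENNReal.ofReal δ := h
    rw [edist_self, eq_comm, ENNReal.ofReal_eq_zero] at h'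
    exact h'.not_gt hδ
  · exact fun z hz => (hsub z hz).1.mono fun q hq => hq.2.1
  · intro z hz
    obtain ⟨hz1, -, hz2⟩ := (hsub z hz).1.self_of_nhds
    have hz' : edist z x = ENNReal.ofReal δ := hz
    filter_upwards [(hsub z hz).1] with q hq
    rw [← Real.sqrt_inj hq.2.2 hz2,
      ← ENNReal.ofReal_eq_ofReal_iff (Real.sqrt_nonneg _) (Real.sqrt_nonneg _), ← hq.1, ← hz1, hz']
    exact Iff.rfl

end Sphere

end SmoothPolyhedra
-- Assembly: the link construction applied to small metric spheres.
theorem lemma3p2 {E : Type*} [NormedAddCommGroup E] [NormedSpace ℝ E] [FiniteDimensional ℝ E]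
    {M : Type*} [EMetricSpace M] [ChartedSpace E M] [IsManifold 𝓘(ℝ, E) ∞ M]
    [RiemannianBundle (fun x : M => TangentSpace 𝓘(ℝ, E) x)]
    [IsContMDiffRiemannianBundle 𝓘(ℝ, E) ∞ E (fun x : M => TangentSpace 𝓘(ℝ, E) x)]
    [IsRiemannianManifold 𝓘(ℝ, E) M] [CompleteSpace M]
    (d : ℕ) (P : SmoothPolyhedra.FacedSet M)
    (hP : SmoothPolyhedra.IsCompactSmoothPolyhedron E Set.univ d P)
    (x : M) (hx : x ∈ P.carrier) :
    ∃ δ₀ : ℝ, 0 < δ₀ ∧ ∀ δ : ℝ, 0 < δ → δ ≤ δ₀ →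
      -- the sphere is a smooth hypersurface
      SmoothPolyhedra.IsSubmanifold E (Module.finrank ℝ E - 1) (SmoothPolyhedra.sphere x δ) ∧
      -- it intersects only the faces of `P` that properly contain `x`
      (∀ k, ∀ f ∈ P.faces k,
        (SmoothPolyhedra.sphere x δ ∩ f.carrier).Nonempty → {x} ⊂ f.carrier) ∧
      -- its intersection with `P` is a compact smooth polyhedron `Q` in it
      ∃ Q : SmoothPolyhedra.FacedSet M,
        Q.carrier = SmoothPolyhedra.sphere x δ ∩ P.carrier ∧
        SmoothPolyhedra.IsCompactSmoothPolyhedron E (SmoothPolyhedra.sphere x δ) (d - 1) Q ∧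
        -- the codimension `k` faces of `Q` are the connected components of the intersections of
        -- the sphere with the codimension `k` faces of `P` containing `x`
        (∀ k, ∀ C : Set M, (∃ c ∈ Q.faces k, c.carrier = C) ↔
          ∃ f ∈ P.faces k, x ∈ f.carrier ∧ ∃ y ∈ SmoothPolyhedra.sphere x δ ∩ f.carrier,
            C = connectedComponentIn (SmoothPolyhedra.sphere x δ ∩ f.carrier) y) ∧
        -- the interior of a face of `Q` comes from the interior of the corresponding face of `P`
        (∀ k, ∀ c ∈ Q.faces k, ∀ f ∈ P.faces k, x ∈ f.carrier →
          ∀ y ∈ SmoothPolyhedra.sphere x δ ∩ f.carrier,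
            c.carrier = connectedComponentIn (SmoothPolyhedra.sphere x δ ∩ f.carrier) y →
            c.interior = c.carrier ∩ f.interior) := by

  open SmoothPolyhedra Filter Topology in
  obtain ⟨r, hr0, c, hc, hr⟩ := exists_smooth_sq_dist (E := E) x
  have hsm : ∀ᶠ q in 𝓝 x, ContMDiffAt 𝓘(ℝ, E) 𝓘(ℝ, ℝ) ∞ r q := hr.mono fun _ h => h.2.1
  have hrad : IsRadial E r x := isRadial_of_le hr0 hsm hc (hr.mono fun y h => by simpa using h.2.2)
  obtain ⟨δ₀, hδ₀, h⟩ := exists_forall_sphere (hr.mono fun y h => ⟨h.1, h.2.1, le_trans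
    (by positivity) h.2.2⟩) (eventually_levels_isLevel.and
      ((hP.eventually_levels_disjoint (E := E) (r := r) (x := x)).and
        ((hP.eventually_hasLink hsm hrad hx).and
          (eventually_levels_isTransverse hsm hrad isSubmanifold_univ (mem_univ x)))))
  refine ⟨δ₀, hδ₀, fun δ hδ hδ' => ?_⟩
  obtain ⟨hL, hdisj, hlink, htr⟩ := h δ hδ hδ'
  generalize sphere x δ = L at *
  have hcomp : ∀ f : Face M, ∀ C : Set M, C ∈ components (L ∩ f.carrier) ↔
      ∃ y ∈ L ∩ f.carrier, C = connectedComponentIn (L ∩ f.carrier) y := fun f C =>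
    exists_congr fun y => and_congr_right fun _ => eq_comm
  -- The claim on the sphere itself is the slicing of the submanifold `univ`.
  refine ⟨by simpa using hL.isSubmanifold_inter isSubmanifold_univ htr, ?_, ?_⟩
  · rintro k f hf ⟨y, hyL, hyf⟩
    have hxf : x ∈ f.carrier := by
      by_contra h
      exact (hdisj k f hf h).ne_of_mem hyL hyf rfl
    refine (ssubset_iff_of_subset (singleton_subset_iff.2 hxf)).2 ⟨y, hyf, fun h => ?_⟩
    obtain rfl : y = x := h
    exact hL.notMem hyL
  · obtain ⟨Q, hQ, hQp, hQf⟩ := hlink.exists_polyhedron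
    refine ⟨Q, hQ, hQp, fun k C => ?_, fun k _ hc f hf hxf y hy hcy => ?_⟩
    · simp only [hQf, hcomp]
    · rw [(hQp.face_spec hc).2.1.interior_eq]
      exact hlink.interior_eq k f hf hxf _ ((hcomp f _).2 ⟨y, hy, hcy⟩)
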